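/- **Conventions.** All categories of coefficients are Grothendieck categories and "small" refers to a fixed universe. A *localizing subcategory* of an abelian category is a Serre subcategory closed under small coproducts. For a localizing subcategory $\mathcal Q$ of a Grothendieck category $\mathcal D$, let $\mathcal D/\mathcal Q$ be the quotient category, $X\mapsto X_{\mathcal Q}$ the exact $\mathcal Q$-localization functor $\mathcal D\to\mathcal D/\mathcal Q$, and recall that $\mathcal D/\mathcal Q$ is identified with the full subcategory of $\mathcal Q$-local objects of $\mathcal D$. For localizing subcategories $\mathcal Q,\mathcal S\subset\mathcal D$ let $\mathcal S^{\mathcal Q}\subset\mathcal D/\mathcal Q$ be the full subcategory of the objects isomorphic to $X_{\mathcal Q}$ with $X\in\mathcal S$, and let the *join* of $\mathcal Q$ and $\mathcal S$ be the smallest localizing subcategory of $\mathcal D$ containing both. We say that $\mathcal S$ has the *strict Voevodsky property with respect to $\mathcal Q$* if * the $\mathcal Q$-localization of every object of $\mathcal S$, viewed as a $\mathcal Q$-local object of $\mathcal D$, is in $\mathcal S$; and * for every K-injective complex $Z$ in $\mathcal D/\mathcal Q$ whose homology objects, computed in $\mathcal D/\mathcal Q$, are in $\mathcal S^{\mathcal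 Q}$, the homology objects, computed in $\mathcal D$, of $Z$ viewed as a complex of $\mathcal Q$-local objects of $\mathcal D$ are in $\mathcal S$. A *recollement* $\mathcal B\xrightarrow{\iota}\mathcal T\xrightarrow{\rho}\mathcal E$ of triangulated categories consists of triangulated functors $\iota,\rho$ with triangulated adjoints $\iota_L\dashv\iota\dashv\iota_R$ and $\rho_L\dashv\rho\dashv\rho_R$, such that $\iota,\rho_L,\rho_R$ are fully faithful and $\operatorname{Im}\iota=\operatorname{Ker}\rho$. **Theorem.** Let $\mathcal V$ be a closed symmetric monoidal Grothendieck category, $\mathcal C$ a small $\mathcal V$-category, and $[\mathcal C,\mathcal V]$ the category of $\mathcal V$-functors $\mathcal C\to\mathcal V$ and $\mathcal V$-natural transformations. Suppose that the derived category $D(\mathcal V)$ is compactly generated, with a set $\{P_j\}_{j\in J}$ of complexes as compact generators, and that at least one of the following holds: 1. each $P_j$ is K-projective; 2. for every K-injective complex $Y$ in $[\mathcal C,\mathcal V]$ and every $c\in\mathcal C$ the complex $Y(c)$ in $\mathcal V$ is K-injective; 3. $\mathrm{Ch}(\mathcal V)$ has a model structure whose weak equivalences are the quasi-isomorphisms,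 such that for every complex $Y$ in $[\mathcal C,\mathcal V]$ that is injective fibrant (that is, $Y\to 0$ has the right lifting property with respect to all monomorphisms that are quasi-isomorphisms) and every $c\in\mathcal C$ the complex $Y(c)$ is fibrant. Let $\mathcal A$ be a collection of objects of $\mathcal C$, let $\mathcal S_{\mathcal A}=\{Y\in[\mathcal C,\mathcal V]\mid Y(a)=0\text{ for all }a\in\mathcal A\}$, let $\mathcal Q\subset[\mathcal C,\mathcal V]$ be a localizing subcategory, and let $\mathcal J_{\mathcal A}$ be the join of $\mathcal Q$ and $\mathcal S_{\mathcal A}$. Suppose that * $D([\mathcal C,\mathcal V]/\mathcal Q)$ is compactly generated and the functor $D[\mathcal C,\mathcal V]\to D([\mathcal C,\mathcal V]/\mathcal Q)$ induced by $\mathcal Q$-localization preserves compact objects; * $\mathcal S_{\mathcal A}$ has the strict Voevodsky property with respect to $\mathcal Q$. Then $\mathcal S_{\mathcal A}$ is localizing in $[\mathcal C,\mathcal V]$, $\mathcal S_{\mathcal A}^{\mathcal Q}$ is localizing in $[\mathcal C,\mathcal V]/\mathcal Q$, the canonical functor $\ell:[\mathcal C,\mathcal V]/\mathcal Q\to[\mathcal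 C,\mathcal V]/\mathcal J_{\mathcal A}$ is the localization functor with respect to $\mathcal S_{\mathcal A}^{\mathcal Q}$, and there is a recollement of triangulated categories $$\mathcal E_{\mathcal A}^{\mathcal Q}\xrightarrow{\ \iota\ }D([\mathcal C,\mathcal V]/\mathcal Q)\xrightarrow{\ \lambda\ }D([\mathcal C,\mathcal V]/\mathcal J_{\mathcal A})$$ in which $\mathcal E_{\mathcal A}^{\mathcal Q}$ is the full triangulated subcategory of the complexes whose homology objects, computed in $[\mathcal C,\mathcal V]/\mathcal Q$, are in $\mathcal S_{\mathcal A}^{\mathcal Q}$, $\iota$ is the inclusion, $\lambda$ is induced by the exact functor $\ell$, and the right adjoint $\lambda_R$ of $\lambda$ is induced by K-injective resolutions: $\lambda_R\cong s\circ k$, where $k$ is a K-injective resolution functor on $D([\mathcal C,\mathcal V]/\mathcal J_{\mathcal A})$ and $s$ is the right adjoint of $\ell$, applied termwise to complexes. -/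

import Mathlib

open CategoryTheory CategoryTheory.Limits MonoidalCategory MonoidalClosed

universe w w₁ w₂ w₃ w₄ v u v₁ u₁

noncomputable section

section EnrichedFunctors

variable (V : Type u) [Category.{v} V] [MonoidalCategory V] [MonoidalClosed V]
  (C : Type u₁) [EnrichedCategory V C]

/-- A `V`-functor from the `V`-category `C` to the closed monoidal category `V`, which is
regarded as a `V`-category by means of its internal hom. This is a one-field wrapper, because
the category structure that Mathlib puts on `EnrichedFunctor` has as its morphisms the natural
transformations between the underlying ordinary functors, and these are more general than
`V`-natural transformations. -/
structure VFunctor where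
  /-- the underlying enriched functor -/
  toEnriched : EnrichedFunctor V C V

namespace VFunctor

variable {V C}

/-- The value `F(c)` of a `V`-functor. -/
abbrev obj (F : VFunctor V C) (c : C) : V := F.toEnriched.obj c

/-- The structure morphism `C(a, b) ⟶ [F(a), F(b)]` of a `V`-functor. -/
abbrev map (F : VFunctor V C) (a b : C) : (a ⟶[V] b) ⟶ (ihom (F.obj a)).obj (F.obj b) :=
  F.toEnriched.map a b

/-- A `V`-natural transformation between `V`-functors `F, G : C ⟶ V`. A morphism
`𝟙_ V ⟶ [F(a), G(a)]` is the same thing as a morphism `F(a) ⟶ G(a)`, and the condition says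
that `C(a, b) ⟶ [F(a), F(b)] ⟶ [F(a), G(b)]` and `C(a, b) ⟶ [G(a), G(b)] ⟶ [F(a), G(b)]`
agree. -/
@[ext]
structure Hom (F G : VFunctor V C) where
  /-- the components -/
  app (c : C) : F.obj c ⟶ G.obj c
  naturality (a b : C) : F.map a b ≫ (ihom (F.obj a)).map (app b) =
    G.map a b ≫ (pre (app a)).app (G.obj b)

/-- The action `F(a) ⊗ C(a, b) ⟶ F(b)` adjoint to the structure morphism of `F`. -/
def act (F : VFunctor V C) (a b : C) : F.obj a ⊗ (a ⟶[V] b) ⟶ F.obj b :=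
  uncurry (F.map a b)

lemma whiskerLeft_compTranspose {X Y Z A B : V} (f : A ⟶ (ihom X).obj Y)
    (g : B ⟶ (ihom Y).obj Z) :
    X ◁ (f ⊗ₘ g) ≫ MonoidalClosed.compTranspose X Y Z =
      (α_ X A B).inv ≫ uncurry f ▷ B ≫ uncurry g := by
  rw [MonoidalClosed.compTranspose_eq, uncurry_eq, uncurry_eq]
  simp only [MonoidalCategory.tensorHom_def, MonoidalCategory.whiskerLeft_comp,
    comp_whiskerRight, Category.assoc]
  rw [associator_inv_naturality_right_assoc, associator_inv_naturality_middle_assoc]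
  simp only [whisker_exchange_assoc]
  rfl

lemma act_id (F : VFunctor V C) (a : C) :
    F.obj a ◁ eId V a ≫ F.act a a = (ρ_ (F.obj a)).hom := by
  unfold act
  rw [← uncurry_natural_left]
  erw [F.toEnriched.map_id a]
  rw [enrichedCategorySelf_id, MonoidalClosed.id_eq, uncurry_curry]

lemma act_comp (F : VFunctor V C) (a b c : C) :
    F.obj a ◁ eComp V a b c ≫ F.act a c =
      (α_ _ _ _).inv ≫ F.act a b ▷ (b ⟶[V] c) ≫ F.act b c := by
  unfold act
  rw [← uncurry_natural_left]
  erw [F.toEnriched.map_comp a b c]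
  rw [enrichedCategorySelf_comp, MonoidalClosed.comp_eq]
  erw [uncurry_natural_left]
  rw [uncurry_curry]
  exact whiskerLeft_compTranspose _ _

/-- Construction of a `V`-functor from its action morphisms. -/
def ofAct (X : C → V) (m : ∀ a b, X a ⊗ (a ⟶[V] b) ⟶ X b)
    (m_id : ∀ a, X a ◁ eId V a ≫ m a a = (ρ_ (X a)).hom)
    (m_comp : ∀ a b c, X a ◁ eComp V a b c ≫ m a c =
      (α_ _ _ _).inv ≫ m a b ▷ (b ⟶[V] c) ≫ m b c) : VFunctor V C where
  toEnriched :=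
    { obj := X
      map := fun a b => curry (m a b)
      map_id := fun a => by
        erw [← curry_natural_left]
        rw [m_id]; rfl
      map_comp := fun a b c => by
        erw [← curry_natural_left]
        rw [m_comp, curry_eq_iff]
        erw [uncurry_natural_left]
        rw [enrichedCategorySelf_comp, MonoidalClosed.comp_eq, uncurry_curry]
        erw [whiskerLeft_compTranspose]
        rw [uncurry_curry, uncurry_curry] }

lemma ofAct_act (X : C → V) (m : ∀ a b, X a ⊗ (a ⟶[V] b) ⟶ X b) (m_id) (m_comp) (a b : C) :
    (ofAct X m m_id m_comp).act a b = m a b :=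
  uncurry_curry _

lemma naturality_iff (F G : VFunctor V C) (app : ∀ c, F.obj c ⟶ G.obj c) (a b : C) :
    F.map a b ≫ (ihom (F.obj a)).map (app b) = G.map a b ≫ (pre (app a)).app (G.obj b) ↔
      F.act a b ≫ app b = app a ▷ (a ⟶[V] b) ≫ G.act a b := by
  unfold act
  rw [← uncurry_natural_right, ← uncurry_pre_app]
  exact uncurry_injective.eq_iff.symm

/-- Construction of a `V`-natural transformation from its compatibility with the actions. -/
def Hom.ofAct {F G : VFunctor V C} (app : ∀ c, F.obj c ⟶ G.obj c)
    (h : ∀ a b, F.act a b ≫ app b = app a ▷ (a ⟶[V] b) ≫ G.act a b) : Hom F G where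
  app := app
  naturality a b := (naturality_iff F G app a b).2 (h a b)

lemma Hom.act_naturality {F G : VFunctor V C} (f : Hom F G) (a b : C) :
    F.act a b ≫ f.app b = f.app a ▷ (a ⟶[V] b) ≫ G.act a b :=
  (naturality_iff F G f.app a b).1 (f.naturality a b)

/-- The category `[C, V]` of `V`-functors and `V`-natural transformations. -/
instance : Category (VFunctor V C) where
  Hom F G := Hom F G
  id F := Hom.ofAct (fun _ => 𝟙 _) (by simp)
  comp f g := Hom.ofAct (fun c => f.app c ≫ g.app c) (fun a b => by
    rw [← Category.assoc, f.act_naturality, Category.assoc, g.act_naturality]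
    simp)
  id_comp f := Hom.ext (funext fun _ => Category.id_comp _)
  comp_id f := Hom.ext (funext fun _ => Category.comp_id _)
  assoc f g h := Hom.ext (funext fun _ => Category.assoc _ _ _)

lemma hom_ext {F G : VFunctor V C} {f g : F ⟶ G} (h : ∀ c, f.app c = g.app c) : f = g :=
  Hom.ext (funext h)

@[simp] lemma id_app (F : VFunctor V C) (c : C) : Hom.app (𝟙 F) c = 𝟙 _ := rfl

@[simp] lemma comp_app {F G H : VFunctor V C} (f : F ⟶ G) (g : G ⟶ H) (c : C) :
    (f ≫ g).app c = f.app c ≫ g.app c := rfl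

variable (V) in
/-- Evaluation `[C, V] ⥤ V` at an object of `C`. -/
@[simps]
def eval (c : C) : VFunctor V C ⥤ V where
  obj F := F.obj c
  map f := f.app c

lemma isIso_of_app {F G : VFunctor V C} (f : F ⟶ G) (h : ∀ c, IsIso (f.app c)) : IsIso f :=
  ⟨Hom.ofAct (fun c => inv (f.app c)) (fun a b => by
      rw [IsIso.comp_inv_eq, Category.assoc, f.act_naturality, ← comp_whiskerRight_assoc]
      simp), hom_ext fun c => IsIso.hom_inv_id _, hom_ext fun c => IsIso.inv_hom_id _⟩

section Limits

variable {J : Type w} [Category.{v₁} J] (K : J ⥤ VFunctor V C)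

section
variable [HasLimitsOfShape J V]

/-- The pointwise limit of a diagram of `V`-functors. -/
def limObj (c : C) : V := limit (K ⋙ eval V c)

/-- The projections of the pointwise limit. -/
def limπ (j : J) (c : C) : limObj K c ⟶ (K.obj j).obj c := limit.π (K ⋙ eval V c) j

@[simp] lemma limπ_w {i j : J} (φ : i ⟶ j) (c : C) :
    limπ K i c ≫ (K.map φ).app c = limπ K j c := limit.w (K ⋙ eval V c) φ

variable {K} in
lemma lim_hom_ext {c : C} {X : V} {f g : X ⟶ limObj K c}
    (h : ∀ j, f ≫ limπ K j c = g ≫ limπ K j c) : f = g := limit.hom_ext h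

/-- Morphisms to the pointwise limit. -/
def limLift {c : C} {X : V} (f : ∀ j, X ⟶ (K.obj j).obj c)
    (w : ∀ ⦃i j⦄ (φ : i ⟶ j), f i ≫ (K.map φ).app c = f j) : X ⟶ limObj K c :=
  limit.lift (K ⋙ eval V c)
    { pt := X
      π := { app := f, naturality := fun _ _ φ => (Category.id_comp _).trans (w φ).symm } }

@[simp] lemma limLift_π {c : C} {X : V} (f : ∀ j, X ⟶ (K.obj j).obj c) (w)
    (j : J) : limLift K f w ≫ limπ K j c = f j := limit.lift_π _ j

/-- The action of the pointwise limit. -/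
def limAct (a b : C) : limObj K a ⊗ (a ⟶[V] b) ⟶ limObj K b :=
  limLift K (fun j => limπ K j a ▷ _ ≫ (K.obj j).act a b) (fun _ _ φ => by
    rw [Category.assoc, (K.map φ).act_naturality, ← comp_whiskerRight_assoc, limπ_w])

lemma limAct_π (a b : C) (j : J) :
    limAct K a b ≫ limπ K j b = limπ K j a ▷ _ ≫ (K.obj j).act a b := limLift_π K _ _ j

/-- The pointwise limit of a diagram of `V`-functors, as a `V`-functor. -/
def lim : VFunctor V C :=
  ofAct (limObj K) (limAct K)
    (fun a => lim_hom_ext fun j => by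
      rw [Category.assoc, limAct_π, whisker_exchange_assoc, act_id, rightUnitor_naturality])
    (fun a b c => lim_hom_ext fun j => by
      rw [Category.assoc, limAct_π, whisker_exchange_assoc, act_comp]
      simp only [Category.assoc, limAct_π]
      rw [← comp_whiskerRight_assoc, limAct_π]
      simp)

lemma lim_act (a b : C) : (lim K).act a b = limAct K a b := ofAct_act _ _ _ _ a b

lemma limLift_natural (F : VFunctor V C) (t : ∀ j, F ⟶ K.obj j)
    (w : ∀ c, ∀ ⦃i j⦄ (φ : i ⟶ j), (t i).app c ≫ (K.map φ).app c = (t j).app c) (a b : C) :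
    F.act a b ≫ limLift K (fun j => (t j).app b) (w b) =
      limLift K (fun j => (t j).app a) (w a) ▷ _ ≫ (lim K).act a b := by
  have key : F.act a b ≫ limLift K (fun j => (t j).app b) (w b) =
      limLift K (fun j => (t j).app a) (w a) ▷ _ ≫ limAct K a b := by
    refine lim_hom_ext fun j => ?_
    rw [Category.assoc, Category.assoc, limAct_π, limLift_π, ← comp_whiskerRight_assoc,
      limLift_π, (t j).act_naturality]
  exact key.trans (congrArg (fun x : limObj K a ⊗ (a ⟶[V] b) ⟶ limObj K b =>
    _ ▷ _ ≫ x) (lim_act K a b).symm)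

/-- The pointwise limit cone. -/
def limitCone : Cone K where
  pt := lim K
  π :=
    { app := fun j => Hom.ofAct (limπ K j) (fun a b =>
        (congrArg (· ≫ limπ K j b) (lim_act K a b)).trans (limAct_π K a b j))
      naturality := fun _ _ φ => hom_ext fun c =>
        (Category.id_comp _).trans (limπ_w K φ c).symm }

/-- The pointwise limit is a limit. -/
def limitConeIsLimit : IsLimit (limitCone K) where
  lift s := Hom.ofAct (fun c => limLift K (fun j => (s.π.app j).app c)
      (fun _ _ φ => congrArg (fun f => Hom.app f c) (s.w φ))) (fun a b =>
    limLift_natural K s.pt s.π.app (fun c _ _ φ => congrArg (fun f => Hom.app f c) (s.w φ))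
      a b)
  fac s j := hom_ext fun c => limLift_π K (X := s.pt.obj c) (fun j => (s.π.app j).app c)
    (fun _ _ φ => congrArg (fun f => Hom.app f c) (s.w φ)) j
  uniq s _ h := hom_ext fun c => lim_hom_ext fun j =>
    (congrArg (fun f => Hom.app f c) (h j)).trans
      (limLift_π K (X := s.pt.obj c) (fun j => (s.π.app j).app c)
        (fun _ _ φ => congrArg (fun f => Hom.app f c) (s.w φ)) j).symm

instance : HasLimitsOfShape J (VFunctor V C) :=
  ⟨fun K => ⟨⟨_, limitConeIsLimit K⟩⟩⟩

instance (c : C) : PreservesLimitsOfShape J (eval V c : VFunctor V C ⥤ V) :=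
  ⟨fun {K} => preservesLimit_of_preserves_limit_cone (limitConeIsLimit K)
    ((limit.isLimit (K ⋙ eval V c)).ofIsoLimit (Cone.ext (Iso.refl _) (fun _ =>
      (Category.id_comp _).symm)))⟩

end

section
variable [HasColimitsOfShape J V]

/-- The pointwise colimit of a diagram of `V`-functors. -/
def colimObj (c : C) : V := colimit (K ⋙ eval V c)

/-- The coprojections of the pointwise colimit. -/
def colimι (j : J) (c : C) : (K.obj j).obj c ⟶ colimObj K c := colimit.ι (K ⋙ eval V c) j

@[simp] lemma colimι_w {i j : J} (φ : i ⟶ j) (c : C) :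
    (K.map φ).app c ≫ colimι K j c = colimι K i c := colimit.w (K ⋙ eval V c) φ

variable {K} in
lemma colim_hom_ext {c : C} {X : V} {f g : colimObj K c ⟶ X}
    (h : ∀ j, colimι K j c ≫ f = colimι K j c ≫ g) : f = g := colimit.hom_ext h

/-- Morphisms from the pointwise colimit. -/
def colimDesc {c : C} {X : V} (f : ∀ j, (K.obj j).obj c ⟶ X)
    (w : ∀ ⦃i j⦄ (φ : i ⟶ j), (K.map φ).app c ≫ f j = f i) : colimObj K c ⟶ X :=
  colimit.desc (K ⋙ eval V c)
    { pt := X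
      ι := { app := f, naturality := fun _ _ φ => (w φ).trans (Category.comp_id _).symm } }

@[simp] lemma colimι_desc {c : C} {X : V} (f : ∀ j, (K.obj j).obj c ⟶ X) (w)
    (j : J) : colimι K j c ≫ colimDesc K f w = f j := colimit.ι_desc _ j

variable [SymmetricCategory V]

/-- Tensoring with an object preserves the pointwise colimit. -/
def colimTensorIsColimit (c : C) (Y : V) :
    IsColimit ((tensorRight Y).mapCocone (colimit.cocone (K ⋙ eval V c))) :=
  isColimitOfPreserves (tensorRight Y) (colimit.isColimit _)

variable {K} in
lemma colim_tensor_hom_ext {c : C} {X Y : V} {f g : colimObj K c ⊗ Y ⟶ X}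
    (h : ∀ j, colimι K j c ▷ Y ≫ f = colimι K j c ▷ Y ≫ g) : f = g :=
  (colimTensorIsColimit K c Y).hom_ext h

variable {K} in
lemma colim_tensor_tensor_hom_ext {c : C} {X Y Z : V} {f g : (colimObj K c ⊗ Y) ⊗ Z ⟶ X}
    (h : ∀ j, colimι K j c ▷ Y ▷ Z ≫ f = colimι K j c ▷ Y ▷ Z ≫ g) : f = g :=
  (isColimitOfPreserves (tensorRight Z) (colimTensorIsColimit K c Y)).hom_ext h

/-- Morphisms from the tensor product of the pointwise colimit and an object. -/
def colimTensorDesc {c : C} {X Y : V} (f : ∀ j, (K.obj j).obj c ⊗ Y ⟶ X)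
    (w : ∀ ⦃i j⦄ (φ : i ⟶ j), (K.map φ).app c ▷ Y ≫ f j = f i) : colimObj K c ⊗ Y ⟶ X :=
  (colimTensorIsColimit K c Y).desc
    { pt := X
      ι := { app := f, naturality := fun _ _ φ => (w φ).trans (Category.comp_id _).symm } }

@[simp] lemma colimι_tensorDesc {c : C} {X Y : V}
    (f : ∀ j, (K.obj j).obj c ⊗ Y ⟶ X) (w) (j : J) :
    colimι K j c ▷ Y ≫ colimTensorDesc K f w = f j :=
  (colimTensorIsColimit K c Y).fac _ j

/-- The action of the pointwise colimit. -/
def colimAct (a b : C) : colimObj K a ⊗ (a ⟶[V] b) ⟶ colimObj K b :=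
  colimTensorDesc K (fun j => (K.obj j).act a b ≫ colimι K j b) (fun _ _ φ => by
    rw [← Category.assoc, ← (K.map φ).act_naturality, Category.assoc, colimι_w])

lemma ι_colimAct (a b : C) (j : J) :
    colimι K j a ▷ _ ≫ colimAct K a b = (K.obj j).act a b ≫ colimι K j b :=
  colimι_tensorDesc K _ _ j

/-- The pointwise colimit of a diagram of `V`-functors, as a `V`-functor. -/
def colim : VFunctor V C :=
  ofAct (colimObj K) (colimAct K)
    (fun a => colim_tensor_hom_ext fun j => by
      rw [← whisker_exchange_assoc, ι_colimAct, ← Category.assoc, act_id,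
        rightUnitor_naturality])
    (fun a b c => colim_tensor_hom_ext fun j => by
      rw [← whisker_exchange_assoc, ι_colimAct, ← Category.assoc, act_comp]
      rw [associator_inv_naturality_left_assoc, ← comp_whiskerRight_assoc, ι_colimAct]
      simp only [Category.assoc, comp_whiskerRight, ι_colimAct])

lemma colim_act (a b : C) : (colim K).act a b = colimAct K a b := ofAct_act _ _ _ _ a b

lemma colimDesc_natural (F : VFunctor V C) (t : ∀ j, K.obj j ⟶ F)
    (w : ∀ c, ∀ ⦃i j⦄ (φ : i ⟶ j), (K.map φ).app c ≫ (t j).app c = (t i).app c) (a b : C) :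
    (colim K).act a b ≫ colimDesc K (fun j => (t j).app b) (w b) =
      colimDesc K (fun j => (t j).app a) (w a) ▷ _ ≫ F.act a b := by
  have key : colimAct K a b ≫ colimDesc K (fun j => (t j).app b) (w b) =
      colimDesc K (fun j => (t j).app a) (w a) ▷ _ ≫ F.act a b := by
    refine colim_tensor_hom_ext fun j => ?_
    rw [← Category.assoc, ι_colimAct, Category.assoc, colimι_desc, ← comp_whiskerRight_assoc,
      colimι_desc, (t j).act_naturality]
  exact (congrArg (fun x : colimObj K a ⊗ (a ⟶[V] b) ⟶ colimObj K b => x ≫ _)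
    (colim_act K a b)).trans key

/-- The pointwise colimit cocone. -/
def colimitCocone : Cocone K where
  pt := colim K
  ι :=
    { app := fun j => Hom.ofAct (colimι K j) (fun a b =>
        (ι_colimAct K a b j).symm.trans (congrArg (_ ▷ _ ≫ ·) (colim_act K a b).symm))
      naturality := fun _ _ φ => hom_ext fun c =>
        (colimι_w K φ c).trans (Category.comp_id _).symm }

/-- The pointwise colimit is a colimit. -/
def colimitCoconeIsColimit : IsColimit (colimitCocone K) where
  desc s := Hom.ofAct (fun c => colimDesc K (fun j => (s.ι.app j).app c)
      (fun _ _ φ => congrArg (fun f => Hom.app f c) (s.w φ))) (fun a b =>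
    colimDesc_natural K s.pt s.ι.app (fun c _ _ φ => congrArg (fun f => Hom.app f c) (s.w φ))
      a b)
  fac s j := hom_ext fun c => colimι_desc K (X := s.pt.obj c) (fun j => (s.ι.app j).app c)
    (fun _ _ φ => congrArg (fun f => Hom.app f c) (s.w φ)) j
  uniq s _ h := hom_ext fun c => colim_hom_ext fun j =>
    (congrArg (fun f => Hom.app f c) (h j)).trans
      (colimι_desc K (X := s.pt.obj c) (fun j => (s.ι.app j).app c)
        (fun _ _ φ => congrArg (fun f => Hom.app f c) (s.w φ)) j).symm

instance : HasColimitsOfShape J (VFunctor V C) :=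
  ⟨fun K => ⟨⟨_, colimitCoconeIsColimit K⟩⟩⟩

instance (c : C) : PreservesColimitsOfShape J (eval V c : VFunctor V C ⥤ V) :=
  ⟨fun {K} => preservesColimit_of_preserves_colimit_cocone (colimitCoconeIsColimit K)
    ((colimit.isColimit (K ⋙ eval V c)).ofIsoColimit (Cocone.ext (Iso.refl _) (fun _ =>
      (Category.comp_id _))))⟩

end
end Limits

section Abelian

lemma app_injective (F G : VFunctor V C) :
    Function.Injective (fun (f : F ⟶ G) (c : C) => f.app c) :=
  fun _ _ h => Hom.ext h

variable [SymmetricCategory V] [Abelian V]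

instance tensorRight_additive (X : V) : (tensorRight X).Additive :=
  have : PreservesBinaryBiproducts (tensorRight X) :=
    preservesBinaryBiproducts_of_preservesBinaryCoproducts _
  Functor.additive_of_preservesBinaryBiproducts _

lemma zero_whisker (X Y Z : V) : (0 : X ⟶ Y) ▷ Z = 0 := (tensorRight Z).map_zero X Y
lemma add_whisker {X Y : V} (f g : X ⟶ Y) (Z : V) : (f + g) ▷ Z = f ▷ Z + g ▷ Z :=
  (tensorRight Z).map_add
lemma neg_whisker {X Y : V} (f : X ⟶ Y) (Z : V) : (-f) ▷ Z = -(f ▷ Z) :=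
  (tensorRight Z).map_neg
lemma sub_whisker {X Y : V} (f g : X ⟶ Y) (Z : V) : (f - g) ▷ Z = f ▷ Z - g ▷ Z :=
  (tensorRight Z).map_sub
lemma nsmul_whisker {X Y : V} (n : ℕ) (f : X ⟶ Y) (Z : V) : (n • f) ▷ Z = n • (f ▷ Z) :=
  (tensorRight Z).map_nsmul
lemma zsmul_whisker {X Y : V} (n : ℤ) (f : X ⟶ Y) (Z : V) : (n • f) ▷ Z = n • (f ▷ Z) :=
  (tensorRight Z).map_zsmul

variable (F G : VFunctor V C)

instance : Zero (F ⟶ G) := ⟨Hom.ofAct (fun _ => 0) (by simp [zero_whisker])⟩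
instance : Add (F ⟶ G) := ⟨fun f g => Hom.ofAct (fun c => f.app c + g.app c)
  (by simp [add_whisker, Hom.act_naturality])⟩
instance : Neg (F ⟶ G) := ⟨fun f => Hom.ofAct (fun c => -f.app c)
  (by simp [neg_whisker, Hom.act_naturality])⟩
instance : Sub (F ⟶ G) := ⟨fun f g => Hom.ofAct (fun c => f.app c - g.app c)
  (by simp [sub_whisker, Hom.act_naturality])⟩
instance : SMul ℕ (F ⟶ G) := ⟨fun n f => Hom.ofAct (fun c => n • f.app c)
  (by simp [nsmul_whisker, Hom.act_naturality])⟩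
instance : SMul ℤ (F ⟶ G) := ⟨fun n f => Hom.ofAct (fun c => n • f.app c)
  (by simp [zsmul_whisker, Hom.act_naturality])⟩

instance : AddCommGroup (F ⟶ G) :=
  (app_injective F G).addCommGroup (fun (f : F ⟶ G) (c : C) => f.app c)
    rfl (fun _ _ => rfl) (fun _ => rfl) (fun _ _ => rfl) (fun _ _ => rfl) (fun _ _ => rfl)

instance : Preadditive (VFunctor V C) where
  add_comp _ _ _ _ _ _ := hom_ext fun _ => Preadditive.add_comp _ _ _ _ _ _
  comp_add _ _ _ _ _ _ := hom_ext fun _ => Preadditive.comp_add _ _ _ _ _ _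

instance (c : C) : (eval V c : VFunctor V C ⥤ V).Additive where

instance (c : C) : PreservesFiniteLimits (eval V c : VFunctor V C ⥤ V) where
  preservesFiniteLimits _ _ _ := inferInstance

instance (c : C) : PreservesFiniteColimits (eval V c : VFunctor V C ⥤ V) where
  preservesFiniteColimits _ _ _ := inferInstance

instance : HasFiniteProducts (VFunctor V C) := ⟨fun _ => inferInstance⟩
instance : HasKernels (VFunctor V C) := ⟨fun _ => inferInstance⟩
instance : HasCokernels (VFunctor V C) := ⟨fun _ => inferInstance⟩

variable {F G} in
lemma isIso_coimageImageComparison (f : F ⟶ G) :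
    IsIso (Abelian.coimageImageComparison f) := by
  refine isIso_of_app _ fun c => ?_
  exact ((MorphismProperty.isomorphisms V).arrow_mk_iso_iff
    (Abelian.PreservesCoimageImageComparison.iso (eval V c) f)).2
    (inferInstanceAs (IsIso (Abelian.coimageImageComparison ((eval V c).map f))))

/-- The category `[C, V]` is abelian, with pointwise kernels and cokernels. -/
instance : Abelian (VFunctor V C) :=
  have : ∀ {F G : VFunctor V C} (f : F ⟶ G), IsIso (Abelian.coimageImageComparison f) :=
    fun f => isIso_coimageImageComparison f
  Abelian.ofCoimageImageComparisonIsIso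

end Abelian

end VFunctor
end EnrichedFunctors
section SerreQuotients

variable {D : Type u} [Category.{v} D] [Abelian D]

/-- A (Serre) localizing subcategory of an abelian category: a class of objects that contains
zero, is closed under subobjects, quotient objects and extensions, and is closed under small
coproducts. -/
structure IsLocalizing (P : ObjectProperty D) : Prop where
  isSerreClass : P.IsSerreClass
  closedUnderCoproducts (J : Type w) : P.IsClosedUnderColimitsOfShape (Discrete J)

/-- The join of two classes of objects: the smallest localizing subcategory containing both. -/
def join (Q S : ObjectProperty D) : ObjectProperty D := fun X =>
  ∀ R : ObjectProperty D, IsLocalizing.{w} R → Q ≤ R → S ≤ R → R X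

lemma le_join_left (Q S : ObjectProperty D) : Q ≤ join.{w} Q S := fun X hX _ _ hQ _ => hQ X hX

lemma le_join_right (Q S : ObjectProperty D) : S ≤ join.{w} Q S := fun X hX _ _ _ hS => hS X hX

lemma join_isLocalizing (Q S : ObjectProperty D) : IsLocalizing.{w} (join.{w} Q S) where
  isSerreClass :=
    { exists_zero := ⟨_, isZero_zero D, fun R hR _ _ => by
        have := hR.isSerreClass
        obtain ⟨Z, hZ, h⟩ := R.exists_prop_of_containsZero
        exact R.prop_of_iso (hZ.iso (isZero_zero D)) h⟩
      prop_of_mono := fun f _ hY R hR h₁ h₂ => by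
        have := hR.isSerreClass
        exact R.prop_of_mono f (hY R hR h₁ h₂)
      prop_of_epi := fun f _ hX R hR h₁ h₂ => by
        have := hR.isSerreClass
        exact R.prop_of_epi f (hX R hR h₁ h₂)
      prop_X₂_of_shortExact := fun hS hX₁ hX₃ R hR h₁ h₂ => by
        have := hR.isSerreClass
        exact R.prop_X₂_of_shortExact hS (hX₁ R hR h₁ h₂) (hX₃ R hR h₁ h₂) }
  closedUnderCoproducts J :=
    { colimitsOfShape_le := fun X hX R hR h₁ h₂ => by
        have := hR.closedUnderCoproducts J
        obtain ⟨hX⟩ := hX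
        exact R.prop_of_isColimit hX.isColimit (fun j => hX.prop_diag_obj j R hR h₁ h₂) }

instance (Q S : ObjectProperty D) : (join.{w} Q S).IsSerreClass :=
  (join_isLocalizing Q S).isSerreClass

/-- The quotient category `D / P` of an abelian category by a Serre class `P`, that is, the
localization of `D` with respect to the morphisms whose kernel and cokernel are in `P`. -/
abbrev SerreQuotient (P : ObjectProperty D) [P.IsSerreClass] := P.isoModSerre.Localization

/-- The quotient functor `D ⥤ D / P`, that is, the exact `P`-localization functor. -/
abbrev toQuotient (P : ObjectProperty D) [P.IsSerreClass] : D ⥤ SerreQuotient P :=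
  P.isoModSerre.Q

variable (P : ObjectProperty D) [P.IsSerreClass]

instance : Abelian (SerreQuotient P) :=
  ObjectProperty.SerreClassLocalization.abelian (toQuotient P) P

instance : PreservesFiniteLimits (toQuotient P) :=
  ObjectProperty.SerreClassLocalization.preservesFiniteLimits (toQuotient P) P

instance : PreservesFiniteColimits (toQuotient P) :=
  ObjectProperty.SerreClassLocalization.preservesFiniteColimits (toQuotient P) P

variable {P} {P' : ObjectProperty D} [P'.IsSerreClass]

lemma isInvertedBy_toQuotient (h : P ≤ P') : P.isoModSerre.IsInvertedBy (toQuotient P') :=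
  fun _ _ f hf => Localization.inverts (toQuotient P') P'.isoModSerre f ⟨h _ hf.1, h _ hf.2⟩

/-- The functor `D / P ⥤ D / P'` induced by an inclusion `P ≤ P'` of Serre classes. -/
def quotientFunctor (h : P ≤ P') : SerreQuotient P ⥤ SerreQuotient P' :=
  Localization.lift (toQuotient P') (isInvertedBy_toQuotient h) (toQuotient P)

/-- The functor `D / P ⥤ D / P'` is compatible with the quotient functors. -/
def quotientFunctorIso (h : P ≤ P') : toQuotient P ⋙ quotientFunctor h ≅ toQuotient P' :=
  Localization.fac _ (isInvertedBy_toQuotient h) _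

instance (h : P ≤ P') : (quotientFunctor h).Additive :=
  (Localization.functor_additive_iff (toQuotient P) P.isoModSerre _).2
    (Functor.additive_of_iso (quotientFunctorIso h).symm)

instance (h : P ≤ P') : PreservesFiniteLimits (quotientFunctor h) :=
  (ObjectProperty.SerreClassLocalization.preservesFiniteLimits_comp_iff (toQuotient P) P _).1
    (preservesFiniteLimits_of_natIso (quotientFunctorIso h).symm)

instance (h : P ≤ P') : PreservesFiniteColimits (quotientFunctor h) :=
  (ObjectProperty.SerreClassLocalization.preservesFiniteColimits_comp_iff (toQuotient P) P _).1
    (preservesFiniteColimits_of_natIso (quotientFunctorIso h).symm)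

/-- The class `S^P` of the objects of `D / P` that are isomorphic to the image `X_P` of an
object `X` of `S`. -/
def imageInQuotient (S P : ObjectProperty D) [P.IsSerreClass] :
    ObjectProperty (SerreQuotient P) :=
  fun Z => ∃ X, S X ∧ Nonempty ((toQuotient P).obj X ≅ Z)

/-- An object `Y` of `D` is `P`-local if it cannot distinguish the source and the target of a
morphism whose kernel and cokernel are in `P`. The quotient functor induces an equivalence
between the `P`-local objects and `D / P` if `D` is a Grothendieck category and `P` is
localizing. -/
abbrev IsLocalObj (P : ObjectProperty D) [P.IsSerreClass] : ObjectProperty D :=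
  P.isoModSerre.isLocal

/-- The Voevodsky property of `S` with respect to `P`: the `P`-localization `Y` of any object
`X` of `S` is in `S`. Here a `P`-localization of `X` is a morphism `X ⟶ Y` to a `P`-local
object `Y` whose kernel and cokernel are in `P`. -/
def VoevodskyProperty (S P : ObjectProperty D) [P.IsSerreClass] : Prop :=
  ∀ ⦃X Y : D⦄ (f : X ⟶ Y), S X → P.isoModSerre f → IsLocalObj P Y → S Y

/-- The strict Voevodsky property of `S` with respect to `P`: in addition to the Voevodsky
property, if a K-injective complex of `D / P` has its homology objects, computed in `D / P`,
in `S^P`, then the homology objects, computed in `D`, of the corresponding complex `Y` of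
`P`-local objects of `D` are in `S`. -/
structure StrictVoevodskyProperty (S P : ObjectProperty D) [P.IsSerreClass] : Prop where
  voevodskyProperty : VoevodskyProperty S P
  homology_mem (Y : CochainComplex D ℤ) (hY : ∀ n, IsLocalObj P (Y.X n))
    (hY' : CochainComplex.IsKInjective
      (((toQuotient P).mapHomologicalComplex (ComplexShape.up ℤ)).obj Y))
    (h : ∀ n, imageInQuotient S P
      ((((toQuotient P).mapHomologicalComplex (ComplexShape.up ℤ)).obj Y).homology n)) (n : ℤ) :
    S (Y.homology n)

/-- The class of the objects of the derived category all of whose homology objects are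
in `S`. -/
def homologyIn [HasDerivedCategory.{w} D] (S : ObjectProperty D) :
    ObjectProperty (DerivedCategory D) :=
  fun Z => ∀ n : ℤ, S ((DerivedCategory.homologyFunctor D n).obj Z)

end SerreQuotients

section Compact

variable {T : Type u} [Category.{v} T] [Preadditive T]

/-- An object `X` of a preadditive category is compact if the functor `Hom(X, -)` to abelian
groups preserves small coproducts. -/
def IsCompactObj (X : T) : Prop :=
  ∀ J : Type w, Nonempty
    (PreservesColimitsOfShape (Discrete J) (preadditiveCoyoneda.obj (Opposite.op X)))

/-- A family of objects is a family of compact generators of a triangulated category `T` if `T`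
has small coproducts, the members of the family are compact, and an object `X` is zero as soon
as every morphism from a shift of a member of the family to `X` is zero. -/
structure IsCompactGenerating [HasShift T ℤ] {J : Type w} (P : J → T) : Prop where
  hasCoproducts : HasCoproducts.{w} T
  isCompactObj (j : J) : IsCompactObj.{w} (P j)
  isZero (X : T) (h : ∀ (j : J) (n : ℤ) (f : (P j)⟦n⟧ ⟶ X), f = 0) : IsZero X

variable (T) in
/-- A triangulated category is compactly generated if it has a small family of compact
generators. -/
def IsCompactlyGeneratedTriangulated [HasShift T ℤ] : Prop :=
  ∃ (J : Type w) (P : J → T), IsCompactGenerating P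

end Compact

section Recollements

variable {B T E : Type*} [Category* B] [Category* T] [Category* E]
  [HasZeroObject B] [HasZeroObject T] [HasZeroObject E]
  [Preadditive B] [Preadditive T] [Preadditive E]
  [HasShift B ℤ] [HasShift T ℤ] [HasShift E ℤ]
  [∀ n : ℤ, (shiftFunctor B n).Additive] [∀ n : ℤ, (shiftFunctor T n).Additive]
  [∀ n : ℤ, (shiftFunctor E n).Additive]
  [Pretriangulated B] [Pretriangulated T] [Pretriangulated E]

/-- A recollement of triangulated categories `B ⥤ T ⥤ E` with given triangulated functors
`i : B ⥤ T` and `r : T ⥤ E`: these have triangulated left and right adjoints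
`iL ⊣ i ⊣ iR` and `rL ⊣ r ⊣ rR`, the functors `i`, `rL` and `rR` are fully faithful, and the
image of `i` is the kernel of `r`. -/
structure Recollement (i : B ⥤ T) (r : T ⥤ E) [i.CommShift ℤ] [i.IsTriangulated]
    [r.CommShift ℤ] [r.IsTriangulated] where
  /-- the left adjoint of `i` -/
  iL : T ⥤ B
  /-- the right adjoint of `i` -/
  iR : T ⥤ B
  /-- the left adjoint of `r` -/
  rL : E ⥤ T
  /-- the right adjoint of `r` -/
  rR : E ⥤ T
  [commShift_iL : iL.CommShift ℤ]
  [commShift_iR : iR.CommShift ℤ]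
  [commShift_rL : rL.CommShift ℤ]
  [commShift_rR : rR.CommShift ℤ]
  /-- the adjunction between `iL` and `i` -/
  adj_iL : iL ⊣ i
  /-- the adjunction between `i` and `iR` -/
  adj_iR : i ⊣ iR
  /-- the adjunction between `rL` and `r` -/
  adj_rL : rL ⊣ r
  /-- the adjunction between `r` and `rR` -/
  adj_rR : r ⊣ rR
  isTriangulated_iL : adj_iL.IsTriangulated
  isTriangulated_iR : adj_iR.IsTriangulated
  isTriangulated_rL : adj_rL.IsTriangulated
  isTriangulated_rR : adj_rR.IsTriangulated
  full_i : i.Full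
  faithful_i : i.Faithful
  full_rL : rL.Full
  faithful_rL : rL.Faithful
  full_rR : rR.Full
  faithful_rR : rR.Faithful
  image_eq_kernel (X : T) : i.essImage X ↔ IsZero (r.obj X)

end Recollements

section KInjective

/-- A K-injective resolution functor: a section `k` of the localization functor from the
homotopy category to the derived category, which takes its values in the K-injective
complexes. -/
structure KInjectiveResolutionFunctor (D : Type u) [Category.{v} D] [Abelian D]
    [HasDerivedCategory.{w} D] where
  /-- the underlying functor -/
  k : DerivedCategory D ⥤ HomotopyCategory D (ComplexShape.up ℤ)
  isKInjective (Y : DerivedCategory D) : CochainComplex.IsKInjective (k.obj Y).as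
  /-- `Y` is isomorphic to its resolution `k(Y)` in the derived category -/
  iso : k ⋙ DerivedCategory.Qh ≅ 𝟭 (DerivedCategory D)

end KInjective

section EnrichedConditions

variable {V : Type u} [Category.{v} V] [MonoidalCategory V] [MonoidalClosed V]
  [SymmetricCategory V] [Abelian V] {C : Type u₁} [EnrichedCategory V C]

/-- The complex `Y(c)` of objects of `V` for a complex `Y` in `[C, V]` and an object `c`. -/
def evalComplex (Y : CochainComplex (VFunctor V C) ℤ) (c : C) : CochainComplex V ℤ :=
  ((VFunctor.eval V c).mapHomologicalComplex (ComplexShape.up ℤ)).obj Y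

/-- A complex `Y` is injective fibrant if `Y ⟶ 0` has the right lifting property with respect
to the monomorphisms that are quasi-isomorphisms. -/
def IsInjectiveFibrant {D : Type*} [Category* D] [Abelian D] (Y : CochainComplex D ℤ) : Prop :=
  ∀ ⦃A B : CochainComplex D ℤ⦄ (i : A ⟶ B) [Mono i] [QuasiIso i] (f : A ⟶ Y),
    ∃ g : B ⟶ Y, i ≫ g = f

variable (V C) in
/-- There is a model structure on the category of complexes of objects of `V` whose weak
equivalences are the quasi-isomorphisms, such that `Y(c)` is fibrant for every injective fibrant
complex `Y` in `[C, V]` and every object `c` of `C`. -/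
def HasFibrantEvaluationModelStructure : Prop :=
  ∃ _ : HomotopicalAlgebra.ModelCategory (CochainComplex V ℤ),
    HomotopicalAlgebra.weakEquivalences (CochainComplex V ℤ) =
      HomologicalComplex.quasiIso V (ComplexShape.up ℤ) ∧
    ∀ Y : CochainComplex (VFunctor V C) ℤ, IsInjectiveFibrant Y →
      ∀ c : C, HomotopicalAlgebra.IsFibrant (evalComplex Y c)

variable (V) in
/-- The localizing subcategory `S_A` of the `V`-functors that vanish on a class `A` of objects
of `C`. -/
def vanishingOn (A : Set C) : ObjectProperty (VFunctor V C) :=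
  fun Y => ∀ a ∈ A, IsZero (Y.obj a)

end EnrichedConditions

end

set_option linter.unusedSectionVars false

open Pretriangulated

/-! ### Splitting idempotents, and reflections from weak reflections -/

section TriangulatedReflections

variable {T : Type u} [Category.{v} T] [HasZeroObject T] [Preadditive T] [HasShift T ℤ]
  [∀ n : ℤ, (shiftFunctor T n).Additive] [Pretriangulated T]

/-! Let `ℓ` be the functor from `[C, V]/Q` to `[C, V]/J_A`, `λ` the induced functor on derived
categories and `E` its kernel. Since `ℓ` is exact, `λ` commutes with homology, so `E` consists of
the complexes whose homology is killed by `ℓ`. By the Voevodsky property the objects killed by `ℓ`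
are those of `S_A^Q` (`isZero_quotientFunctor_obj_iff`). The functor `ℓ` has a fully faithful right
adjoint `s`, which preserves K-injective complexes, so `λ` has the fully faithful right adjoint `s ∘
k` (`exists_derived_adjunction`). For such a functor a recollement exists as soon as every object
has a reflection in the kernel (`exists_recollement_of_reflections`): the fibre of the unit gives
the right adjoint of the inclusion, and the fibre of the reflection of `λ_R Y` gives the left
adjoint of `λ` at `Y`.

The reflections are found in the style of Freyd's adjoint functor theorem. Let `X ⟶ Y` be a morphism
of complexes with `Y` injective fibrant and with homology in `S_A^Q`. It factors through a
subcomplex `M` of `Y` of bounded size whose homology embeds in that of `Y`, and hence is again in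
`S_A^Q`. There is only a set of such `M`, and the product of injective fibrant resolutions of them,
over all morphisms from `X`, is a weak reflection of `X`, provided that this product is in `E`
(`exists_weakReflection_homologyIn`). A weak reflection yields a reflection because `E` is
triangulated and closed under retracts, and idempotents split in a triangulated category with
countable coproducts (`exists_isReflection_of_weak`).

The closure of `E` under these products (`homology_product_mem_imageInQuotient`) is where the strict
Voevodsky property and the three alternatives enter. The section functor of `Q` preserves products
and injective fibrant complexes. By the strict property it takes the factors to complexes in `[C,
V]` that are acyclic at each `a ∈ A`. Products in `[C, V]` are computed pointwise, and each
alternative makes the product of these acyclic complexes of `V` acyclic. Localizing again gives the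
claim in `[C, V]/Q`.

The bound on the size of subcomplexes is `exists_strictIn`. It serves twice: for the set of the
complexes `M`, and for injective fibrant resolutions by the small object argument
(`exists_injectiveFibrant_resolution`). -/

/-- Idempotents split in a pretriangulated category with countable coproducts. -/
lemma exists_splitting_of_idempotent [HasColimitsOfShape (Discrete ℕ) T] {W : T} (e : W ⟶ W)
    (he : e ≫ e = e) :
    ∃ (R : T) (p : W ⟶ R) (i : R ⟶ W), p ≫ i = e ∧ i ≫ p = 𝟙 R := by
  let S : T := ∐ fun _ : ℕ => W
  let ι (n : ℕ) : W ⟶ S := Sigma.ι (fun _ : ℕ => W) n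
  -- The cone of `φ` is the homotopy colimit of the sequence `W ⟶ W ⟶ ⋯` with all maps `e`, which is
  -- the image of `e`.
  let φ : S ⟶ S := Sigma.desc fun n => ι n - e ≫ ι (n + 1)
  -- On the part where `e` is the identity, `φ` is `ι n ↦ ι n - ι (n + 1)`, with retraction `ι n ↦
  -- -∑ k < n, ι k`. On the part where `e` is zero, `φ` is the identity. The map `ψ` combines both
  -- retractions, so `φ` is a split monomorphism and `p` below is an epimorphism.
  let ψ : S ⟶ S := Sigma.desc fun n => ι n - e ≫ ι n - ∑ k ∈ Finset.range n, e ≫ ι k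
  have hφ (n : ℕ) : ι n ≫ φ = ι n - e ≫ ι (n + 1) := Sigma.ι_desc _ _
  have hψ (n : ℕ) : ι n ≫ ψ = ι n - e ≫ ι n - ∑ k ∈ Finset.range n, e ≫ ι k :=
    Sigma.ι_desc _ _
  have he' {Z : T} (f : W ⟶ Z) : e ≫ e ≫ f = e ≫ f := by rw [← Category.assoc, he]
  have hφψ : φ ≫ ψ = 𝟙 S := by
    refine Sigma.hom_ext _ _ fun n => ?_
    change ι n ≫ φ ≫ ψ = ι n ≫ 𝟙 S
    rw [← Category.assoc, hφ, Preadditive.sub_comp, Category.assoc, hψ, hψ, Category.comp_id,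
      Preadditive.comp_sub, Preadditive.comp_sub, he', sub_self, zero_sub, sub_neg_eq_add,
      Finset.sum_range_succ, Preadditive.comp_add, he', Preadditive.comp_sum]
    simp only [he']
    abel
  obtain ⟨H, p, δ, hT⟩ := distinguished_cocone_triangle φ
  have : Mono φ := mono_of_mono_fac hφψ
  have hδ : δ = 0 := Triangle.mor₃_eq_zero_of_mono₁ _ hT this
  have : Epi p := Triangle.epi₂ _ hT hδ
  have hφp : φ ≫ p = 0 := comp_distTriang_mor_zero₁₂ _ hT
  let σ : S ⟶ W := Sigma.desc fun _ => e
  have hσ (n : ℕ) : ι n ≫ σ = e := Sigma.ι_desc _ _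
  have hφσ : φ ≫ σ = 0 := by
    refine Sigma.hom_ext _ _ fun n => ?_
    change ι n ≫ φ ≫ σ = ι n ≫ 0
    rw [← Category.assoc, hφ, Preadditive.sub_comp, Category.assoc, hσ, hσ, he, sub_self,
      comp_zero]
  obtain ⟨h, hh⟩ : ∃ h : H ⟶ W, σ = p ≫ h := Triangle.yoneda_exact₂ _ hT σ hφσ
  have hp (n : ℕ) : ι n ≫ p = e ≫ ι (n + 1) ≫ p := by
    have := congrArg (ι n ≫ ·) hφp
    simpa [← Category.assoc, hφ, Preadditive.sub_comp, sub_eq_zero] using this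
  have hp' (n : ℕ) : e ≫ ι n ≫ p = e ≫ ι 0 ≫ p := by
    induction n with
    | zero => rfl
    | succ n ih => rw [← ih, hp n, he']
  refine ⟨H, ι 0 ≫ p, h, by rw [Category.assoc, ← hh, hσ], ?_⟩
  rw [← cancel_epi p]
  refine Sigma.hom_ext _ _ fun n => ?_
  change ι n ≫ p ≫ h ≫ ι 0 ≫ p = ι n ≫ p ≫ 𝟙 H
  rw [← reassoc_of% hh, ← Category.assoc, hσ, Category.comp_id, hp n]
  exact (hp' _).symm

/-- A morphism `η : X ⟶ Y` with `Y` in `P` is a reflection if every morphism from `X` to an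
object of `P` factors uniquely through `η`. -/
structure IsReflection (P : ObjectProperty T) {X Y : T} (η : X ⟶ Y) : Prop where
  prop : P Y
  bijective (Z : T) (hZ : P Z) : Function.Bijective (fun g : Y ⟶ Z => η ≫ g)

/-- If every object has a weak reflection in a triangulated subcategory that is closed under
retracts, and if idempotents split, then every object has a reflection. -/
lemma exists_isReflection_of_weak [HasColimitsOfShape (Discrete ℕ) T] (P : ObjectProperty T)
    [P.IsTriangulated] [P.IsStableUnderRetracts]
    (hP : ∀ X : T, ∃ (Y : T) (η : X ⟶ Y), P Y ∧ ∀ (Z : T) (f : X ⟶ Z), P Z → ∃ g, f = η ≫ g)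
    (X : T) : ∃ (Y : T) (η : X ⟶ Y), IsReflection P η := by
  obtain ⟨E₀, x, hE₀, hx⟩ := hP X
  -- A morphism from `E₀` to an object of `P` that vanishes on `X` factors through the cone `C`, and
  -- then through its weak reflection. So `c ≫ d` controls the failure of uniqueness, and passing to
  -- its fibre `W` removes it up to an idempotent.
  obtain ⟨C, c, δ, hT⟩ := distinguished_cocone_triangle x
  obtain ⟨E₁, d, hE₁, hd⟩ := hP C
  have hxc : x ≫ c = 0 := comp_distTriang_mor_zero₁₂ _ hT
  obtain ⟨W, hW, w, δ', hT'⟩ := P.distinguished_cocone_triangle₁ (c ≫ d) hE₀ hE₁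
  have hwg : w ≫ c ≫ d = 0 := comp_distTriang_mor_zero₁₂ _ hT'
  obtain ⟨y, hy⟩ : ∃ y : X ⟶ W, x = y ≫ w := Triangle.coyoneda_exact₂ _ hT' x (by
    change x ≫ c ≫ d = 0
    rw [← Category.assoc, hxc, zero_comp])
  obtain ⟨e, he⟩ := hx W y hW
  have factor {Z : T} (hZ : P Z) (f : E₀ ⟶ Z) (hf : x ≫ f = 0) : ∃ k, f = c ≫ d ≫ k := by
    obtain ⟨k, hk⟩ : ∃ k : C ⟶ Z, f = c ≫ k := Triangle.yoneda_exact₂ _ hT f hf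
    obtain ⟨k', hk'⟩ := hd Z k hZ
    exact ⟨k', by rw [hk, hk']⟩
  -- Both `e ≫ w` and the identity extend `x`, so their difference factors through `c ≫ d`, which
  -- `w` kills. Thus `w ≫ e ≫ w = w`, and the image of the idempotent `w ≫ e` is the reflection.
  obtain ⟨k, hk⟩ := factor hE₀ (e ≫ w - 𝟙 E₀) (by
    rw [Preadditive.comp_sub, ← Category.assoc, ← he, ← hy, Category.comp_id, sub_self])
  have hwew : w ≫ e ≫ w = w := by
    rw [sub_eq_iff_eq_add.1 hk, Preadditive.comp_add, reassoc_of% hwg, zero_comp, zero_add,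
      Category.comp_id]
  obtain ⟨R, π, i, hπi, hiπ⟩ := exists_splitting_of_idempotent (w ≫ e) (by
    rw [Category.assoc, reassoc_of% hwew])
  have hR : P R := P.prop_of_retract ⟨i, π, hiπ⟩ hW
  refine ⟨R, y ≫ π, hR, fun Z hZ => ⟨fun f f' hf => ?_, fun f => ?_⟩⟩
  · suffices ∀ f : R ⟶ Z, y ≫ π ≫ f = 0 → f = 0 by
      rw [← sub_eq_zero]
      apply this
      rw [Preadditive.comp_sub, Preadditive.comp_sub, sub_eq_zero]
      simpa using hf
    intro f hf
    obtain ⟨k, hk⟩ := factor hZ (e ≫ π ≫ f) (by rw [← reassoc_of% he, hf])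
    calc f = i ≫ (π ≫ i) ≫ π ≫ f := by
            rw [Category.assoc, reassoc_of% hiπ, reassoc_of% hiπ]
      _ = 0 := by rw [hπi, Category.assoc, hk, reassoc_of% hwg, zero_comp, comp_zero]
  · obtain ⟨f₀, hf₀⟩ := hx Z f hZ
    refine ⟨i ≫ w ≫ f₀, ?_⟩
    change (y ≫ π) ≫ i ≫ w ≫ f₀ = f
    have : y ≫ w ≫ e = y := by rw [← reassoc_of% hy, ← he]
    rw [Category.assoc, reassoc_of% hπi, reassoc_of% this, ← reassoc_of% hy, hf₀]

end TriangulatedReflections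

/-! ### Recollements from reflections in the kernel -/

section RecollementOfReflections

variable {T : Type u} [Category.{v} T] [HasZeroObject T] [Preadditive T] [HasShift T ℤ]
  [∀ n : ℤ, (shiftFunctor T n).Additive] [Pretriangulated T]
  {E : Type u₁} [Category.{v₁} E] [HasZeroObject E] [Preadditive E] [HasShift E ℤ]
  [∀ n : ℤ, (shiftFunctor E n).Additive] [Pretriangulated E]

/-- The inclusion of a full subcategory has a left adjoint if all reflections exist. -/
lemma isRightAdjoint_ι_of_reflections (P : ObjectProperty T)
    (h : ∀ X : T, ∃ (Y : T) (η : X ⟶ Y), IsReflection P η) : P.ι.IsRightAdjoint := by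
  choose Y η h using h
  let e (X : T) (Z : P.FullSubcategory) :
      ((⟨Y X, (h X).prop⟩ : P.FullSubcategory) ⟶ Z) ≃ (X ⟶ P.ι.obj Z) :=
    P.fullyFaithfulι.homEquiv.trans (Equiv.ofBijective _ ((h X).bijective Z.obj Z.property))
  exact ⟨_, ⟨Adjunction.adjunctionOfEquivLeft e (fun X Z Z' g f => by
    change η X ≫ P.ι.map (f ≫ g) = (η X ≫ P.ι.map f) ≫ P.ι.map g
    rw [Functor.map_comp, Category.assoc])⟩⟩

/-- The inclusion of a full subcategory has a right adjoint if all coreflections exist. -/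
lemma isLeftAdjoint_ι_of_coreflections (P : ObjectProperty T)
    (h : ∀ X : T, ∃ (Y : T) (ε : Y ⟶ X), P Y ∧
      ∀ Z : T, P Z → Function.Bijective (fun g : Z ⟶ Y => g ≫ ε)) : P.ι.IsLeftAdjoint := by
  choose Y ε hY h using h
  let e (Z : P.FullSubcategory) (X : T) :
      (P.ι.obj Z ⟶ X) ≃ (Z ⟶ (⟨Y X, hY X⟩ : P.FullSubcategory)) :=
    (P.fullyFaithfulι.homEquiv.trans (Equiv.ofBijective _ (h X Z.obj Z.property))).symm
  exact ⟨_, ⟨Adjunction.adjunctionOfEquivRight e (fun Z Z' X f g => by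
    rw [Equiv.symm_apply_eq]
    change _ = P.ι.map (f ≫ e Z' X g) ≫ ε X
    rw [Functor.map_comp, Category.assoc]
    congr 1
    exact ((e Z' X).symm_apply_apply g).symm)⟩⟩

variable (r : T ⥤ E) [r.CommShift ℤ] [r.IsTriangulated] {ρ : E ⥤ T} (adj : r ⊣ ρ)
  [ρ.Full] [ρ.Faithful] (P : ObjectProperty T) [P.IsTriangulated] [P.IsClosedUnderIsomorphisms]
  (hP : ∀ X, P X ↔ IsZero (r.obj X))

include hP in
lemma trW_iff_isIso_map {X Y : T} (f : X ⟶ Y) : P.trW f ↔ IsIso (r.map f) := by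
  obtain ⟨Z, g, h, hT⟩ := distinguished_cocone_triangle f
  refine ⟨fun hf => ?_, fun hf => ⟨Z, g, h, hT, ?_⟩⟩
  · obtain ⟨Z', g', h', hT', hZ'⟩ := hf
    exact (Triangle.isZero₃_iff_isIso₁ _ (r.map_distinguished _ hT')).1 ((hP _).1 hZ')
  · exact (hP _).2 ((Triangle.isZero₃_iff_isIso₁ _ (r.map_distinguished _ hT)).2 hf)

-- The coreflection is the fibre of the unit `X ⟶ ρ (r X)`. It is in the kernel because `r` inverts
-- the unit, and it is universal because an object of the kernel has no nonzero morphism to an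
-- object `ρ Y`.
include adj hP in
lemma exists_coreflection_kernel (X : T) : ∃ (Y : T) (ε : Y ⟶ X), P Y ∧
    ∀ Z : T, P Z → Function.Bijective (fun g : Z ⟶ Y => g ≫ ε) := by
  have h₀ {Z : T} (hZ : P Z) {Y : E} (f : Z ⟶ ρ.obj Y) : f = 0 := by
    apply (adj.homEquiv _ _).symm.injective
    exact ((hP Z).1 hZ).eq_of_src _ _
  let u : X ⟶ ρ.obj (r.obj X) := adj.unit.app X
  obtain ⟨Y, ε, δ, hT⟩ := distinguished_cocone_triangle₁ u
  have hY : P Y := (hP Y).2 ((Triangle.isZero₁_iff_isIso₂ _ (r.map_distinguished _ hT)).2 (by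
    exact inferInstanceAs (IsIso (r.map (adj.unit.app X)))))
  refine ⟨Y, ε, hY, fun Z hZ => ⟨fun g g' hg => ?_, fun f => ?_⟩⟩
  · rw [← sub_eq_zero]
    have hg : (g - g') ≫ ε = 0 := by
      rw [Preadditive.sub_comp, sub_eq_zero]; exact hg
    obtain ⟨k, hk⟩ : ∃ k : Z⟦(1 : ℤ)⟧ ⟶ ρ.obj (r.obj X), (g - g')⟦(1 : ℤ)⟧' = k ≫ δ :=
      Triangle.coyoneda_exact₁ _ hT ((g - g')⟦(1 : ℤ)⟧') (by
        change (g - g')⟦(1 : ℤ)⟧' ≫ ε⟦(1 : ℤ)⟧' = 0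
        rw [← Functor.map_comp, hg, Functor.map_zero])
    rw [h₀ (P.le_shift 1 _ hZ) k, zero_comp] at hk
    exact (shiftFunctor T (1 : ℤ)).map_injective (by rw [hk, Functor.map_zero])
  · obtain ⟨k, hk⟩ := Triangle.coyoneda_exact₂ _ hT f (h₀ hZ _)
    exact ⟨k, hk.symm⟩

-- The fibre of the reflection of `ρ Y` in the kernel is left orthogonal to the kernel, and `r`
-- takes it to `Y`, as it kills the reflection and `r (ρ Y) ≅ Y`. This fibre is the value at `Y` of
-- the left adjoint of `r`.
include adj hP in
lemma exists_leftOrthogonal_lift (h : ∀ X : T, ∃ (Y : T) (η : X ⟶ Y), IsReflection P η) (Y : E) :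
    ∃ (X : T) (_ : P.leftOrthogonal X) (c : Y ⟶ r.obj X), IsIso c := by
  obtain ⟨Z, η, hη⟩ := h (ρ.obj Y)
  obtain ⟨X, f, δ, hT⟩ := distinguished_cocone_triangle₁ η
  refine ⟨X, fun W g hW => ?_, ?_⟩
  · have hδ : δ ≫ g⟦(1 : ℤ)⟧' = 0 := (hη.bijective _ (P.le_shift 1 _ hW)).1 (by
      change η ≫ δ ≫ g⟦(1 : ℤ)⟧' = η ≫ 0
      have : η ≫ δ = 0 := comp_distTriang_mor_zero₂₃ _ hT
      rw [← Category.assoc, this, zero_comp, comp_zero])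
    obtain ⟨k, hk⟩ : ∃ k : (ρ.obj Y)⟦(1 : ℤ)⟧ ⟶ W⟦(1 : ℤ)⟧,
        g⟦(1 : ℤ)⟧' = (-f⟦(1 : ℤ)⟧') ≫ k :=
      Triangle.yoneda_exact₃ _ (rot_of_distTriang _ hT) (g⟦(1 : ℤ)⟧') hδ
    obtain ⟨k, rfl⟩ := (shiftFunctor T (1 : ℤ)).map_surjective k
    obtain ⟨l, hl : η ≫ l = k⟩ := (hη.bijective W hW).2 k
    apply (shiftFunctor T (1 : ℤ)).map_injective
    rw [hk, Functor.map_zero, ← hl, Functor.map_comp, Preadditive.neg_comp, ← Category.assoc,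
      ← Functor.map_comp, show f ≫ η = 0 from comp_distTriang_mor_zero₁₂ _ hT, Functor.map_zero,
      zero_comp, neg_zero]
  · have : IsIso (r.map f) := (trW_iff_isIso_map r P hP f).1 ⟨Z, η, δ, hT, hη.prop⟩
    exact ⟨inv (adj.counit.app Y) ≫ inv (r.map f), inferInstance⟩

-- If `X` is left orthogonal to the kernel, then `Hom(X, -)` inverts the unit, so `Hom(X, Z) ≅
-- Hom(X, ρ (r Z)) ≅ Hom(r X, r Z)`. Taking the lift `X` of `Y` gives the adjunction bijection.
include adj hP in
lemma isRightAdjoint_of_reflections (h : ∀ X : T, ∃ (Y : T) (η : X ⟶ Y), IsReflection P η) :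
    r.IsRightAdjoint := by
  choose X hX c hc using exists_leftOrthogonal_lift r adj P hP h
  have hbij (Y : E) (Z : T) : Function.Bijective (fun f : X Y ⟶ Z => c Y ≫ r.map f) := by
    have h₁ : Function.Bijective (fun f : X Y ⟶ Z => f ≫ adj.unit.app Z) := by
      have := hX Y
      rw [← ObjectProperty.isColocal_trW] at this
      exact this _ ((trW_iff_isIso_map r P hP _).2 inferInstance)
    have h₂ : Function.Bijective (fun f : X Y ⟶ Z => r.map f) := by
      have := ((adj.homEquiv (X Y) (r.obj Z)).symm.bijective.comp h₁)
      refine (Function.Bijective.of_comp_iff' (Equiv.bijective (Equiv.refl _)) _).1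
        (by convert this using 1; ext f; simp [Adjunction.homEquiv_counit])
    have h₃ : Function.Bijective (fun f : r.obj (X Y) ⟶ r.obj Z => c Y ≫ f) :=
      ((asIso (c Y)).homFromEquiv).symm.bijective
    exact h₃.comp h₂
  let e (Y : E) (Z : T) : (X Y ⟶ Z) ≃ (Y ⟶ r.obj Z) := Equiv.ofBijective _ (hbij Y Z)
  exact ⟨_, ⟨Adjunction.adjunctionOfEquivLeft e (fun Y Z Z' g f => by
    change c Y ≫ r.map (f ≫ g) = (c Y ≫ r.map f) ≫ r.map g
    rw [Functor.map_comp, Category.assoc])⟩⟩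

include adj hP in
/-- Let `r` be a triangulated functor with a fully faithful right adjoint `ρ`. If every object
has a reflection in the kernel of `r`, then there is a recollement with `rR = ρ`. -/
theorem exists_recollement_of_reflections
    (h : ∀ X : T, ∃ (Y : T) (η : X ⟶ Y), IsReflection P η) :
    ∃ R : Recollement P.ι r, R.rR = ρ := by
  have := isRightAdjoint_ι_of_reflections P h
  have := isLeftAdjoint_ι_of_coreflections P (exists_coreflection_kernel r adj P hP)
  have := isRightAdjoint_of_reflections r adj P hP h
  let a₁ := Adjunction.ofIsRightAdjoint P.ι
  let a₂ := Adjunction.ofIsLeftAdjoint P.ι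
  let a₃ := Adjunction.ofIsRightAdjoint r
  let := a₁.leftAdjointCommShift ℤ
  let := a₂.rightAdjointCommShift ℤ
  let := a₃.leftAdjointCommShift ℤ
  let := adj.rightAdjointCommShift ℤ
  have := a₁.commShift_of_rightAdjoint ℤ
  have := a₂.commShift_of_leftAdjoint ℤ
  have := a₃.commShift_of_rightAdjoint ℤ
  have := adj.commShift_of_leftAdjoint ℤ
  -- In an adjoint triple the outer functors are fully faithful simultaneously.
  have ff : (Functor.leftAdjoint r).FullyFaithful :=
    (Adjunction.Triple.fullyFaithfulEquiv ⟨a₃, adj⟩).symm (.ofFullyFaithful ρ)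
  exact ⟨{
    iL := Functor.leftAdjoint P.ι
    iR := Functor.rightAdjoint P.ι
    rL := Functor.leftAdjoint r
    rR := ρ
    adj_iL := a₁
    adj_iR := a₂
    adj_rL := a₃
    adj_rR := adj
    isTriangulated_iL := .mk'' _
    isTriangulated_iR := .mk' _
    isTriangulated_rL := .mk'' _
    isTriangulated_rR := .mk' _
    full_i := inferInstance
    faithful_i := inferInstance
    full_rL := ff.full
    faithful_rL := ff.faithful
    full_rR := inferInstance
    faithful_rR := inferInstance
    image_eq_kernel := fun X => by
      rw [← hP X]
      exact ⟨fun ⟨Y, ⟨i⟩⟩ => P.prop_of_iso i Y.property, fun hX => ⟨⟨X, hX⟩, ⟨Iso.refl _⟩⟩⟩ }, rfl⟩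

end RecollementOfReflections

namespace CategoryTheory

/-! ### Subobjects in abelian and Grothendieck categories -/

section SubobjectLattice

variable {A : Type u} [Category.{v} A] [Abelian A]

lemma subobject_factors_iff {X Y : A} (U : Subobject Y) (f : X ⟶ Y) :
    U.Factors f ↔ f ≫ cokernel.π U.arrow = 0 := by
  constructor
  · intro h
    rw [← U.factorThru_arrow f h, Category.assoc, cokernel.condition, comp_zero]
  · intro h
    rw [← U.mk_arrow, Subobject.mk_factors_iff]
    exact ⟨(Abelian.monoIsKernelOfCokernel _ (cokernelIsCokernel U.arrow)).lift
      (KernelFork.ofι f h), (Abelian.monoIsKernelOfCokernel _ (cokernelIsCokernel U.arrow)).fac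
      (KernelFork.ofι f h) WalkingParallelPair.zero⟩

lemma subobject_factors_of_epi {X' X Y : A} (U : Subobject Y) (f : X ⟶ Y) (p : X' ⟶ X) [Epi p]
    (h : U.Factors (p ≫ f)) : U.Factors f := by
  rw [subobject_factors_iff] at h ⊢
  rwa [Category.assoc, ← comp_zero (f := p), cancel_epi] at h

lemma imageSubobject_le_iff {X Y : A} (U : Subobject Y) (f : X ⟶ Y) :
    imageSubobject f ≤ U ↔ U.Factors f := by
  constructor
  · intro h
    exact Subobject.factors_of_le f h
      (by simpa using imageSubobject_factors_comp_self f (𝟙 _))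
  · intro h
    exact imageSubobject_le f (U.factorThru f h) (by simp)

lemma imageSubobject_epi_comp {X' X Y : A} (p : X' ⟶ X) [Epi p] (f : X ⟶ Y) :
    imageSubobject (p ≫ f) = imageSubobject f := by
  refine le_antisymm (imageSubobject_comp_le _ _) ?_
  rw [imageSubobject_le_iff]
  exact subobject_factors_of_epi _ _ p
    (by simpa using imageSubobject_factors_comp_self (p ≫ f) (𝟙 _))

lemma imageSubobject_factors_self {X Y : A} (f : X ⟶ Y) : (imageSubobject f).Factors f := by
  simpa using imageSubobject_factors_comp_self f (𝟙 _)

/-- A morphism to the image of `f` lifts to the source of `f` after passing to a cover. -/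
lemma exists_refinement_of_factors_image {T X Y : A} (f : X ⟶ Y) (t : T ⟶ Y)
    (h : (imageSubobject f).Factors t) :
    ∃ (T' : A) (π : T' ⟶ T) (_ : Epi π) (x : T' ⟶ X), π ≫ t = x ≫ f := by
  obtain ⟨T', π, hπ, x, hx⟩ := surjective_up_to_refinements_of_epi
    (factorThruImageSubobject f) ((imageSubobject f).factorThru t h)
  refine ⟨T', π, hπ, x, ?_⟩
  rw [← imageSubobject_arrow_comp f, ← reassoc_of% hx, Subobject.factorThru_arrow]

variable [IsGrothendieckAbelian.{w} A]

section

variable {J : Type w} [SmallCategory J] [IsFiltered J] {F : J ⥤ A} {c : Cocone F}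
  (hc : IsColimit c)

-- By AB5, `X` is the colimit of the pullbacks of the diagram along `z`, so a morphism from `X` may
-- be tested on these pullbacks.
include hc in
lemma eq_zero_of_filtered_pullback {X W : A} (z : X ⟶ c.pt) (g : X ⟶ W)
    (h : ∀ (j : J) (T : A) (a : T ⟶ F.obj j) (b : T ⟶ X), a ≫ c.ι.app j = b ≫ z → b ≫ g = 0) :
    g = 0 := by
  have := IsGrothendieckAbelian.IsPresentable.surjectivity.isIso_f hc z
  rw [← cancel_epi (IsGrothendieckAbelian.IsPresentable.surjectivity.f z), comp_zero]
  refine colimit.hom_ext fun j => ?_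
  rw [comp_zero, ← Category.assoc, IsGrothendieckAbelian.IsPresentable.surjectivity.hf]
  refine h j _ ((pullback.fst c.ι ((Functor.const J).map z)).app j) _ ?_
  rw [← NatTrans.comp_app, pullback.condition]
  rfl

end

section

variable {J : Type w} [Preorder J] [IsDirectedOrder J] [Nonempty J] {X : A}
  {N : J → Subobject X} (hN : Monotone N)

/-- The cocone given by the inclusions of the members of a monotone family of subobjects in the
supremum of the family. -/
noncomputable def subobjectISupCocone :
    Cocone (hN.functor ⋙ Subobject.underlying) where
  pt := ((⨆ j, N j : Subobject X) : A)
  ι :=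
    { app := fun j => Subobject.ofLE _ _ (le_iSup N j)
      naturality := fun i j f => by
        rw [← cancel_mono (Subobject.arrow _), Category.assoc, Category.assoc]
        erw [Subobject.ofLE_arrow, Category.id_comp, Subobject.ofLE_arrow]
        exact (Subobject.ofLE_arrow _).symm }

/-- The supremum of a directed family of subobjects is its colimit. -/
noncomputable def subobjectISupIsColimit : IsColimit (subobjectISupCocone hN) := by
  let F : J ⥤ MonoOver X := hN.functor ⋙ Subobject.representative
  let c : Cocone (F ⋙ MonoOver.forget _) :=
    { pt := Over.mk (⨆ j, N j : Subobject X).arrow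
      ι :=
        { app := fun j => Over.homMk (Subobject.ofLE _ _ (le_iSup N j))
            (Subobject.ofLE_arrow _)
          naturality := fun i j f => by
            ext
            exact (subobjectISupCocone hN).ι.naturality f } }
  have : Mono c.pt.hom := by dsimp [c]; infer_instance
  have h : Subobject.mk c.pt.hom = ⨆ j, Subobject.mk (F.obj j).obj.hom := by
    dsimp [c]
    rw [Subobject.mk_arrow]
    exact congrArg iSup (funext fun j => (Subobject.mk_arrow (N j)).symm)
  exact IsGrothendieckAbelian.isColimitMapCoconeOfSubobjectMkEqISup F c h

include hN in
/-- The lattice of subobjects of an object of a Grothendieck category is upper continuous. -/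
lemma inf_iSup_le_of_directed (V U : Subobject X) (h : ∀ j, V ⊓ N j ≤ U) :
    V ⊓ ⨆ j, N j ≤ U := by
  refine Subobject.le_of_factors ?_
  rw [subobject_factors_iff]
  refine eq_zero_of_filtered_pullback (subobjectISupIsColimit hN)
    (Subobject.ofLE _ _ (inf_le_right : V ⊓ ⨆ j, N j ≤ _)) _ ?_
  intro j T a b hab
  rw [← Category.assoc, ← subobject_factors_iff]
  refine Subobject.factors_of_le _ (h j) ?_
  rw [Subobject.inf_factors]
  constructor
  · rw [← Subobject.ofLE_arrow (inf_le_left : V ⊓ ⨆ j, N j ≤ V), ← Category.assoc]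
    exact Subobject.factors_comp_arrow _
  · rw [← Subobject.ofLE_arrow (inf_le_right : V ⊓ ⨆ j, N j ≤ _), ← Category.assoc]
    have : (b ≫ Subobject.ofLE _ _ (inf_le_right : V ⊓ ⨆ j, N j ≤ _)) ≫ (⨆ j, N j).arrow =
        a ≫ (N j).arrow := by
      refine (congrArg (· ≫ (⨆ j, N j).arrow) hab).symm.trans ?_
      rw [← Subobject.ofLE_arrow (le_iSup N j)]
      exact Category.assoc a _ _
    rw [this]
    exact Subobject.factors_comp_arrow a

end

end SubobjectLattice

/-! ### Subcomplexes whose homology embeds -/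

section StrictSubcomplexes

variable {A : Type u} [Category.{v} A] [Abelian A] {Y : CochainComplex A ℤ}

/-- The component of degree `n` of a subcomplex. -/
noncomputable def subDeg (N : Subobject Y) (n : ℤ) : Subobject (Y.X n) :=
  Subobject.mk (N.arrow.f n)

lemma subDeg_mono (n : ℤ) : Monotone fun N : Subobject Y => subDeg N n := fun M N h =>
  Subobject.mk_le_mk_of_comm ((Subobject.ofLE M N h).f n) (by
    rw [← HomologicalComplex.comp_f, Subobject.ofLE_arrow])

/-- Boundaries of `Y` that are in `M` are boundaries of elements of `N`. -/
def StrictIn (M N : Subobject Y) : Prop :=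
  ∀ i j, subDeg M j ⊓ imageSubobject (Y.d i j) ≤ imageSubobject (N.arrow.f i ≫ Y.d i j)

/-- Strictness expresses injectivity on homology by boundaries alone. In this form it passes to
directed unions and can be enforced one step at a time. -/
lemma StrictIn.mono_homologyMap {N : Subobject Y} (h : StrictIn N N) (n : ℤ) :
    Mono (HomologicalComplex.homologyMap N.arrow n) := by
  rw [HomologicalComplex.mono_homologyMap_iff_up_to_refinements _ (n - 1) n (n + 1)
    (by simp) (by simp)]
  intro T x hx y hy
  have : (imageSubobject (N.arrow.f (n - 1) ≫ Y.d (n - 1) n)).Factors (x ≫ N.arrow.f n) := by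
    refine Subobject.factors_of_le _ (h _ _) ?_
    rw [Subobject.inf_factors]
    refine ⟨(Subobject.mk_factors_iff _ _).2 ⟨x, rfl⟩, ?_⟩
    rw [hy]
    exact imageSubobject_factors_comp_self _ _
  obtain ⟨T', π, hπ, x₁, hx₁⟩ := exists_refinement_of_factors_image _ _ this
  refine ⟨T', π, hπ, x₁, ?_⟩
  rw [← cancel_mono (N.arrow.f n), Category.assoc, hx₁, Category.assoc,
    HomologicalComplex.Hom.comm]

lemma strictIn_of_mono_homologyMap {N : Subobject Y}
    (h : ∀ n, Mono (HomologicalComplex.homologyMap N.arrow n)) : StrictIn N N := by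
  intro i j
  by_cases hij : i + 1 = j
  swap
  · have h0 : imageSubobject (Y.d i j) ≤ ⊥ := by
      rw [imageSubobject_le_iff, Subobject.bot_factors_iff_zero]
      exact Y.shape i j (by simpa using hij)
    exact inf_le_right.trans (h0.trans bot_le)
  obtain rfl : i = j - 1 := by lia
  have h' := h j
  rw [HomologicalComplex.mono_homologyMap_iff_up_to_refinements _ (j - 1) j (j + 1)
    (by simp) (by simp)] at h'
  refine Subobject.le_of_factors ?_
  set V := subDeg N j ⊓ imageSubobject (Y.d (j - 1) j) with hV
  obtain ⟨T, π, hπ, y, hy⟩ := exists_refinement_of_factors_image (Y.d (j - 1) j) V.arrow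
    (Subobject.inf_arrow_factors_right _ _)
  obtain ⟨x, hx⟩ : ∃ x : T ⟶ (N : CochainComplex A ℤ).X j, x ≫ N.arrow.f j = π ≫ V.arrow := by
    have h₁ : (subDeg N j).Factors (π ≫ V.arrow) :=
      Subobject.factors_of_factors_right _ (Subobject.inf_arrow_factors_left _ _)
    exact (Subobject.mk_factors_iff _ _).1 h₁
  obtain ⟨T', π', hπ', x₁, hx₁⟩ := h' x (by
    rw [← cancel_mono (N.arrow.f (j + 1)), Category.assoc, ← HomologicalComplex.Hom.comm,
      ← Category.assoc, hx, hy]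
    simp) y (hx.trans hy)
  refine subobject_factors_of_epi _ _ (π' ≫ π) ?_
  rw [Category.assoc, ← hx, ← Category.assoc, hx₁, Category.assoc, ← HomologicalComplex.Hom.comm]
  exact imageSubobject_factors_comp_self _ _

variable [IsGrothendieckAbelian.{w} A] {J : Type w} [Preorder J] [IsDirectedOrder J] [Nonempty J]
  {N : J → Subobject Y} (hN : Monotone N)

include hN in
lemma subDeg_iSup_le (n : ℤ) : subDeg (⨆ j, N j) n ≤ ⨆ j, subDeg (N j) n := by
  refine Subobject.le_of_factors ?_
  rw [subDeg]
  refine subobject_factors_of_epi _ _ (Subobject.underlyingIso _).inv ?_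
  rw [Subobject.underlyingIso_arrow, subobject_factors_iff]
  refine (isColimitOfPreserves (HomologicalComplex.eval A (ComplexShape.up ℤ) n)
    (subobjectISupIsColimit hN)).hom_ext fun j => ?_
  refine Eq.trans ?_ comp_zero.symm
  refine (Category.assoc _ _ _).symm.trans ?_
  refine (subobject_factors_iff _ _).1 ?_
  refine Subobject.factors_of_le _ (le_iSup (fun j => subDeg (N j) n) j) ?_
  refine (Subobject.mk_factors_iff _ _).2 ⟨𝟙 _, ?_⟩
  refine (Category.id_comp _).trans ?_
  exact (HomologicalComplex.congr_hom (Subobject.ofLE_arrow (le_iSup N j)) n).symm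

-- A boundary in the union is, by upper continuity of the lattice of subobjects, a union of
-- boundaries in the members, and each of these is handled by hypothesis. The bounding subcomplex
-- may be the whole union, so the members need not be strict themselves.
include hN in
lemma strictIn_iSup (h : ∀ j, StrictIn (N j) (⨆ j, N j)) : StrictIn (⨆ j, N j) (⨆ j, N j) := by
  intro a b
  refine (inf_le_inf_right _ (subDeg_iSup_le hN b)).trans ?_
  rw [inf_comm]
  refine inf_iSup_le_of_directed (fun i j hij => subDeg_mono b (hN hij)) _ _ fun j => ?_
  rw [inf_comm]
  exact h j a b

end StrictSubcomplexes


/-! ### A generating complex made of disks -/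

section DiskGenerators

variable (A : Type u) [Category.{v} A] [Abelian A] [IsGrothendieckAbelian.{w} A]

instance (I : Type w) : HasColimitsOfShape (Discrete I) (CochainComplex A ℤ) :=
  inferInstanceAs (HasColimitsOfShape (Discrete I) (HomologicalComplex A (ComplexShape.up ℤ)))

/-- There is a complex `Γ` such that each morphism from the separator of `A` to the component of
degree `n` of a complex `B` extends along a fixed morphism to a morphism `Γ ⟶ B`. -/
lemma exists_diskGenerator : ∃ (Γ : CochainComplex A ℤ) (u : ∀ n, separator A ⟶ Γ.X n),
    ∀ (B : CochainComplex A ℤ) (n : ℤ) (g : separator A ⟶ B.X n),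
      ∃ b : Γ ⟶ B, u n ≫ b.f n = g := by
  classical
  -- The complex `R n` corepresents `B ↦ Hom(separator A, B.X n)`; the coproduct over `n` handles
  -- all degrees with one complex.
  let R (n : ℤ) : CochainComplex A ℤ :=
    HomologicalComplex.evalCompCoyonedaCorepresentative (ComplexShape.up ℤ) (separator A) n
  let e (n : ℤ) := HomologicalComplex.evalCompCoyonedaCorepresentable (ComplexShape.up ℤ)
    (separator A) n
  let Γ : CochainComplex A ℤ := ∐ fun n : ULift.{w} ℤ => R n.down
  refine ⟨Γ, fun n => (e n).homEquiv (𝟙 _) ≫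
    (Limits.Sigma.ι (fun n : ULift.{w} ℤ => R n.down) ⟨n⟩).f n, fun B n g => ?_⟩
  let b : Γ ⟶ B := Limits.Sigma.desc fun m => if h : m = ULift.up n then
    eqToHom (by rw [h]) ≫ ((e n).homEquiv.symm g : R n ⟶ B) else (0 : R m.down ⟶ B)
  refine ⟨b, ?_⟩
  have hb : Limits.Sigma.ι (fun n : ULift.{w} ℤ => R n.down) ⟨n⟩ ≫ b = (e n).homEquiv.symm g := by
    dsimp only [b]
    rw [Limits.Sigma.ι_desc]
    simp only [dite_true, eqToHom_refl, Category.id_comp]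
  have h := (e n).homEquiv_comp ((e n).homEquiv.symm g) (𝟙 _)
  rw [Category.id_comp] at h
  refine (Category.assoc _ _ _).trans
    (Eq.trans ?_ (h.symm.trans ((e n).homEquiv.apply_symm_apply g)))
  rw [← hb]
  rfl

/-- A complex which contains all disks on the separator. -/
noncomputable def diskGenerator : CochainComplex A ℤ := (exists_diskGenerator.{w} A).choose

/-- The universal elements of the disk generator. -/
noncomputable def diskElement (n : ℤ) : separator A ⟶ (diskGenerator.{w} A).X n :=
  (exists_diskGenerator.{w} A).choose_spec.choose n

variable {A}

lemma exists_diskElement_comp {B : CochainComplex A ℤ} {n : ℤ} (g : separator A ⟶ B.X n) :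
    ∃ b : diskGenerator.{w} A ⟶ B, diskElement.{w} A n ≫ b.f n = g :=
  (exists_diskGenerator.{w} A).choose_spec.choose_spec B n g

lemma eq_zero_of_diskElement {B : CochainComplex A ℤ} {n : ℤ} {W : A} (f : B.X n ⟶ W)
    (h : ∀ b : diskGenerator.{w} A ⟶ B, diskElement.{w} A n ≫ b.f n ≫ f = 0) : f = 0 := by
  refine (isSeparator_def _).1 (isSeparator_separator A) _ _ fun g => ?_
  obtain ⟨b, rfl⟩ := exists_diskElement_comp.{w} g
  rw [Category.assoc, h, comp_zero]

lemma eq_zero_of_diskGenerator {B C : CochainComplex A ℤ} (f : B ⟶ C)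
    (h : ∀ b : diskGenerator.{w} A ⟶ B, b ≫ f = 0) : f = 0 := by
  ext n
  refine eq_zero_of_diskElement.{w} _ fun b => ?_
  rw [← HomologicalComplex.comp_f, h, HomologicalComplex.zero_f, comp_zero]

variable (A) in
/-- The coproduct of copies of the disk generator. -/
noncomputable abbrev diskCoproduct (I : Type w) : CochainComplex A ℤ :=
  ∐ fun _ : I => diskGenerator.{w} A

/-- Every complex is a quotient of a coproduct of copies of the disk generator. -/
lemma exists_epi_diskCoproduct (X : CochainComplex A ℤ) :
    ∃ (I : Type w) (π : diskCoproduct A I ⟶ X), Epi π := by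
  refine ⟨Shrink.{w} (diskGenerator.{w} A ⟶ X),
    Limits.Sigma.desc fun i => (equivShrink _).symm i, ?_⟩
  rw [Preadditive.epi_iff_cancel_zero]
  intro Z f hf
  refine eq_zero_of_diskGenerator.{w} f fun b => ?_
  have := Limits.Sigma.ι (fun _ => diskGenerator.{w} A) (equivShrink _ b) ≫= hf
  simpa using this

end DiskGenerators

/-! ### Closing off to strict subcomplexes of bounded size -/

section ClosingOff

variable {A : Type u} [Category.{v} A] [Abelian A]

lemma subDeg_imageSubobject {X Y : CochainComplex A ℤ} (f : X ⟶ Y) (n : ℤ) :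
    subDeg (imageSubobject f) n = imageSubobject (f.f n) := by
  have h := HomologicalComplex.congr_hom (imageSubobject_arrow_comp f) n
  rw [HomologicalComplex.comp_f] at h
  rw [← h, imageSubobject_epi_comp, imageSubobject_mono ((imageSubobject f).arrow.f n)]
  rfl

lemma StrictIn.mono_right {Y : CochainComplex A ℤ} {M N N' : Subobject Y} (h : StrictIn M N)
    (hN : N ≤ N') : StrictIn M N' := fun i j => (h i j).trans (by
  rw [imageSubobject_le_iff, ← HomologicalComplex.congr_hom (Subobject.ofLE_arrow hN) i,
    HomologicalComplex.comp_f, Category.assoc]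
  exact imageSubobject_factors_comp_self _ _)

/-- A subobject of the image of `f` is determined by its preimage in the source of `f`. This bounds
the number of subobjects of the image independently of the target. -/
lemma le_of_pullback_eq {X Y : A} (f : X ⟶ Y) {W W' : Subobject Y} (hW : W ≤ imageSubobject f)
    (h : (Subobject.pullback f).obj W = (Subobject.pullback f).obj W') : W ≤ W' := by
  obtain ⟨T, π, hπ, x, hx⟩ := exists_refinement_of_factors_image f W.arrow
    (Subobject.factors_of_le _ hW (Subobject.factors_self W))
  refine Subobject.le_of_factors (subobject_factors_of_epi _ _ π ?_)
  rw [hx, ← Limits.pullback_factors_iff, ← h, Limits.pullback_factors_iff, ← hx]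
  exact Subobject.factors_comp_arrow _

variable [IsGrothendieckAbelian.{w} A]

-- Each boundary lying in the image of `φ ≫ p` needs a preimage under the differential. It suffices
-- to choose one for each subobject of the image that occurs as the image of a boundary, and these
-- are counted by subobjects of `diskCoproduct A I`. Hence `I'` depends on `I` only, and not on `B`,
-- `C`, `p` or `φ`; the size bounds below rest on this uniformity.
open Classical in
lemma exists_strictIn_step (I : Type w) : ∃ I' : Type w, ∀ ⦃B C : CochainComplex A ℤ⦄
    (p : B ⟶ C) [Epi p] (φ : diskCoproduct A I ⟶ B),
    ∃ φ' : diskCoproduct A I' ⟶ B, (∃ h, h ≫ φ' = φ) ∧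
      StrictIn (imageSubobject (φ ≫ p)) (imageSubobject (φ' ≫ p)) := by
  refine ⟨I ⊕ (Σ n : ℤ, Shrink.{w} (Subobject ((diskCoproduct A I).X n))), ?_⟩
  intro B C p _ φ
  let e (n : ℤ) (b : diskGenerator.{w} A ⟶ B) : separator A ⟶ C.X n :=
    diskElement.{w} A (n - 1) ≫ b.f (n - 1) ≫ p.f (n - 1) ≫ C.d (n - 1) n
  -- The index `k` is a subobject of the source of `φ`, and `b` is an element whose boundary lies in
  -- the image of `φ ≫ p` and has preimage `k`. One such `b` is adjoined for each pair `(n, k)` that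
  -- admits one; the other pairs contribute zero.
  let cond (n : ℤ) (k : Shrink.{w} (Subobject ((diskCoproduct A I).X n)))
      (b : diskGenerator.{w} A ⟶ B) : Prop :=
    imageSubobject (e n b) ≤ imageSubobject ((φ ≫ p).f n) ∧
      (Subobject.pullback ((φ ≫ p).f n)).obj (imageSubobject (e n b)) = (equivShrink _).symm k
  let φ' : diskCoproduct A (I ⊕ (Σ n : ℤ, Shrink.{w} (Subobject ((diskCoproduct A I).X n)))) ⟶ B :=
    Limits.Sigma.desc (Sum.elim (fun i => Limits.Sigma.ι (fun _ => diskGenerator.{w} A) i ≫ φ)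
      (fun k => if h : ∃ b, cond k.1 k.2 b then h.choose else 0))
  have key (n : ℤ) (b : diskGenerator.{w} A ⟶ B)
      (hb : imageSubobject (e n b) ≤ imageSubobject ((φ ≫ p).f n)) :
      imageSubobject (e n b) ≤ imageSubobject
        ((imageSubobject (φ' ≫ p)).arrow.f (n - 1) ≫ C.d (n - 1) n) := by
    let k := equivShrink.{w} _
      ((Subobject.pullback ((φ ≫ p).f n)).obj (imageSubobject (e n b)))
    have hk : ∃ b', cond n k b' := ⟨b, hb, by simp [k]⟩
    refine (le_of_pullback_eq ((φ ≫ p).f n) (W' := imageSubobject (e n hk.choose)) hb ?_).trans ?_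
    · rw [hk.choose_spec.2]
      simp [k]
    · rw [imageSubobject_le_iff]
      have h₁ : hk.choose =
          Limits.Sigma.ι (fun _ => diskGenerator.{w} A) (Sum.inr ⟨n, k⟩) ≫ φ' := by
        dsimp only [φ']
        rw [Limits.Sigma.ι_desc, Sum.elim_inr, dif_pos hk]
      have h₂ : e n hk.choose = (diskElement.{w} A (n - 1) ≫
          (Limits.Sigma.ι (fun _ => diskGenerator.{w} A) (Sum.inr ⟨n, k⟩) ≫
            factorThruImageSubobject (φ' ≫ p)).f (n - 1)) ≫
            (imageSubobject (φ' ≫ p)).arrow.f (n - 1) ≫ C.d (n - 1) n := by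
        have h₃ : hk.choose ≫ p = (Limits.Sigma.ι (fun _ => diskGenerator.{w} A) (Sum.inr ⟨n, k⟩) ≫
            factorThruImageSubobject (φ' ≫ p)) ≫ (imageSubobject (φ' ≫ p)).arrow := by
          rw [Category.assoc, imageSubobject_arrow_comp, ← Category.assoc, ← h₁]
        have h₄ := HomologicalComplex.congr_hom h₃ (n - 1)
        rw [HomologicalComplex.comp_f, HomologicalComplex.comp_f] at h₄
        dsimp only [e]
        rw [← Category.assoc (hk.choose.f _), h₄]
        simp only [Category.assoc]
      rw [h₂]
      exact imageSubobject_factors_comp_self _ _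
  refine ⟨φ', ⟨Limits.Sigma.desc fun i => Limits.Sigma.ι
    (fun _ => diskGenerator.{w} A) (Sum.inl i), ?_⟩, ?_⟩
  · refine Limits.Sigma.hom_ext _ _ fun i => ?_
    simp [φ']
  · intro i n
    by_cases hin : i + 1 = n
    swap
    · have h0 : imageSubobject (C.d i n) ≤ ⊥ := by
        rw [imageSubobject_le_iff, Subobject.bot_factors_iff_zero]
        exact C.shape i n (by simpa using hin)
      exact inf_le_right.trans (h0.trans bot_le)
    obtain rfl : i = n - 1 := by omega
    rw [subDeg_imageSubobject]
    set V := imageSubobject ((φ ≫ p).f n) ⊓ imageSubobject (C.d (n - 1) n)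
    obtain ⟨T, π, hπ, y, hy⟩ := exists_refinement_of_factors_image (C.d (n - 1) n) V.arrow
      (Subobject.inf_arrow_factors_right _ _)
    obtain ⟨T', π', hπ', y', hy'⟩ := surjective_up_to_refinements_of_epi (p.f (n - 1)) y
    refine Subobject.le_of_factors (subobject_factors_of_epi _ _ (π' ≫ π) ?_)
    rw [subobject_factors_iff]
    -- On the separator every element of degree `n - 1` of `B` comes from a morphism of the disk
    -- generator, so `key` applies.
    refine (isSeparator_def _).1 (isSeparator_separator A) _ _ fun g => ?_
    rw [comp_zero, ← Category.assoc, ← subobject_factors_iff]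
    obtain ⟨b, hb⟩ := exists_diskElement_comp.{w} (g ≫ y')
    have heq : g ≫ (π' ≫ π) ≫ V.arrow = e n b := by
      dsimp only [e]
      rw [← Category.assoc (diskElement.{w} A (n - 1)), hb, Category.assoc, hy, ← Category.assoc π',
        hy']
      simp only [Category.assoc]
    rw [heq, ← imageSubobject_le_iff]
    refine key n b ?_
    rw [imageSubobject_le_iff, ← heq]
    exact Subobject.factors_of_factors_right _ (Subobject.factors_of_factors_right _
      (Subobject.inf_arrow_factors_left _ _))

/-- Closing off: for each `I` there is `I'` such that each morphism from a coproduct of `I` copies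
of the disk generator factors through one from a coproduct of `I'` copies whose image is
strict. -/
lemma exists_strictIn (I : Type w) : ∃ I' : Type w, ∀ ⦃B C : CochainComplex A ℤ⦄
    (p : B ⟶ C) [Epi p] (φ : diskCoproduct A I ⟶ B),
    ∃ φ' : diskCoproduct A I' ⟶ B, (∃ h, h ≫ φ' = φ) ∧
      StrictIn (imageSubobject (φ' ≫ p)) (imageSubobject (φ' ≫ p)) := by
  choose S hS using exists_strictIn_step.{w} (A := A)
  -- Each step bounds the boundaries of the previous stage, so the union of countably many stages is
  -- strict.
  let s (k : ℕ) : Type w := Nat.rec (motive := fun _ => Type w) I (fun _ T => S T) k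
  refine ⟨Σ k : ℕ, s k, fun B C p _ φ => ?_⟩
  let ψ (k : ℕ) : diskCoproduct A (s k) ⟶ B :=
    Nat.rec (motive := fun k => diskCoproduct A (s k) ⟶ B) φ (fun k ψ => (hS (s k) p ψ).choose) k
  have hψ (k : ℕ) : (∃ h, h ≫ ψ (k + 1) = ψ k) ∧
      StrictIn (Y := C) (imageSubobject (ψ k ≫ p)) (imageSubobject (ψ (k + 1) ≫ p)) :=
    (hS (s k) p (ψ k)).choose_spec
  let φ' : diskCoproduct A (Σ k : ℕ, s k) ⟶ B :=
    Limits.Sigma.desc fun i => Limits.Sigma.ι (fun _ => diskGenerator.{w} A) i.2 ≫ ψ i.1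
  have hφ' (k : ℕ) : (Limits.Sigma.desc fun i =>
      Limits.Sigma.ι (fun _ : (Σ k : ℕ, s k) => diskGenerator.{w} A)
      ⟨k, i⟩) ≫ φ' = ψ k := by
    refine Limits.Sigma.hom_ext _ _ fun i => ?_
    simp [φ']
  let N (k : ULift.{w} ℕ) : Subobject C := imageSubobject (ψ k.down ≫ p)
  have hN : Monotone N := by
    have : Monotone (fun k : ℕ => imageSubobject (ψ k ≫ p)) :=
        monotone_nat_of_le_succ fun k : ℕ => by
      obtain ⟨h, hh⟩ := (hψ k).1
      rw [← hh, Category.assoc]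
      exact imageSubobject_comp_le _ _
    exact fun a b hab => this (show a.down ≤ b.down from hab)
  have heq : imageSubobject (φ' ≫ p) = ⨆ k, N k := by
    apply le_antisymm
    · rw [imageSubobject_le_iff, subobject_factors_iff]
      refine Limits.Sigma.hom_ext _ _ fun i => ?_
      rw [comp_zero, ← Category.assoc, ← subobject_factors_iff]
      refine Subobject.factors_of_le _ (le_iSup N ⟨i.1⟩) ?_
      have : Limits.Sigma.ι (fun _ : (Σ k : ℕ, s k) => diskGenerator.{w} A) i ≫ φ' ≫ p =
          Limits.Sigma.ι (fun _ => diskGenerator.{w} A) i.2 ≫ ψ i.1 ≫ p := by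
        simp [φ']
      rw [this]
      exact imageSubobject_factors_comp_self _ _
    · refine iSup_le fun k => ?_
      dsimp only [N]
      rw [← hφ', Category.assoc]
      exact imageSubobject_comp_le _ _
  refine ⟨φ', ⟨_, hφ' 0⟩, ?_⟩
  rw [heq]
  exact strictIn_iSup hN fun k => (hψ k.down).2.mono_right (le_iSup N ⟨k.down + 1⟩)

end ClosingOff


/-! ### Monomorphic quasi-isomorphisms -/

section MonoQuasiIso

open ZeroObject

variable {A : Type u} [Category.{v} A] [Abelian A]

lemma quasiIso_f_of_acyclic {S : ShortComplex (CochainComplex A ℤ)} (hS : S.ShortExact)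
    (h : S.X₃.Acyclic) : QuasiIso S.f := by
  rw [quasiIso_iff]
  intro n
  rw [quasiIsoAt_iff_isIso_homologyMap]
  have h₁ : Mono (HomologicalComplex.homologyMap S.f n) := by
    refine (hS.homology_exact₁ (n - 1) n (by simp)).mono_g ?_
    exact ((HomologicalComplex.exactAt_iff_isZero_homology _ _).1 (h (n - 1))).eq_of_src _ _
  have h₂ : Epi (HomologicalComplex.homologyMap S.f n) := by
    refine (hS.homology_exact₂ n).epi_f ?_
    exact ((HomologicalComplex.exactAt_iff_isZero_homology _ _).1 (h n)).eq_of_tgt _ _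
  exact isIso_of_mono_of_epi _

lemma quasiIso_of_acyclic_cokernel {K L : CochainComplex A ℤ} (i : K ⟶ L) [Mono i]
    (h : (cokernel i).Acyclic) : QuasiIso i :=
  quasiIso_f_of_acyclic (S := ShortComplex.mk i (cokernel.π i) (cokernel.condition i))
    { exact := ShortComplex.exact_cokernel i } h

lemma acyclic_cokernel {K L : CochainComplex A ℤ} (i : K ⟶ L) [Mono i] (h : QuasiIso i) :
    (cokernel i).Acyclic :=
  ShortComplex.ShortExact.acyclic_X₃
    (S := ShortComplex.mk i (cokernel.π i) (cokernel.condition i))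
    { exact := ShortComplex.exact_cokernel i } h

/-- Monomorphisms that are quasi-isomorphisms are stable under pushouts. -/
lemma quasiIso_of_isPushout {K L M N : CochainComplex A ℤ} {k : K ⟶ L} {l : K ⟶ M}
    {l' : L ⟶ N} {k' : M ⟶ N} (sq : IsPushout k l l' k') [Mono k] [QuasiIso k] :
    Mono k' ∧ QuasiIso k' := by
  have : Mono k' := (MorphismProperty.monomorphisms _).of_isPushout sq.flip
    (inferInstanceAs (Mono k))
  refine ⟨this, ?_⟩
  -- The morphism `d` exhibits the cokernel of `k` as the cokernel of `k'`, and this cokernel is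
  -- acyclic.
  let d : N ⟶ cokernel k := sq.desc (cokernel.π k) 0 (by simp)
  have hd : k' ≫ d = 0 := sq.inr_desc _ _ _
  refine quasiIso_f_of_acyclic (S := ShortComplex.mk k' d hd) ?_
    (acyclic_cokernel k inferInstance)
  have hl : l' ≫ d = cokernel.π k := sq.inl_desc _ _ _
  have : Epi d := epi_of_epi_fac hl
  refine { exact := ShortComplex.exact_of_g_is_cokernel _ ?_ }
  have hz {Z : CochainComplex A ℤ} (z : N ⟶ Z) (hz : k' ≫ z = 0) : k ≫ l' ≫ z = 0 := by
    rw [sq.w_assoc, hz, comp_zero]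
  refine CokernelCofork.IsColimit.ofπ _ _ (fun z hz' => cokernel.desc k (l' ≫ z) (hz z hz'))
    (fun z hz' => ?_) (fun z hz' m hm => ?_)
  · refine sq.hom_ext ?_ ?_
    · rw [← Category.assoc, hl, cokernel.π_desc]
    · rw [← Category.assoc, hd, zero_comp, hz']
  · rw [← cancel_epi d, hm]
    refine sq.hom_ext ?_ ?_
    · rw [← Category.assoc, hl, cokernel.π_desc]
    · rw [← Category.assoc, hd, zero_comp, hz']

variable (A) in
/-- The monomorphisms that are quasi-isomorphisms. -/
def monoQuasiIso : MorphismProperty (CochainComplex A ℤ) := fun _ _ f => Mono f ∧ QuasiIso f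

end MonoQuasiIso

/-! ### Lifting against disks and spheres on injective objects -/

section Disks

variable {A : Type u} [Category.{v} A] [Abelian A]

/-- The disk on `E` in degrees `n` and `n + 1`. -/
noncomputable abbrev disk (E : A) (n : ℤ) : CochainComplex A ℤ :=
  HomologicalComplex.double (𝟙 E) (show (ComplexShape.up ℤ).Rel n (n + 1) by simp)

/-- The isomorphism of the component of degree `n + 1`. -/
noncomputable abbrev diskIso (E : A) (n : ℤ) : (disk E n).X (n + 1) ≅ E :=
  HomologicalComplex.doubleXIso₁ _ _ (by simp)

lemma disk_d (E : A) (n : ℤ) : (disk E n).d n (n + 1) ≫ (diskIso E n).hom =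
    (HomologicalComplex.doubleXIso₀ _ _).hom := by
  rw [HomologicalComplex.double_d _ _ (by simp)]
  simp

lemma exists_toDisk {K : CochainComplex A ℤ} {E : A} {n : ℤ} (a : K.X (n + 1) ⟶ E) :
    ∃ g : K ⟶ disk E n, g.f (n + 1) ≫ (diskIso E n).hom = a := by
  classical
  let g : K ⟶ disk E n :=
    { f := fun k =>
        if h₀ : k = n then (K.XIsoOfEq h₀).hom ≫ K.d n (n + 1) ≫ a ≫
          (HomologicalComplex.doubleXIso₀ (𝟙 E)
            (show (ComplexShape.up ℤ).Rel n (n + 1) by simp)).inv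
            ≫ ((disk E n).XIsoOfEq h₀).inv
        else if h₁ : k = n + 1 then (K.XIsoOfEq h₁).hom ≫ a ≫ (diskIso E n).inv ≫
          ((disk E n).XIsoOfEq h₁).inv
        else 0
      comm' := fun i j hij => by
        obtain rfl : i + 1 = j := hij
        by_cases h₀ : i = n
        · subst h₀
          simp only [dite_true, HomologicalComplex.XIsoOfEq_rfl, Iso.refl_hom, Iso.refl_inv,
            Category.id_comp, Category.comp_id, Category.assoc]
          rw [dif_neg (by simp), HomologicalComplex.double_d _ _ (by simp)]
          simp
        · rw [HomologicalComplex.double_d_eq_zero₀ _ _ _ _ h₀, comp_zero]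
          by_cases h₁ : i + 1 = n
          · subst h₁
            simp
          · rw [dif_neg h₁, dif_neg (by simpa using h₀), comp_zero] }
  refine ⟨g, ?_⟩
  dsimp only [g]
  rw [dif_neg (by simp), dif_pos rfl]
  simp

lemma disk_hom_ext {K : CochainComplex A ℤ} {E : A} {n : ℤ} {g g' : K ⟶ disk E n}
    (h : g.f (n + 1) ≫ (diskIso E n).hom = g'.f (n + 1) ≫ (diskIso E n).hom) : g = g' := by
  rw [cancel_mono] at h
  refine HomologicalComplex.to_double_hom_ext ?_ h
  rw [← cancel_mono (HomologicalComplex.doubleXIso₀ (𝟙 E)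
    (show (ComplexShape.up ℤ).Rel n (n + 1) by simp)).hom, ← disk_d, ← Category.assoc,
    ← Category.assoc, g.comm, g'.comm, h]

/-- The projection from the disk on `E` to the complex `E` concentrated in degree `n`. -/
noncomputable def diskToSphere (E : A) (n : ℤ) :
    disk E n ⟶ (HomologicalComplex.single A (ComplexShape.up ℤ) n).obj E :=
  HomologicalComplex.mkHomFromDouble _ (by simp)
    (HomologicalComplex.singleObjXSelf (ComplexShape.up ℤ) n E).inv 0 (by simp) (by simp)

lemma diskToSphere_f (E : A) (n : ℤ) : (diskToSphere E n).f n ≫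
    (HomologicalComplex.singleObjXSelf (ComplexShape.up ℤ) n E).hom =
      (HomologicalComplex.doubleXIso₀ _ _).hom := by
  dsimp only [diskToSphere]
  rw [HomologicalComplex.mkHomFromDouble_f₀]
  simp

/-- This is the lifting problem for `disk E n ⟶ E[n]` in terms of components: `a` is the top
morphism, `b` the bottom one. As `E` is injective, a pair `(a, b)` on `K.X (n + 1) ⊞ L.X n` extends
to `L.X (n + 1)` if it vanishes on the kernel of `t`. -/
lemma exists_extension_of_monoQuasiIso {K L : CochainComplex A ℤ} (i : K ⟶ L) [Mono i]
    [QuasiIso i] {E : A} [Injective E] (n : ℤ) (a : K.X (n + 1) ⟶ E) (b : L.X n ⟶ E)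
    (hb : L.d (n - 1) n ≫ b = 0) (h : i.f n ≫ b = K.d n (n + 1) ≫ a) :
    ∃ b' : L.X (n + 1) ⟶ E, i.f (n + 1) ≫ b' = a ∧ L.d n (n + 1) ≫ b' = b := by
  have hi (m : ℤ) : IsIso (HomologicalComplex.homologyMap i m) := inferInstance
  let t : K.X (n + 1) ⊞ L.X n ⟶ L.X (n + 1) := biprod.desc (i.f (n + 1)) (L.d n (n + 1))
  -- For `(x, y)` in the kernel, `i x = -d y`. Injectivity on homology gives `x = d x'` locally.
  -- Then `i x' + y` is a cycle, so by surjectivity on homology it is `i z` plus a boundary, with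
  -- `z` a cycle. Hence `a x + b y = b (i x' + y) = b (i z) = a (d z) = 0`.
  have ht : kernel.ι t ≫ biprod.desc a b = 0 := by
    have hx : (kernel.ι t ≫ biprod.fst) ≫ i.f (n + 1) =
        (-(kernel.ι t ≫ biprod.snd)) ≫ L.d n (n + 1) := by
      have this : kernel.ι t ≫ (biprod.fst ≫ i.f (n + 1) + biprod.snd ≫ L.d n (n + 1)) = 0 := by
        rw [← biprod.desc_eq]
        exact kernel.condition t
      rw [Preadditive.comp_add] at this
      rw [Preadditive.neg_comp, Category.assoc, Category.assoc, eq_neg_iff_add_eq_zero]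
      exact this
    have hx' : (kernel.ι t ≫ biprod.fst) ≫ K.d (n + 1) (n + 1 + 1) = 0 := by
      rw [← cancel_mono (i.f (n + 1 + 1)), Category.assoc, ← i.comm, ← Category.assoc, hx,
        Category.assoc, L.d_comp_d, comp_zero, zero_comp]
    have hm := (inferInstance : Mono (HomologicalComplex.homologyMap i (n + 1)))
    rw [HomologicalComplex.mono_homologyMap_iff_up_to_refinements _ n (n + 1) (n + 1 + 1)
      (by simp) (by simp)] at hm
    obtain ⟨T, π, hπ, x', hx''⟩ := hm _ hx' _ hx
    have he := (inferInstance : Epi (HomologicalComplex.homologyMap i n))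
    rw [HomologicalComplex.epi_homologyMap_iff_up_to_refinements _ (n - 1) n (n + 1)
      (by simp) (by simp)] at he
    obtain ⟨T', π', hπ', z, hz, y, hy⟩ := he (x' ≫ i.f n + π ≫ kernel.ι t ≫ biprod.snd) (by
      rw [Preadditive.add_comp, Category.assoc, i.comm, ← Category.assoc, ← hx'', Category.assoc,
        hx]
      simp)
    rw [← cancel_epi π, ← cancel_epi π', comp_zero, comp_zero, biprod.desc_eq]
    simp only [Preadditive.comp_add]
    have e₁ : π' ≫ π ≫ kernel.ι t ≫ biprod.fst ≫ a = π' ≫ x' ≫ i.f n ≫ b := by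
      rw [h, ← Category.assoc (kernel.ι t), ← Category.assoc π, hx'', Category.assoc]
    have e₂ : π' ≫ π ≫ kernel.ι t ≫ biprod.snd ≫ b = - (π' ≫ x' ≫ i.f n ≫ b) := by
      have := hy =≫ b
      simp only [Preadditive.comp_add, Preadditive.add_comp, Category.assoc, hb, comp_zero,
        add_zero, h] at this
      rw [reassoc_of% hz, zero_comp] at this
      rw [eq_neg_iff_add_eq_zero, add_comm, h]
      exact this
    rw [e₁, e₂, add_neg_cancel]
  let S : ShortComplex A := ShortComplex.mk (kernel.ι t) t (kernel.condition t)
  have hS : S.Exact := ShortComplex.exact_kernel t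
  have hd := hS.comp_descToInjective (biprod.desc a b) ht
  refine ⟨hS.descToInjective (biprod.desc a b) ht, ?_, ?_⟩
  · have := biprod.inl ≫= hd
    simpa [S, t] using this
  · have := biprod.inr ≫= hd
    simpa [S, t] using this

lemma monoQuasiIso_rlp_diskToSphere (E : A) [Injective E] (n : ℤ) :
    (monoQuasiIso A).rlp (diskToSphere E n) := by
  intro K L i hi
  have := hi.1
  have := hi.2
  refine ⟨fun {g h} sq => ?_⟩
  let s := HomologicalComplex.singleObjXSelf (ComplexShape.up ℤ) n E
  obtain ⟨b', h₁, h₂⟩ := exists_extension_of_monoQuasiIso i n (g.f (n + 1) ≫ (diskIso E n).hom)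
    (h.f n ≫ s.hom) (by
      rw [← Category.assoc, ← h.comm, HomologicalComplex.single_obj_d, comp_zero, zero_comp]) (by
      have := HomologicalComplex.congr_hom sq.w n
      rw [HomologicalComplex.comp_f, HomologicalComplex.comp_f] at this
      rw [← Category.assoc, ← this, Category.assoc, diskToSphere_f, ← disk_d, ← Category.assoc,
        g.comm, Category.assoc])
  obtain ⟨l, hl⟩ := exists_toDisk b'
  refine ⟨⟨⟨l, disk_hom_ext ?_, ?_⟩⟩⟩
  · rw [HomologicalComplex.comp_f, Category.assoc, hl, h₁]
  · refine HomologicalComplex.to_single_hom_ext ?_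
    rw [← cancel_mono s.hom, HomologicalComplex.comp_f, Category.assoc, diskToSphere_f, ← disk_d,
      ← Category.assoc, l.comm, Category.assoc, hl, h₂]

variable [EnoughInjectives A]

/-- A complex with the left lifting property with respect to the projections from the disks to the
spheres on injective objects is acyclic. -/
lemma acyclic_of_llp {K : CochainComplex A ℤ}
    (h : ∀ (E : A) [Injective E] (n : ℤ) (f : K ⟶ (HomologicalComplex.single A _ n).obj E),
      ∃ g : K ⟶ disk E n, g ≫ diskToSphere E n = f) : K.Acyclic := by
  intro n
  rw [HomologicalComplex.exactAt_iff_isZero_homology]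
  -- Embed the homology in an injective object and extend this embedding to the opcycles, which
  -- gives a morphism from `K` to a sphere. If it lifts to the disk, it factors through the
  -- differential and so vanishes on cycles. Then the embedding is zero and so is the homology.
  let E := Injective.under (K.homology n)
  let e : K.opcycles n ⟶ E := Injective.factorThru (Injective.ι (K.homology n)) (K.homologyι n)
  let s := HomologicalComplex.singleObjXSelf (ComplexShape.up ℤ) n E
  let f : K ⟶ (HomologicalComplex.single A (ComplexShape.up ℤ) n).obj E :=
    HomologicalComplex.mkHomToSingle (K.pOpcycles n ≫ e) (by simp)
  obtain ⟨g, hg⟩ := h E n f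
  have h₁ : K.pOpcycles n ≫ e = K.d n (n + 1) ≫ g.f (n + 1) ≫ (diskIso E n).hom := by
    have := HomologicalComplex.congr_hom hg n
    rw [HomologicalComplex.comp_f, HomologicalComplex.mkHomToSingle_f] at this
    have := this =≫ s.hom
    rw [Category.assoc, diskToSphere_f, Category.assoc, Iso.inv_hom_id, Category.comp_id] at this
    rw [← this, ← disk_d, ← Category.assoc, g.comm, Category.assoc]
  have h₂ : K.homologyπ n ≫ Injective.ι (K.homology n) = 0 := by
    rw [← Injective.comp_factorThru (Injective.ι (K.homology n)) (K.homologyι n)]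
    change _ ≫ _ ≫ e = 0
    rw [HomologicalComplex.homology_π_ι_assoc, h₁, HomologicalComplex.iCycles_d_assoc, zero_comp]
  rw [IsZero.iff_id_eq_zero, ← cancel_epi (K.homologyπ n), ← cancel_mono (Injective.ι _)]
  simpa using h₂

/-- A morphism from the cokernel of `i` to a sphere is a lifting problem for `i` with zero top row,
and its solution descends to the cokernel. So the cokernel has the lifting property that forces
acyclicity. -/
lemma monoQuasiIso_of_llp_rlp {K L : CochainComplex A ℤ} {i : K ⟶ L} [Mono i]
    (hi : (monoQuasiIso A).rlp.llp i) : monoQuasiIso A i := by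
  refine ⟨inferInstance, quasiIso_of_acyclic_cokernel i (acyclic_of_llp fun E _ n f => ?_)⟩
  have := hi _ (monoQuasiIso_rlp_diskToSphere E n)
  have sq : CommSq (0 : K ⟶ disk E n) i (diskToSphere E n) (cokernel.π i ≫ f) := ⟨by simp⟩
  refine ⟨cokernel.desc i sq.lift sq.fac_left, ?_⟩
  rw [← cancel_epi (cokernel.π i), cokernel.π_desc_assoc, sq.fac_right]

end Disks


/-! ### Small object argument for monomorphic quasi-isomorphisms -/

section SmallObject

open ZeroObject

variable (A : Type u) [Category.{v} A] [Abelian A] [IsGrothendieckAbelian.{w} A]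

/-- The inclusions of subcomplexes in quotients of `diskCoproduct A I` that are
quasi-isomorphisms. -/
def generatingMonoQuasiIso (I : Type w) : MorphismProperty (CochainComplex A ℤ) :=
  MorphismProperty.ofHoms (ι := { p : Σ K : Subobject (diskCoproduct A I),
    Subobject (cokernel K.arrow) // QuasiIso p.2.arrow }) fun p => p.1.2.arrow

lemma generatingMonoQuasiIso_le (I : Type w) : generatingMonoQuasiIso A I ≤ monoQuasiIso A := by
  rintro _ _ _ ⟨p⟩
  exact ⟨inferInstance, p.2⟩

instance (I : Type w) : MorphismProperty.IsSmall.{w} (generatingMonoQuasiIso A I) := by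
  dsimp [generatingMonoQuasiIso]
  infer_instance

open MorphismProperty in
instance (I : Type w) : HasSmallObjectArgument.{w} (generatingMonoQuasiIso A I) := by
  -- A regular cardinal above the number of subobjects of all quotients of `diskCoproduct A I` makes
  -- the sources of the generating morphisms small with respect to transfinite compositions of
  -- monomorphisms.
  obtain ⟨κ, hκ', hκ⟩ := HasCardinalLT.exists_regular_cardinal.{w}
    (Σ K : Subobject (diskCoproduct A I), Subobject (cokernel K.arrow))
  have : Fact κ.IsRegular := ⟨hκ'⟩
  have : Nonempty κ.ord.ToType := by simpa using hκ'.ne_zero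
  have := WellFoundedLT.toOrderBot κ.ord.ToType
  exact ⟨κ, inferInstance, inferInstance,
    { preservesColimit {K L X Y} i hi f hf := by
        let hf' : (monomorphisms (CochainComplex A ℤ)).TransfiniteCompositionOfShape
            κ.ord.ToType f :=
          { toTransfiniteCompositionOfShape := hf.toTransfiniteCompositionOfShape
            map_mem j hj := by
              have := (hf.attachCells j hj).pushouts_coproducts
              simp only [ofHoms_homFamily] at this
              refine (?_ : _ ≤ monomorphisms _) _ this
              simp only [pushouts_le_iff, coproducts_le_iff]
              exact fun _ _ _ h => (generatingMonoQuasiIso_le A I _ h).1 }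
        have (j j' : κ.ord.ToType) (φ : j ⟶ j') : Mono (hf'.F.map φ) := hf'.mem_map φ
        apply IsGrothendieckAbelian.preservesColimit_coyoneda_obj_of_mono (Y := hf'.F) (κ := κ)
        obtain ⟨⟨⟨K, S⟩, hS⟩⟩ := hi
        exact Subobject.hasCardinalLT_of_mono (hκ.of_injective (fun T => ⟨K, T⟩)
          (fun T T' h => by simpa using h)) S.arrow }⟩

variable {A}

/-- Monomorphic quasi-isomorphisms with target a quotient of `diskCoproduct A I` lift. -/
lemma exists_lift_of_generating {I : Type w} {Z : CochainComplex A ℤ}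
    (hZ : (generatingMonoQuasiIso A I).rlp (0 : Z ⟶ 0)) {K M : CochainComplex A ℤ} (k : K ⟶ M)
    [Mono k] [QuasiIso k] (π : diskCoproduct A I ⟶ M) [Epi π] (f : K ⟶ Z) :
    ∃ g : M ⟶ Z, k ≫ g = f := by
  -- The target `M` is the quotient by the kernel of `π`, so `k` is a generating morphism up to
  -- isomorphism.
  let N : Subobject (diskCoproduct A I) := kernelSubobject π
  have hN : N.arrow ≫ π = 0 := kernelSubobject_arrow_comp π
  have hex : (ShortComplex.mk N.arrow π hN).Exact := by
    rw [ShortComplex.exact_iff_exact_up_to_refinements]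
    intro T x hx
    exact ⟨T, 𝟙 T, inferInstance, factorThruKernelSubobject π x hx, by simp [N]⟩
  have hc : IsColimit (CokernelCofork.ofπ π hN) := hex.gIsCokernel
  let e : cokernel N.arrow ≅ M := (cokernelIsCokernel N.arrow).coconePointUniqueUpToIso hc
  let k' := k ≫ e.inv
  let S : Subobject (cokernel N.arrow) := Subobject.mk k'
  have hS : S.arrow = (Subobject.underlyingIso k').hom ≫ k ≫ e.inv := by
    rw [Subobject.underlyingIso_hom_comp_eq_mk]
  have hq : QuasiIso S.arrow := by
    rw [hS]
    infer_instance
  have := hZ _ (MorphismProperty.ofHoms.mk (⟨⟨N, S⟩, hq⟩ :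
    { p : Σ K : Subobject (diskCoproduct A I),
      Subobject (cokernel K.arrow) // QuasiIso p.2.arrow }))
  have sq : CommSq ((Subobject.underlyingIso k').hom ≫ f) S.arrow (0 : Z ⟶ 0) 0 := ⟨by simp⟩
  obtain ⟨l, hl⟩ : ∃ l : cokernel N.arrow ⟶ Z,
      S.arrow ≫ l = (Subobject.underlyingIso k').hom ≫ f := ⟨sq.lift, sq.fac_left⟩
  refine ⟨e.inv ≫ l, ?_⟩
  rw [hS, Category.assoc, cancel_epi, Category.assoc] at hl
  exact hl

end SmallObject

/-! ### Injective fibrant complexes are K-injective -/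

section KInjective

variable {A : Type u} [Category.{v} A] [Abelian A]

/-- Injective fibrant complexes are K-injective. -/
lemma IsInjectiveFibrant.isKInjective {L : CochainComplex A ℤ} (hL : IsInjectiveFibrant L) :
    L.IsKInjective where
  nonempty_homotopy_zero {K} f hK := by
    -- For acyclic `K` the inclusion in the cone of the identity is a monomorphic quasi-isomorphism.
    -- So `f` extends to a contractible complex and is null-homotopic.
    let i : K ⟶ CochainComplex.mappingCone (𝟙 K) := CochainComplex.mappingCone.inr (𝟙 K)
    have hi : Mono i := by
      refine HomologicalComplex.mono_of_mono_f _ fun p => ?_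
      exact mono_of_mono_fac (CochainComplex.mappingCone.inr_f_snd_v (𝟙 K) p)
    let h := CochainComplex.mappingCone.homotopyToZeroOfId K
    have hcone : (CochainComplex.mappingCone (𝟙 K)).Acyclic := fun n => by
      rw [HomologicalComplex.exactAt_iff_isZero_homology, IsZero.iff_id_eq_zero,
        ← HomologicalComplex.homologyMap_id, h.homologyMap_eq, HomologicalComplex.homologyMap_zero]
    have : QuasiIso i := by
      rw [quasiIso_iff]
      intro n
      rw [quasiIsoAt_iff_exactAt' _ _ (hcone n)]
      exact hK n
    obtain ⟨g, hg⟩ := hL i f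
    exact ⟨(Homotopy.ofEq (by rw [← hg]; simp [i])).trans
      (((h.compRight g).compLeft i).trans (Homotopy.ofEq (by simp)))⟩

end KInjective


/-! ### Injective fibrant resolutions -/

section Extension

open ZeroObject

variable {A : Type u} [Category.{v} A] [Abelian A] [IsGrothendieckAbelian.{w} A]

/-- A morphism from a proper subcomplex of `B` with acyclic quotient extends to a larger one. -/
lemma exists_extension_of_ne_top {I : Type w}
    (hI : ∀ ⦃B C : CochainComplex A ℤ⦄ (p : B ⟶ C) [Epi p] (φ : diskCoproduct A PUnit ⟶ B),
      ∃ φ' : diskCoproduct A I ⟶ B, (∃ h, h ≫ φ' = φ) ∧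
        StrictIn (imageSubobject (φ' ≫ p)) (imageSubobject (φ' ≫ p)))
    {Z B : CochainComplex A ℤ} (hZ : (generatingMonoQuasiIso A I).rlp (0 : Z ⟶ 0))
    (N : Subobject B) (hNq : QuasiIso N.arrow) (hN : N ≠ ⊤)
    (g : (N : CochainComplex A ℤ) ⟶ Z) :
    ∃ (N' : Subobject B) (h : N ≤ N') (g' : (N' : CochainComplex A ℤ) ⟶ Z),
      ¬ N' ≤ N ∧ QuasiIso N'.arrow ∧ Subobject.ofLE _ _ h ≫ g' = g := by
  let p := cokernel.π N.arrow
  have hC : (cokernel N.arrow).Acyclic := acyclic_cokernel _ hNq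
  -- An element of `B` outside `N`. Closing it off gives a subcomplex `M` of bounded size, not
  -- contained in `N`, whose image in `B/N` is strict.
  obtain ⟨γ, hγ⟩ : ∃ γ : diskGenerator.{w} A ⟶ B, γ ≫ p ≠ 0 := by
    by_contra! H
    have hp : p = 0 := eq_zero_of_diskGenerator _ H
    have : Epi N.arrow := Abelian.epi_of_cokernel_π_eq_zero _ hp
    have : IsIso N.arrow := isIso_of_mono_of_epi _
    exact hN (Subobject.eq_top_of_isIso_arrow N)
  obtain ⟨φ', ⟨h, hh⟩, hs⟩ := hI p (Limits.Sigma.desc fun _ => γ)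
  let M := imageSubobject φ'
  let π := factorThruImageSubobject φ'
  have hπ : π ≫ M.arrow = φ' := imageSubobject_arrow_comp φ'
  let q := M.arrow ≫ p
  have hq : imageSubobject q = imageSubobject (φ' ≫ p) := by
    rw [← hπ, Category.assoc]
    exact (imageSubobject_epi_comp π q).symm
  let k := pullback.snd N.arrow M.arrow
  have hk0 : k ≫ factorThruImageSubobject q = 0 := by
    rw [← cancel_mono (imageSubobject q).arrow, Category.assoc, imageSubobject_arrow_comp,
      zero_comp, ← Category.assoc, ← pullback.condition, Category.assoc, cokernel.condition,
      comp_zero]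
  have hkex : (ShortComplex.mk k _ hk0).Exact := by
    rw [ShortComplex.exact_iff_exact_up_to_refinements]
    intro T x hx
    dsimp at x hx
    have hx' : N.Factors (x ≫ M.arrow) := by
      rw [subobject_factors_iff, Category.assoc]
      change x ≫ q = 0
      rw [← imageSubobject_arrow_comp q, reassoc_of% hx, zero_comp]
    exact ⟨T, 𝟙 T, inferInstance, pullback.lift (N.factorThru _ hx') x (by simp), by
      simpa [k] using (pullback.lift_snd _ _ _).symm⟩
  -- The homology of the image of `M` embeds in that of `B/N`, which is zero. So the inclusion of `N
  -- ∩ M` in `M` is a quasi-isomorphism, and `g` extends from the intersection to `M`.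
  have hac : ((imageSubobject q : Subobject _) : CochainComplex A ℤ).Acyclic := fun n => by
    rw [HomologicalComplex.exactAt_iff_isZero_homology]
    have := (hq ▸ hs : StrictIn (imageSubobject q) (imageSubobject q)).mono_homologyMap n
    exact IsZero.of_mono (HomologicalComplex.homologyMap (imageSubobject q).arrow n)
      ((HomologicalComplex.exactAt_iff_isZero_homology _ _).1 (hC n))
  have hkq : QuasiIso k := quasiIso_f_of_acyclic (S := ShortComplex.mk k _ hk0)
    { exact := hkex
      mono_f := by dsimp [k]; infer_instance
      epi_g := by dsimp; infer_instance } hac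
  obtain ⟨m, hm⟩ := exists_lift_of_generating hZ k π (pullback.fst N.arrow M.arrow ≫ g)
  -- The union of `N` and `M` is the pushout along their intersection, so `g` and its extension to
  -- `M` glue.
  let d : pushout (pullback.fst N.arrow M.arrow) k ⟶ B :=
    pushout.desc N.arrow M.arrow pullback.condition
  have hdl : pushout.inl (pullback.fst N.arrow M.arrow) k ≫ d = N.arrow := pushout.inl_desc _ _ _
  have hdr : pushout.inr (pullback.fst N.arrow M.arrow) k ≫ d = M.arrow := pushout.inr_desc _ _ _
  have hd : Mono d := (IsPushout.of_hasPushout _ _).mono_of_isPullback_of_mono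
    (IsPullback.of_hasPullback N.arrow M.arrow) _ hdl hdr
  have hkm : Mono k := by dsimp [k]; infer_instance
  have hinl := (quasiIso_of_isPushout (IsPushout.of_hasPushout
    (pullback.fst N.arrow M.arrow) k).flip).2
  have hdq : QuasiIso d := by
    rw [← quasiIso_iff_comp_left (pushout.inl (pullback.fst N.arrow M.arrow) k), hdl]
    exact hNq
  have hle : N ≤ Subobject.mk d := Subobject.le_mk_of_comm _ hdl
  refine ⟨Subobject.mk d, hle, (Subobject.underlyingIso d).hom ≫ pushout.desc g m hm.symm,
    fun H => hγ ?_, ?_, ?_⟩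
  · have h₁ : N.Factors M.arrow := Subobject.factors_of_le _ H
      ((Subobject.mk_factors_iff _ _).2 ⟨_, hdr⟩)
    rw [subobject_factors_iff] at h₁
    have h₂ : Limits.Sigma.ι (fun _ : PUnit.{w + 1} => diskGenerator.{w} A) PUnit.unit ≫
      Limits.Sigma.desc (fun _ => γ) = γ := Limits.Sigma.ι_desc _ _
    rw [← h₂, ← hh, ← hπ]
    simp only [Category.assoc]
    rw [h₁]
    simp
  · have : QuasiIso ((Subobject.underlyingIso d).hom ≫ d) := inferInstance
    rwa [Subobject.underlyingIso_hom_comp_eq_mk] at this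
  · have h₁ : Subobject.ofLE _ _ hle ≫ (Subobject.underlyingIso d).hom =
        pushout.inl (pullback.fst N.arrow M.arrow) k := by
      rw [← cancel_mono d, Category.assoc, Subobject.underlyingIso_hom_comp_eq_mk,
        Subobject.ofLE_arrow, hdl]
    rw [reassoc_of% h₁, pushout.inl_desc]

/-- Lifting against the quasi-isomorphic inclusions in the quotients of `diskCoproduct A I`, for a
suitable `I`, suffices for being injective fibrant. -/
lemma isInjectiveFibrant_of_generating {I : Type w}
    (hI : ∀ ⦃B C : CochainComplex A ℤ⦄ (p : B ⟶ C) [Epi p]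
      (φ : diskCoproduct A PUnit.{w + 1} ⟶ B),
      ∃ φ' : diskCoproduct A I ⟶ B, (∃ h, h ≫ φ' = φ) ∧
        StrictIn (imageSubobject (φ' ≫ p)) (imageSubobject (φ' ≫ p)))
    {Z : CochainComplex A ℤ} (hZ : (generatingMonoQuasiIso A I).rlp (0 : Z ⟶ 0)) :
    IsInjectiveFibrant Z := by
  intro K B i _ _ f
  -- Zorn's lemma for partial extensions of `f` to subcomplexes that are quasi-isomorphic to `B`.
  let T := { x : Σ N : Subobject B, ((N : CochainComplex A ℤ) ⟶ Z) //
    QuasiIso x.1.arrow ∧ ∃ h : K ⟶ x.1, h ≫ x.1.arrow = i ∧ h ≫ x.2 = f }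
  let r : T → T → Prop := fun x y =>
    ∃ h : x.1.1 ≤ y.1.1, Subobject.ofLE _ _ h ≫ y.1.2 = x.1.2
  have hr (x : T) : r x x := ⟨le_rfl, by rw [Subobject.ofLE_refl, Category.id_comp]⟩
  have htr {x y z : T} : r x y → r y z → r x z := by
    rintro ⟨h₁, h₂⟩ ⟨h₃, h₄⟩
    exact ⟨h₁.trans h₃, by rw [← h₂, ← h₄, Subobject.ofLE_comp_ofLE_assoc]⟩
  have hsymm {x y : T} (h : y.1.1 ≤ x.1.1) : r x y → r y x := by
    rintro ⟨h₁, h₂⟩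
    refine ⟨h, ?_⟩
    rw [← h₂, Subobject.ofLE_comp_ofLE_assoc, Subobject.ofLE_refl, Category.id_comp]
  have hch (c : Set T) (hc : IsChain r c) (hne : c.Nonempty) : ∃ ub, ∀ a ∈ c, r a ub := by
    have htot (a b : c) : r a b ∨ r b a := by
      by_cases hab : a.1 = b.1
      · exact Or.inl (by rw [hab]; exact hr _)
      · exact hc a.2 b.2 hab
    let J := Shrink.{w} c
    let e : J → c := (equivShrink c).symm
    let N : J → Subobject B := fun j => (e j).1.1.1
    let : Preorder J := Preorder.lift N
    have hN : Monotone N := fun _ _ h => h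
    -- Within a chain, an inclusion of the subcomplexes already forces compatibility of the
    -- extensions, so the extensions glue on the union.
    have hle {a b : c} (h : a.1.1.1 ≤ b.1.1.1) : r a b := (htot a b).elim id (hsymm h)
    have : IsDirectedOrder J := ⟨fun a b => (htot (e a) (e b)).elim
      (fun h => ⟨b, h.1, le_rfl⟩) (fun h => ⟨a, le_rfl, h.1⟩)⟩
    obtain ⟨a₀, ha₀⟩ := hne
    let j₀ : J := equivShrink c ⟨a₀, ha₀⟩
    have : Nonempty J := ⟨j₀⟩
    let s : Cocone (hN.functor ⋙ Subobject.underlying) :=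
      { pt := Z
        ι :=
          { app := fun j => (e j).1.1.2
            naturality := fun a b h => by
              obtain ⟨h₁, h₂⟩ := hle (a := e a) (b := e b) (leOfHom h : a ≤ b)
              exact h₂.trans (Category.comp_id _).symm } }
    have hs (j : J) : Subobject.ofLE _ _ (le_iSup N j) ≫ (subobjectISupIsColimit hN).desc s =
      (e j).1.1.2 := (subobjectISupIsColimit hN).fac s j
    obtain ⟨h₀, h₁, h₂⟩ := (e j₀).1.2.2
    have hfac : (h₀ ≫ Subobject.ofLE _ _ (le_iSup N j₀)) ≫ (⨆ j, N j).arrow = i := by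
      rw [Category.assoc, Subobject.ofLE_arrow, h₁]
    -- The homology of the union embeds in that of `B` by strictness, and it surjects because the
    -- quasi-isomorphism `i` factors through the union.
    have hq : QuasiIso (⨆ j, N j).arrow := by
      have hst : StrictIn (⨆ j, N j) (⨆ j, N j) := strictIn_iSup hN fun j =>
        (strictIn_of_mono_homologyMap fun n => by
          have := (e j).1.2.1
          infer_instance : StrictIn (N j) (N j)).mono_right (le_iSup N j)
      rw [quasiIso_iff]
      intro n
      rw [quasiIsoAt_iff_isIso_homologyMap]
      have := hst.mono_homologyMap n
      have : Epi (HomologicalComplex.homologyMap (⨆ j, N j).arrow n) :=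
        epi_of_epi_fac (f := HomologicalComplex.homologyMap
          (h₀ ≫ Subobject.ofLE _ _ (le_iSup N j₀)) n) (h := HomologicalComplex.homologyMap i n) (by
            rw [← HomologicalComplex.homologyMap_comp, hfac])
      exact isIso_of_mono_of_epi _
    refine ⟨⟨⟨⨆ j, N j, (subobjectISupIsColimit hN).desc s⟩, hq, _, hfac, ?_⟩, fun a ha => ?_⟩
    · rw [Category.assoc, hs, h₂]
    · obtain ⟨j, hj⟩ : ∃ j, e j = ⟨a, ha⟩ := (equivShrink c).symm.surjective _
      obtain rfl : (e j).1 = a := congrArg Subtype.val hj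
      exact ⟨le_iSup N j, hs j⟩
  obtain ⟨m, hm⟩ := exists_maximal_of_chains_bounded (r := r) (fun c hc => by
    by_cases hne : c.Nonempty
    · exact hch c hc hne
    · have hi : QuasiIso (Subobject.mk i).arrow := by
        have : QuasiIso ((Subobject.underlyingIso i).hom ≫ i) := inferInstance
        rwa [Subobject.underlyingIso_hom_comp_eq_mk] at this
      exact ⟨⟨⟨Subobject.mk i, (Subobject.underlyingIso i).hom ≫ f⟩, hi,
        (Subobject.underlyingIso i).inv, by simp, by simp⟩,
        fun a ha => (hne ⟨a, ha⟩).elim⟩) htr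
  obtain ⟨⟨N, g⟩, hNq, h, h₁, h₂⟩ := m
  dsimp at h h₁ h₂ g
  have htop : N = ⊤ := by
    by_contra hne
    obtain ⟨N', hle, g', hlt, hq', hg'⟩ := exists_extension_of_ne_top hI hZ N hNq hne g
    exact hlt (hm ⟨⟨N', g'⟩, hq', h ≫ Subobject.ofLE _ _ hle, by simpa using h₁, by
      dsimp; rw [Category.assoc, hg', h₂]⟩ ⟨hle, hg'⟩).1
  have : IsIso N.arrow := by
    rw [Subobject.isIso_iff_mk_eq_top, Subobject.mk_arrow, htop]
  refine ⟨inv N.arrow ≫ g, ?_⟩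
  rw [← h₁, Category.assoc, IsIso.hom_inv_id_assoc, h₂]

open MorphismProperty in
/-- Every complex admits a monomorphic quasi-isomorphism to an injective fibrant complex. -/
lemma exists_injectiveFibrant_resolution (X : CochainComplex A ℤ) :
    ∃ (Z : CochainComplex A ℤ) (i : X ⟶ Z), Mono i ∧ QuasiIso i ∧ IsInjectiveFibrant Z := by
  obtain ⟨I, hI⟩ := exists_strictIn (A := A) PUnit.{w + 1}
  let J := generatingMonoQuasiIso A I
  have : HasFunctorialFactorization J.rlp.llp J.rlp := inferInstance
  let F := factorizationData J.rlp.llp J.rlp (0 : X ⟶ 0)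
  -- Lifting against the generating morphisms is weaker than lifting against all monomorphisms, so
  -- the left class is contained in the saturated class of monomorphisms.
  have hmono : Mono F.i := by
    have h : J.rlp.llp ≤ monomorphisms (CochainComplex A ℤ) := by
      rw [← IsGrothendieckAbelian.llp_rlp_monomorphisms
        (isSeparator_separator (CochainComplex A ℤ))]
      exact antitone_llp (antitone_rlp fun _ _ _ h => (generatingMonoQuasiIso_le A I _ h).1)
    exact h _ F.hi
  have hq := monoQuasiIso_of_llp_rlp (antitone_llp
    (antitone_rlp (generatingMonoQuasiIso_le A I)) _ F.hi)
  refine ⟨F.Z, F.i, hmono, hq.2, isInjectiveFibrant_of_generating hI ?_⟩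
  have := F.hp
  rwa [(isZero_zero _).eq_of_tgt F.p 0] at this

end Extension

/-! ### K-injective resolutions as right adjoint of `Qh` -/

section Resolutions

variable {A : Type u} [Category.{v} A] [Abelian A] [HasDerivedCategory.{w₁} A]

lemma exists_isKInjective_Qh_iso [IsGrothendieckAbelian.{w} A] (Y : DerivedCategory A) :
    ∃ Z : CochainComplex A ℤ, Z.IsKInjective ∧
      Nonempty (DerivedCategory.Qh.obj ((HomotopyCategory.quotient A (.up ℤ)).obj Z) ≅ Y) := by
  obtain ⟨Z, i, _, _, hZ⟩ := exists_injectiveFibrant_resolution (DerivedCategory.Q.objPreimage Y)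
  exact ⟨Z, hZ.isKInjective, ⟨(DerivedCategory.quotientCompQhIso A).app Z ≪≫
    (asIso (DerivedCategory.Q.map i)).symm ≪≫ DerivedCategory.Q.objObjPreimageIso Y⟩⟩

/-- Right adjoints of the localization functor `Qh` given by K-injective complexes. -/
lemma exists_Qh_adjunction [IsGrothendieckAbelian.{w} A] :
    ∃ (k : DerivedCategory A ⥤ HomotopyCategory A (.up ℤ))
      (adj : DerivedCategory.Qh ⊣ k), IsIso adj.counit ∧
        ∀ Y, CochainComplex.IsKInjective (k.obj Y).as := by
  choose Z hZ e using exists_isKInjective_Qh_iso.{w} (A := A)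
  let q := HomotopyCategory.quotient A (.up ℤ)
  let E (X : HomotopyCategory A (.up ℤ)) (Y : DerivedCategory A) :
      (DerivedCategory.Qh.obj X ⟶ Y) ≃ (X ⟶ q.obj (Z Y)) :=
    ((Iso.refl _).homCongr (e Y).some.symm).trans
      (Equiv.ofBijective _ (CochainComplex.IsKInjective.Qh_map_bijective X (Z Y))).symm
  have hE (X' X Y f g) : E X' Y (DerivedCategory.Qh.map f ≫ g) = f ≫ E X Y g := by
    apply (CochainComplex.IsKInjective.Qh_map_bijective X' (Z Y)).1
    have h {X} (g : DerivedCategory.Qh.obj X ⟶ Y) :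
        DerivedCategory.Qh.map (E X Y g) = g ≫ (e Y).some.inv :=
      (Equiv.ofBijective_apply_symm_apply _
        (CochainComplex.IsKInjective.Qh_map_bijective X (Z Y)) _).trans (by simp)
    exact (h _).trans (by rw [Functor.map_comp, h, Category.assoc])
  refine ⟨Adjunction.rightAdjointOfEquiv E hE, Adjunction.adjunctionOfEquivRight E hE, ?_, hZ⟩
  have (Y : DerivedCategory A) : IsIso ((Adjunction.adjunctionOfEquivRight E hE).counit.app Y) := by
    have : (Adjunction.adjunctionOfEquivRight E hE).counit.app Y = (e Y).some.hom := by
      simp [Adjunction.adjunctionOfEquivRight, E]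
    rw [this]
    infer_instance
  exact NatIso.isIso_of_isIso_app _

/-- `Qh` is bijective on morphisms to a K-injective complex, so an inverse lifts and the two
identities are reflected. -/
lemma isIso_of_isIso_Qh_map {X Y : HomotopyCategory A (.up ℤ)}
    (hX : CochainComplex.IsKInjective X.as) (hY : CochainComplex.IsKInjective Y.as) (f : X ⟶ Y)
    [IsIso (DerivedCategory.Qh.map f)] : IsIso f := by
  have bij (Z : HomotopyCategory A (.up ℤ)) :
      Function.Bijective (DerivedCategory.Qh.map : (Z ⟶ X) → _) :=
    CochainComplex.IsKInjective.Qh_map_bijective Z X.as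
  have bij' (Z : HomotopyCategory A (.up ℤ)) :
      Function.Bijective (DerivedCategory.Qh.map : (Z ⟶ Y) → _) :=
    CochainComplex.IsKInjective.Qh_map_bijective Z Y.as
  obtain ⟨g, hg⟩ := (bij Y).2 (inv (DerivedCategory.Qh.map f))
  refine ⟨g, (bij X).1 ?_, (bij' Y).1 ?_⟩
  · exact (Functor.map_comp _ _ _).trans (by rw [hg]; simp)
  · exact (Functor.map_comp _ _ _).trans (by rw [hg]; simp)

lemma isIso_unit_of_isKInjective {k : DerivedCategory A ⥤ HomotopyCategory A (.up ℤ)}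
    (adj : DerivedCategory.Qh ⊣ k) [IsIso adj.counit]
    (hk : ∀ Y, CochainComplex.IsKInjective (k.obj Y).as) (X : HomotopyCategory A (.up ℤ))
    (hX : CochainComplex.IsKInjective X.as) : IsIso (adj.unit.app X) := by
  have h := adj.left_triangle_components X
  have : IsIso (DerivedCategory.Qh.map (adj.unit.app X) ≫
      adj.counit.app (DerivedCategory.Qh.obj X)) := h ▸ IsIso.id _
  have : IsIso (DerivedCategory.Qh.map (adj.unit.app X)) :=
    IsIso.of_isIso_comp_right _ (adj.counit.app (DerivedCategory.Qh.obj X))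
  exact isIso_of_isIso_Qh_map hX (hk _) _

end Resolutions

/-! ### Adjunctions on homotopy and derived categories -/

section HomotopyAdjunction

variable {A : Type*} [Category* A] [Abelian A] {B : Type*} [Category* B] [Abelian B]
  {F : A ⥤ B} {G : B ⥤ A} (adj : F ⊣ G) [F.Additive] [G.Additive]

/-- The unit on complexes of an adjunction of additive functors. -/
@[simps]
noncomputable def complexUnit (X : CochainComplex A ℤ) :
    X ⟶ (G.mapHomologicalComplex (.up ℤ)).obj ((F.mapHomologicalComplex (.up ℤ)).obj X) where
  f n := adj.unit.app (X.X n)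
  comm' i j _ := adj.unit_naturality (X.d i j)

/-- The counit on complexes of an adjunction of additive functors. -/
@[simps]
noncomputable def complexCounit (X : CochainComplex B ℤ) :
    (F.mapHomologicalComplex (.up ℤ)).obj ((G.mapHomologicalComplex (.up ℤ)).obj X) ⟶ X where
  f n := adj.counit.app (X.X n)
  comm' i j _ := (adj.counit_naturality (X.d i j)).symm

/-- The adjunction on homotopy categories of complexes given by an adjunction of additive
functors. -/
noncomputable def homotopyCategoryAdjunction :
    F.mapHomotopyCategory (ComplexShape.up ℤ) ⊣ G.mapHomotopyCategory (ComplexShape.up ℤ) where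
  unit :=
    { app := fun X => (HomotopyCategory.quotient _ _).map (complexUnit adj X.as)
      naturality := by
        rintro ⟨X⟩ ⟨Y⟩ f
        obtain ⟨f, rfl⟩ := (HomotopyCategory.quotient A (.up ℤ)).map_surjective
          (X := X) (Y := Y) f
        exact ((HomotopyCategory.quotient _ _).map_comp _ _).symm.trans
          ((congrArg _ (by ext n; exact (adj.unit_naturality (f.f n)).symm)).trans
            ((HomotopyCategory.quotient _ _).map_comp _ _)) }
  counit :=
    { app := fun X => (HomotopyCategory.quotient _ _).map (complexCounit adj X.as)
      naturality := by
        rintro ⟨X⟩ ⟨Y⟩ f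
        obtain ⟨f, rfl⟩ := (HomotopyCategory.quotient B (.up ℤ)).map_surjective
          (X := X) (Y := Y) f
        exact ((HomotopyCategory.quotient _ _).map_comp _ _).symm.trans
          ((congrArg _ (by ext n; exact adj.counit_naturality (f.f n))).trans
            ((HomotopyCategory.quotient _ _).map_comp _ _)) }
  left_triangle_components X :=
    ((HomotopyCategory.quotient _ _).map_comp ((F.mapHomologicalComplex _).map
      (complexUnit adj X.as)) (complexCounit adj _)).symm.trans
      ((congrArg _ (by ext n; exact adj.left_triangle_components (X.as.X n))).trans
        ((HomotopyCategory.quotient _ _).map_id _))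
  right_triangle_components X :=
    ((HomotopyCategory.quotient _ _).map_comp (complexUnit adj _) ((G.mapHomologicalComplex _).map
      (complexCounit adj X.as))).symm.trans
      ((congrArg _ (by ext n; exact adj.right_triangle_components (X.as.X n))).trans
        ((HomotopyCategory.quotient _ _).map_id _))

instance [IsIso adj.counit] : IsIso (homotopyCategoryAdjunction adj).counit := by
  have (X : HomotopyCategory B (.up ℤ)) :
      IsIso ((homotopyCategoryAdjunction adj).counit.app X) := by
    have (n : ℤ) : IsIso ((complexCounit adj X.as).f n) :=
      inferInstanceAs (IsIso (adj.counit.app (X.as.X n)))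
    have : IsIso (complexCounit adj X.as) := HomologicalComplex.Hom.isIso_of_components _
    exact inferInstanceAs (IsIso ((HomotopyCategory.quotient _ _).map (complexCounit adj X.as)))
  exact NatIso.isIso_of_isIso_app _

-- A morphism `K ⟶ G Z` from an acyclic complex corresponds to a morphism `F K ⟶ Z`. The latter is
-- null-homotopic because `F K` is acyclic, and additive functors preserve homotopies.
include adj in
lemma isKInjective_map_of_adjunction [PreservesFiniteLimits F] [PreservesFiniteColimits F]
    (Z : CochainComplex B ℤ) [Z.IsKInjective] :
    CochainComplex.IsKInjective ((G.mapHomologicalComplex (.up ℤ)).obj Z) where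
  nonempty_homotopy_zero {K} f hK := by
    have hFK : ((F.mapHomologicalComplex (.up ℤ)).obj K).Acyclic := fun n => (hK n).map F
    refine ⟨HomotopyCategory.homotopyOfEq _ _ ?_⟩
    have h : (HomotopyCategory.quotient B (.up ℤ)).map
        ((F.mapHomologicalComplex (.up ℤ)).map f ≫ complexCounit adj Z) =
          (HomotopyCategory.quotient B (.up ℤ)).map 0 :=
      HomotopyCategory.eq_of_homotopy _ _ (CochainComplex.IsKInjective.homotopyZero _ hFK)
    have h' : f = complexUnit adj K ≫ (G.mapHomologicalComplex (.up ℤ)).map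
        ((F.mapHomologicalComplex (.up ℤ)).map f ≫ complexCounit adj Z) := by
      ext n
      simp only [HomologicalComplex.comp_f, complexUnit_f, Functor.mapHomologicalComplex_map_f,
        complexCounit_f, Functor.map_comp]
      refine Eq.symm ((adj.unit_naturality_assoc (f.f n) _).trans ?_)
      exact ((congrArg (f.f n ≫ ·) (adj.right_triangle_components (Z.X n))).trans
        (Category.comp_id _))
    rw [h', Functor.map_comp, ← G.mapHomotopyCategory_map, h]
    simp only [Functor.map_zero]
    exact comp_zero

variable [HasDerivedCategory.{w₁} A] [HasDerivedCategory.{w₂} B]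

include adj in
/-- The functor between derived categories induced by an exact functor with a fully faithful
right adjoint `G` has a fully faithful right adjoint induced by `G` and K-injective
resolutions. -/
lemma exists_derived_adjunction [IsGrothendieckAbelian.{w} A] [IsGrothendieckAbelian.{w₃} B]
    [PreservesFiniteLimits F] [PreservesFiniteColimits F] [IsIso adj.counit] :
    ∃ (K : KInjectiveResolutionFunctor B)
      (a : F.mapDerivedCategory ⊣ K.k ⋙ G.mapHomotopyCategory (.up ℤ) ⋙ DerivedCategory.Qh),
      IsIso a.counit := by
  obtain ⟨kA, adjA, hA, hkA⟩ := exists_Qh_adjunction.{w} (A := A)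
  obtain ⟨kB, adjB, hB, hkB⟩ := exists_Qh_adjunction.{w₃} (A := B)
  let K : KInjectiveResolutionFunctor B := ⟨kB, hkB, asIso adjB.counit⟩
  have := adjA.fullyFaithfulROfIsIsoCounit
  let R' := kB ⋙ G.mapHomotopyCategory (.up ℤ)
  -- Compose the adjunctions at the level of homotopy categories. The result factors on the left
  -- through `Qh` and on the right takes K-injective values, so it restricts along the fully
  -- faithful `kA` to the derived category of `A`.
  let a' : F.mapHomotopyCategory (.up ℤ) ⋙ DerivedCategory.Qh ⊣ R' :=
    (homotopyCategoryAdjunction adj).comp adjB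
  let a'' : DerivedCategory.Qh ⋙ F.mapDerivedCategory ⊣ R' :=
    a'.ofNatIsoLeft F.mapDerivedCategoryFactorsh.symm
  have ha'' (Y : DerivedCategory B) : IsIso (a''.counit.app Y) := by
    have : IsIso (a'.counit.app Y) := by
      dsimp only [a']
      rw [Adjunction.comp_counit_app]
      infer_instance
    have h : a''.counit.app Y =
      F.mapDerivedCategoryFactorsh.hom.app (R'.obj Y) ≫ a'.counit.app Y := by
      simp [a'', Adjunction.ofNatIsoLeft]
    rw [h]
    infer_instance
  have hR' (Y : DerivedCategory B) : IsIso (adjA.unit.app (R'.obj Y)) := by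
    have := hkB Y
    have h₁ := isKInjective_map_of_adjunction adj (kB.obj Y).as
    exact isIso_unit_of_isKInjective adjA hkA _ h₁
  let c₂ : 𝟭 _ ⋙ R' ≅ (kB ⋙ G.mapHomotopyCategory (.up ℤ) ⋙ DerivedCategory.Qh) ⋙ kA :=
    NatIso.ofComponents (fun Y => asIso (adjA.unit.app (R'.obj Y)))
      (fun f => adjA.unit.naturality (R'.map f))
  let c₁ : kA ⋙ DerivedCategory.Qh ⋙ F.mapDerivedCategory ≅ F.mapDerivedCategory ⋙ 𝟭 _ :=
    Functor.isoWhiskerRight (asIso adjA.counit) F.mapDerivedCategory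
  refine ⟨K, a''.restrictFullyFaithful adjA.fullyFaithfulROfIsIsoCounit (.id _) c₁ c₂, ?_⟩
  have (Y : DerivedCategory B) : IsIso ((a''.restrictFullyFaithful
      adjA.fullyFaithfulROfIsIsoCounit (.id _) c₁ c₂).counit.app Y) := by
    have h := a''.map_restrictFullyFaithful_counit_app adjA.fullyFaithfulROfIsIsoCounit
      (.id _) c₁ c₂ Y
    have := ha'' Y
    exact (congrArg IsIso h).mpr (inferInstanceAs (IsIso (c₁.inv.app _ ≫
      (DerivedCategory.Qh ⋙ F.mapDerivedCategory).map (c₂.inv.app Y) ≫ a''.counit.app Y)))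
  exact NatIso.isIso_of_isIso_app _

end HomotopyAdjunction


/-! ### Right adjoints of localization functors -/

section LocalizationAdjunction

variable {A : Type*} [Category* A] {B : Type*} [Category* B] {L : A ⥤ B} {G : B ⥤ A}

/-- A right adjoint of a localization functor is fully faithful. -/
lemma isIso_counit_of_isLocalization (W : MorphismProperty A) [L.IsLocalization W]
    (adj : L ⊣ G) : IsIso adj.counit := by
  -- Natural transformations from the identity of `B` may be constructed on objects `L X`. The unit
  -- gives one, and it is the inverse of the counit.
  let α : 𝟭 B ⟶ G ⋙ L := Localization.liftNatTrans L W L (L ⋙ G ⋙ L) _ _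
    (Functor.whiskerRight adj.unit L)
  have hα (X : A) : α.app (L.obj X) = L.map (adj.unit.app X) := by
    simp [α]
  have h : α ≫ adj.counit = 𝟙 _ := by
    refine Localization.natTrans_ext L W fun X => ?_
    rw [NatTrans.comp_app, hα]
    exact adj.left_triangle_components X
  refine ⟨α, ?_, h⟩
  ext Y
  have h₁ := α.naturality (adj.counit.app Y)
  rw [NatTrans.comp_app]
  refine h₁.trans ?_
  have h₂ := hα (G.obj Y)
  refine (congrArg (· ≫ _) h₂).trans ?_
  exact (L.map_comp _ _).symm.trans ((congrArg L.map (adj.right_triangle_components Y)).trans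
    (L.map_id _))

end LocalizationAdjunction

/-! ### Gabriel quotients of Grothendieck categories -/

section Gabriel

variable {A : Type u} [Category.{v} A] [Abelian A] (P : ObjectProperty A) [P.IsSerreClass]

/-- A morphism in the quotient is represented by a morphism from a subobject `U` of `X` to a
quotient `Y/N`. There is only a small set of these data. -/
instance locallySmall_serreQuotient [LocallySmall.{w} A] [WellPowered.{w} A] :
    LocallySmall.{w} (SerreQuotient P) where
  hom_small X' Y' := by
    classical
    obtain ⟨X, rfl⟩ := (Localization.Construction.objEquiv P.isoModSerre).surjective X'
    obtain ⟨Y, rfl⟩ := (Localization.Construction.objEquiv P.isoModSerre).surjective Y'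
    let L := toQuotient P
    change Small.{w} (L.obj X ⟶ L.obj Y)
    let I := Σ (U : Subobject X) (N : Subobject Y), ((U : A) ⟶ cokernel N.arrow)
    let φ : I → (L.obj X ⟶ L.obj Y) := fun t =>
      if h : IsIso (L.map t.1.arrow) ∧ IsIso (L.map (cokernel.π t.2.1.arrow)) then
        letI := h.1
        letI := h.2
        inv (L.map t.1.arrow) ≫ L.map t.2.2 ≫ inv (L.map (cokernel.π t.2.1.arrow))
      else 0
    refine small_of_surjective (f := φ) fun z => ?_
    obtain ⟨r, hr⟩ := Localization.exists_rightFraction L P.isoModSerre z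
    let U := imageSubobject r.s
    let p := factorThruImageSubobject r.s
    let N := imageSubobject (kernel.ι p ≫ r.f)
    have hsp : L.map p ≫ L.map U.arrow = L.map r.s := by
      rw [← L.map_comp, imageSubobject_arrow_comp]
    have := Localization.inverts L _ _ r.hs
    have h₁ : IsIso (L.map U.arrow) :=
      have : Epi (L.map U.arrow) := epi_of_epi_fac hsp
      isIso_of_mono_of_epi _
    have h₃ : IsIso (L.map p) := IsIso.of_isIso_fac_right hsp
    have hN : P N := P.prop_of_epi (factorThruImageSubobject _)
      ((ObjectProperty.SerreClassLocalization.isIso_map_iff L P p).1 h₃).1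
    have h₂ : IsIso (L.map (cokernel.π N.arrow)) :=
      Localization.inverts L P.isoModSerre _ (P.isoModSerre_of_epi _
        (P.prop_of_epi (Abelian.factorThruImage N.arrow) hN))
    obtain ⟨g, hg⟩ : ∃ g : (U : A) ⟶ cokernel N.arrow, p ≫ g = r.f ≫ cokernel.π N.arrow :=
      ShortComplex.Exact.desc' (S := ShortComplex.mk _ _ (kernel.condition p))
        (ShortComplex.exact_kernel p) (r.f ≫ cokernel.π N.arrow) (by
          dsimp
          rw [← Category.assoc, ← subobject_factors_iff]
          exact imageSubobject_factors_self _)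
    refine ⟨⟨U, N, g⟩, ?_⟩
    rw [hr]
    dsimp only [φ]
    rw [dif_pos ⟨h₁, h₂⟩, ← cancel_epi (L.map r.s), r.map_s_comp_map, ← hsp, Category.assoc,
      IsIso.hom_inv_id_assoc, ← Category.assoc, ← L.map_comp, hg, L.map_comp, Category.assoc,
      IsIso.hom_inv_id, Category.comp_id]

variable {P} in
-- Exact coproducts commute with kernels and cokernels, and `P` is closed under coproducts.
lemma isoModSerre_colimMap {J : Type w} [P.IsClosedUnderColimitsOfShape (Discrete J)]
    [HasColimitsOfShape (Discrete J) A] [HasExactColimitsOfShape (Discrete J) A]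
    {F G : Discrete J ⥤ A} (α : F ⟶ G) (h : ∀ j, P.isoModSerre (α.app j)) :
    P.isoModSerre (colim.map α) := by
  constructor
  · exact P.prop_of_iso (PreservesKernel.iso colim α)
      (P.prop_colimit _ fun j => P.prop_of_iso
        (PreservesKernel.iso ((evaluation _ _).obj j) α).symm (h j).1)
  · exact P.prop_of_iso (PreservesCokernel.iso colim α)
      (P.prop_colimit _ fun j => P.prop_of_iso
        (PreservesCokernel.iso ((evaluation _ _).obj j) α).symm (h j).2)

/-- The uniqueness half of preservation of coproducts. Each component vanishes after precomposition
with a morphism that is invertible in the quotient, and the coproduct of these morphisms is again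
invertible there. -/
lemma eq_zero_of_toQuotient_map_colimitι {J : Type w}
    [P.IsClosedUnderColimitsOfShape (Discrete J)]
    [HasColimitsOfShape (Discrete J) A] [HasExactColimitsOfShape (Discrete J) A]
    {F : Discrete J ⥤ A} {Z : SerreQuotient P} (z : (toQuotient P).obj (colimit F) ⟶ Z)
    (h : ∀ j, (toQuotient P).map (colimit.ι F j) ≫ z = 0) : z = 0 := by
  let L := toQuotient P
  obtain ⟨Y, rfl⟩ : ∃ Y, L.obj Y = Z :=
    (Localization.Construction.objEquiv P.isoModSerre).surjective Z
  change L.obj (colimit F) ⟶ L.obj Y at z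
  change z = 0
  obtain ⟨r, hr⟩ := Localization.exists_leftFraction L P.isoModSerre z
  have := Localization.inverts L _ _ r.hs
  have hz : z ≫ L.map r.s = L.map r.f := by rw [hr, r.map_comp_map_s]
  have h' (j) : ∃ (X' : A) (s : X' ⟶ F.obj j) (_ : P.isoModSerre s),
      s ≫ colimit.ι F j ≫ r.f = 0 := by
    rw [ObjectProperty.exists_isoModSerre_comp_eq_zero_iff,
      ← ObjectProperty.SerreClassLocalization.map_eq_zero_iff L P, L.map_comp, ← hz]
    exact (Category.assoc _ _ _).symm.trans ((congrArg (· ≫ _) (h j)).trans zero_comp)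
  choose X' s hs h₀ using h'
  let α : Discrete.functor (fun j : J => X' ⟨j⟩) ⟶ F := Discrete.natTrans fun j => s j
  have hα := Localization.inverts L _ _ (isoModSerre_colimMap (P := P) α fun j => hs j)
  have h₁ : colim.map α ≫ r.f = 0 := by
    refine colimit.hom_ext fun j => ?_
    rw [comp_zero]
    refine (colimit.ι_map_assoc α j r.f).trans (h₀ j)
  rw [← cancel_mono (L.map r.s), hz, zero_comp, ← cancel_epi (L.map (colim.map α)), comp_zero,
    ← L.map_comp, h₁, L.map_zero]

/-- The components of a cocone are right fractions. The coproduct of their denominators is inverted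
by the quotient functor, so the morphism induced by the numerators can be divided by it. -/
lemma preservesColimitsOfShape_discrete_toQuotient {J : Type w}
    [P.IsClosedUnderColimitsOfShape (Discrete J)]
    [HasColimitsOfShape (Discrete J) A] [HasExactColimitsOfShape (Discrete J) A] :
    PreservesColimitsOfShape (Discrete J) (toQuotient P) where
  preservesColimit {F} := by
    let L := toQuotient P
    refine preservesColimit_of_preserves_colimit_cocone (colimit.isColimit F)
      (IsColimit.ofExistsUnique fun s => ?_)
    have : L.EssSurj := Localization.essSurj L P.isoModSerre
    let e : L.obj (L.objPreimage s.pt) ≅ s.pt := L.objObjPreimageIso s.pt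
    let Y := L.objPreimage s.pt
    choose r hr using fun j => Localization.exists_rightFraction L P.isoModSerre
      (s.ι.app j ≫ e.inv)
    let G : Discrete J ⥤ A := Discrete.functor fun j => (r ⟨j⟩).X'
    let α : G ⟶ F := Discrete.natTrans fun j => (r j).s
    have hα := Localization.inverts L _ _ (isoModSerre_colimMap α fun j => (r j).hs)
    let f : colimit G ⟶ Y := colimit.desc G { pt := Y, ι := Discrete.natTrans fun j => (r j).f }
    have hd (j) : L.map (colimit.ι F j) ≫ inv (L.map (colim.map α)) ≫ L.map f ≫ e.hom =
        s.ι.app j := by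
      have := Localization.inverts L _ _ (r j).hs
      have h₁ : L.map (r j).s ≫ L.map (colimit.ι F j) =
          L.map (colimit.ι G j) ≫ L.map (colim.map α) := by
        rw [← L.map_comp, ← L.map_comp, colimit.ι_map]
        rfl
      have h₂ : L.map (r j).s ≫ s.ι.app j = L.map (r j).f ≫ e.hom := by
        rw [← cancel_mono e.inv, Category.assoc, hr, (r j).map_s_comp_map, Category.assoc,
          Iso.hom_inv_id, Category.comp_id]
      have h₃ : L.map (colimit.ι G j) ≫ L.map f = L.map (r j).f := by
        rw [← L.map_comp, colimit.ι_desc]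
        rfl
      rw [← cancel_epi (L.map (r j).s), h₂]
      refine (Category.assoc _ _ _).symm.trans ((congrArg (· ≫ _) h₁).trans ?_)
      rw [Category.assoc, IsIso.hom_inv_id_assoc, reassoc_of% h₃]
    refine ⟨inv (L.map (colim.map α)) ≫ L.map f ≫ e.hom, hd, fun z hz => ?_⟩
    rw [← sub_eq_zero]
    refine eq_zero_of_toQuotient_map_colimitι P _ fun j => ?_
    rw [Preadditive.comp_sub, sub_eq_zero]
    exact (hz j).trans (hd j).symm

variable {P}

lemma IsLocalizing.preservesColimits_toQuotient [IsGrothendieckAbelian.{w} A]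
    (hP : IsLocalizing.{w} P) : PreservesColimitsOfSize.{w, w} (toQuotient P) := by
  have (J : Type w) : PreservesColimitsOfShape (Discrete J) (toQuotient P) :=
    have := hP.closedUnderCoproducts J
    preservesColimitsOfShape_discrete_toQuotient P
  exact preservesColimits_of_preservesCoequalizers_and_coproducts _

lemma IsLocalizing.isLeftAdjoint_toQuotient [IsGrothendieckAbelian.{v} A]
    (hP : IsLocalizing.{v} P) : (toQuotient P).IsLeftAdjoint := by
  have := hP.preservesColimits_toQuotient
  -- The morphisms of the quotient are only essentially small, so the adjoint functor theorem is
  -- applied to an equivalent category.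
  let e := ShrinkHoms.equivalence.{v} (SerreQuotient P)
  have : (toQuotient P ⋙ e.functor).IsLeftAdjoint :=
    isLeftAdjoint_of_preservesColimits_of_isSeparating (isSeparator_separator A) _
  have : ((toQuotient P ⋙ e.functor) ⋙ e.inverse).IsLeftAdjoint := inferInstance
  exact Functor.isLeftAdjoint_of_iso (Functor.associator _ _ _ ≪≫
    Functor.isoWhiskerLeft _ e.unitIso.symm ≪≫ Functor.rightUnitor _)

/-- The section functor of a Gabriel quotient. -/
lemma IsLocalizing.exists_adjunction [IsGrothendieckAbelian.{v} A] (hP : IsLocalizing.{v} P) :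
    ∃ (j : SerreQuotient P ⥤ A) (_ : toQuotient P ⊣ j), j.Full ∧ j.Faithful := by
  have := hP.isLeftAdjoint_toQuotient
  have adj := Adjunction.ofIsLeftAdjoint (toQuotient P)
  have := isIso_counit_of_isLocalization P.isoModSerre adj
  exact ⟨_, adj, adj.fullyFaithfulROfIsIsoCounit.full, adj.fullyFaithfulROfIsIsoCounit.faithful⟩

/-- Exact reflective subcategories of Grothendieck categories are Grothendieck categories. -/
lemma isGrothendieckAbelian_of_reflective [IsGrothendieckAbelian.{w} A] {B : Type*} [Category* B]
    [Abelian B] {L : A ⥤ B} {j : B ⥤ A} (adj : L ⊣ j) [j.Full] [j.Faithful]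
    [PreservesFiniteLimits L] : IsGrothendieckAbelian.{w} B := by
  let : Reflective j := { L := L, adj := adj }
  have : HasFilteredColimitsOfSize.{w, w} B := ⟨fun _ _ _ => hasColimitsOfShape_of_reflective j⟩
  exact
    { locallySmall := locallySmall_of_faithful j
      ab5OfSize := ⟨fun J _ _ => adj.hasExactColimitsOfShape J⟩
      hasSeparator := ⟨L.obj (separator A), (isSeparator_def _).2 fun X Y f g h =>
        j.map_injective ((isSeparator_separator A).def _ _ fun k => by
          have := congrArg (adj.homEquiv _ _) (h ((adj.homEquiv _ _).symm k))
          simpa only [adj.homEquiv_naturality_right, Equiv.apply_symm_apply] using this)⟩ }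

lemma IsLocalizing.isGrothendieckAbelian_serreQuotient [IsGrothendieckAbelian.{v} A]
    (hP : IsLocalizing.{v} P) : IsGrothendieckAbelian.{v} (SerreQuotient P) := by
  obtain ⟨j, adj, _, _⟩ := hP.exists_adjunction
  exact isGrothendieckAbelian_of_reflective adj

end Gabriel

end CategoryTheory

namespace VFunctor

/-! ### Free `V`-functors -/

section Representable

variable {V : Type u} [Category.{v} V] [MonoidalCategory V] [MonoidalClosed V]
  {C : Type u₁} [EnrichedCategory V C]

/-- The free `V`-functor `d ↦ G ⊗ C(c, d)`. -/
noncomputable def free (G : V) (c : C) : VFunctor V C :=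
  ofAct (fun d => G ⊗ (c ⟶[V] d)) (fun a b => (α_ _ _ _).hom ≫ G ◁ eComp V c a b)
    (fun a => by
      rw [associator_naturality_right_assoc, ← MonoidalCategory.whiskerLeft_comp,
        ← cancel_epi (ρ_ (G ⊗ (c ⟶[V] a))).inv, Iso.inv_hom_id, rightUnitor_tensor_inv]
      simp only [Category.assoc, Iso.inv_hom_id_assoc]
      rw [← MonoidalCategory.whiskerLeft_comp, e_comp_id, MonoidalCategory.whiskerLeft_id])
    (fun a b d => by
      simp only [comp_whiskerRight, Category.assoc]
      rw [associator_naturality_middle_assoc, associator_naturality_right_assoc,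
        ← MonoidalCategory.whiskerLeft_comp, ← MonoidalCategory.whiskerLeft_comp, ← e_assoc]
      simp [-MonoidalCategory.whiskerLeft_comp]
      rw [← MonoidalCategory.whiskerLeft_comp, e_assoc])

/-- The morphism from a free `V`-functor given by an element. -/
noncomputable def freeDesc {G : V} {c : C} {F : VFunctor V C} (f : G ⟶ F.obj c) : free G c ⟶ F :=
  Hom.ofAct (fun d => f ▷ _ ≫ F.act c d) (fun a b => by
    have h : (free G c).act a b = (α_ _ _ _).hom ≫ G ◁ eComp V c a b := ofAct_act _ _ _ _ a b
    refine (congrArg (· ≫ f ▷ _ ≫ F.act c b) h).trans ?_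
    change ((α_ _ _ _).hom ≫ G ◁ eComp V c a b) ≫ f ▷ _ ≫ F.act c b =
      (f ▷ _ ≫ F.act c a) ▷ _ ≫ F.act a b
    simp only [comp_whiskerRight, Category.assoc]
    rw [whisker_exchange_assoc, act_comp, associator_inv_naturality_left_assoc]
    simp)

lemma freeDesc_app {G : V} {c : C} {F : VFunctor V C} (f : G ⟶ F.obj c) :
    (ρ_ G).inv ≫ G ◁ eId V c ≫ (freeDesc f).app c = f := by
  change (ρ_ G).inv ≫ G ◁ eId V c ≫ f ▷ _ ≫ F.act c c = f
  rw [whisker_exchange_assoc, act_id]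
  simp

lemma freeDesc_comp {G : V} {c : C} {F F' : VFunctor V C} (f : G ⟶ F.obj c) (g : F ⟶ F') :
    freeDesc f ≫ g = freeDesc (f ≫ g.app c) := by
  refine hom_ext fun d => ?_
  change (f ▷ _ ≫ F.act c d) ≫ g.app d = (f ≫ g.app c) ▷ _ ≫ F'.act c d
  rw [Category.assoc, g.act_naturality, comp_whiskerRight_assoc]

end Representable

/-! ### The Grothendieck category of `V`-functors -/

section Grothendieck

variable {V : Type u} [Category.{v} V] [MonoidalCategory V] [SymmetricCategory V]
  [MonoidalClosed V] [Abelian V] [IsGrothendieckAbelian.{v} V]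
  {C : Type v} [EnrichedCategory V C]

lemma mono_of_app {F G : VFunctor V C} (f : F ⟶ G) (h : ∀ c, Mono (f.app c)) : Mono f := by
  constructor
  intro Z g g' hg
  refine hom_ext fun c => ?_
  rw [← cancel_mono (f.app c)]
  exact congrArg (fun k => Hom.app k c) hg

instance {J : Type v} [SmallCategory J] [IsFiltered J] :
    HasExactColimitsOfShape J (VFunctor V C) := by
  have : (Limits.colim : (J ⥤ VFunctor V C) ⥤ _).PreservesMonomorphisms :=
    { preserves := fun {F G} α _ => mono_of_app _ fun c => by
        let e := preservesColimitNatIso (J := J) (eval V c : VFunctor V C ⥤ V)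
        have : Mono (Limits.colim.map (Functor.whiskerRight α (eval V c))) := by
          have (j : J) : Mono ((Functor.whiskerRight α (eval V c)).app j) :=
            inferInstanceAs (Mono ((eval V c).map (α.app j)))
          have := NatTrans.mono_of_mono_app (Functor.whiskerRight α (eval V c))
          infer_instance
        exact ((MorphismProperty.monomorphisms V).arrow_mk_iso_iff
          (Arrow.isoMk (e.app F) (e.app G) (e.hom.naturality α).symm)).2 this }
  exact hasExactColimitsOfShape_of_preservesMono (J := J) (C := VFunctor V C)

/-- By the enriched Yoneda lemma, morphisms from `free G c` to `F` restrict onto all morphisms `G ⟶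
F.obj c`, so a separator of `V` separates at each `c`. -/
lemma isSeparating_free : ObjectProperty.IsSeparating
    (.ofObj fun c : C => (free (separator V) c : VFunctor V C)) := by
  intro F F' g g' h
  refine hom_ext fun c => (isSeparator_separator V).def _ _ fun f => ?_
  have := h _ ⟨c⟩ (freeDesc f)
  rw [freeDesc_comp, freeDesc_comp] at this
  rw [← freeDesc_app (f ≫ g.app c), this, freeDesc_app]

instance : HasFilteredColimitsOfSize.{v, v} (VFunctor V C) := ⟨fun _ _ _ => inferInstance⟩

instance : IsGrothendieckAbelian.{v} (VFunctor V C) where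
  hasFilteredColimitsOfSize := inferInstance
  ab5OfSize := ⟨fun _ _ _ => inferInstance⟩
  hasSeparator := ⟨_, (isSeparating_free (V := V) (C := C)).isSeparator_coproduct⟩

instance mono_app {F G : VFunctor V C} (f : F ⟶ G) [Mono f] (a : C) : Mono (f.app a) :=
  inferInstanceAs (Mono ((eval V a : VFunctor V C ⥤ V).map f))

instance epi_app {F G : VFunctor V C} (f : F ⟶ G) [Epi f] (a : C) : Epi (f.app a) :=
  inferInstanceAs (Epi ((eval V a : VFunctor V C ⥤ V).map f))

/-- The class of the functors vanishing on `A` is localizing. -/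
lemma isLocalizing_vanishingOn (A : Set C) : IsLocalizing.{v} (vanishingOn V A) where
  isSerreClass :=
    { exists_zero := ⟨_, isZero_zero _, fun a _ => (eval V a).map_isZero (isZero_zero _)⟩
      prop_of_mono := fun f _ h a ha =>
        have := mono_app f a
        IsZero.of_mono (f.app a) (h a ha)
      prop_of_epi := fun f _ h a ha =>
        have := epi_app f a
        IsZero.of_epi (f.app a) (h a ha)
      prop_X₂_of_shortExact := fun hS h₁ h₃ a ha =>
        (hS.map_of_exact (eval V a)).exact.isZero_of_both_zeros
          ((h₁ a ha).eq_of_src _ _) ((h₃ a ha).eq_of_tgt _ _) }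
  closedUnderCoproducts J :=
    { colimitsOfShape_le := fun F ⟨h⟩ a ha => by
        rw [IsZero.iff_id_eq_zero]
        exact (isColimitOfPreserves (eval V a) h.isColimit).hom_ext fun j =>
          (h.prop_diag_obj j a ha).eq_of_src _ _ }

end Grothendieck

end VFunctor

namespace CategoryTheory
open ZeroObject

/-! ### Local objects and the section functor -/

section SectionFunctor

variable {A : Type u} [Category.{v} A] [Abelian A] {P : ObjectProperty A} [P.IsSerreClass]
  {j : SerreQuotient P ⥤ A} (adj : toQuotient P ⊣ j)

include adj in
lemma isLocalObj_section (Z : SerreQuotient P) : IsLocalObj P (j.obj Z) := by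
  intro X Y f hf
  have := Localization.inverts (toQuotient P) _ f hf
  have h : (fun g : Y ⟶ j.obj Z => f ≫ g) = (adj.homEquiv _ _) ∘
      (fun g => (toQuotient P).map f ≫ g) ∘ (adj.homEquiv _ _).symm := by
    ext g
    simp [adj.homEquiv_naturality_left]
  rw [h]
  refine (adj.homEquiv _ _).bijective.comp (Function.Bijective.comp ?_
    (adj.homEquiv _ _).symm.bijective)
  exact (Iso.homFromEquiv (asIso ((toQuotient P).map f))).symm.bijective

lemma isoModSerre_unit (X : A) : P.isoModSerre (adj.unit.app X) := by
  rw [← ObjectProperty.SerreClassLocalization.isIso_map_iff (toQuotient P) P]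
  have := isIso_counit_of_isLocalization P.isoModSerre adj
  have h := adj.left_triangle_components X
  have : IsIso ((toQuotient P).map (adj.unit.app X) ≫
      adj.counit.app ((toQuotient P).obj X)) := h ▸ IsIso.id _
  exact IsIso.of_isIso_comp_right _ (adj.counit.app ((toQuotient P).obj X))

lemma isIso_unit_of_isLocalObj {X : A} (hX : IsLocalObj P X) : IsIso (adj.unit.app X) := by
  have hu := isoModSerre_unit adj X
  obtain ⟨r, hr⟩ := (hX _ hu).2 (𝟙 X)
  refine ⟨r, hr, (isLocalObj_section adj _ _ hu).1 ?_⟩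
  dsimp at hr ⊢
  rw [reassoc_of% hr, Category.comp_id]

end SectionFunctor

/-! ### The Voevodsky property and the join -/

section Join

variable {A : Type u} [Category.{v} A] [Abelian A] [IsGrothendieckAbelian.{v} A]
  {P S : ObjectProperty A} [P.IsSerreClass]
  {j : SerreQuotient P ⥤ A} (adj : toQuotient P ⊣ j)
  (hP : IsLocalizing.{v} P) (hS : IsLocalizing.{v} S) (hPS : VoevodskyProperty S P)

-- The Voevodsky property makes membership in `S^P` a condition on the section `j Z` itself, so
-- closure properties of `S` transfer to `S^P`.
include adj hS hPS in
lemma imageInQuotient_iff (Z : SerreQuotient P) : imageInQuotient S P Z ↔ S (j.obj Z) := by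
  have := hS.isSerreClass
  have := isIso_counit_of_isLocalization P.isoModSerre adj
  constructor
  · rintro ⟨X, hX, ⟨e⟩⟩
    exact S.prop_of_iso (j.mapIso e)
      (hPS (adj.unit.app X) hX (isoModSerre_unit adj X) (isLocalObj_section adj _))
  · exact fun h => ⟨_, h, ⟨asIso (adj.counit.app Z)⟩⟩

include adj hP hS hPS in
lemma isLocalizing_imageInQuotient : IsLocalizing.{v} (imageInQuotient S P) where
  isSerreClass := by
    have := hS.isSerreClass
    have : j.IsRightAdjoint := adj.isRightAdjoint
    have : j.Additive := adj.right_adjoint_additive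
    have := isIso_counit_of_isLocalization P.isoModSerre adj
    have hT := imageInQuotient_iff adj hS hPS
    exact
      { exists_zero := ⟨0, isZero_zero _, (hT _).2
          (S.prop_of_isZero (j.map_isZero (isZero_zero _)))⟩
        prop_of_mono := fun f _ h => (hT _).2 (S.prop_of_mono (j.map f) ((hT _).1 h))
        -- The section functor need not preserve epimorphisms, but the cokernel of `j f` is in `P`.
        -- So the local object `j Y` is the localization of the image of `j f`, which is in `S` as a
        -- quotient of `j X`.
        prop_of_epi := fun {X Y} f _ h => by
          rw [hT] at h ⊢
          have hLf : (toQuotient P).map (j.map f) =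
              adj.counit.app X ≫ f ≫ inv (adj.counit.app Y) := by
            have h₁ := adj.counit_naturality f
            rw [← Category.assoc]
            exact (IsIso.eq_comp_inv _).2 h₁
          have : Epi ((toQuotient P).map (j.map f)) := by
            rw [hLf]
            infer_instance
          exact hPS (Abelian.image.ι (j.map f))
            (S.prop_of_epi (Abelian.factorThruImage (j.map f)) h)
            (((ObjectProperty.SerreClassLocalization.epi_map_iff (toQuotient P) P _).1
              this).isoModSerre_image_ι)
            (isLocalObj_section adj _)
        prop_X₂_of_shortExact := fun {E} hE h₁ h₃ => by
          rw [hT] at h₁ h₃ ⊢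
          have := hE.mono_f
          exact S.prop_X₂_of_exact (S := E.map j)
            ((hE.exact.map_of_mono_of_preservesKernel j inferInstance inferInstance)) h₁ h₃ }
  closedUnderCoproducts J :=
    { colimitsOfShape_le := by
        rintro Z ⟨h⟩
        have := hS.isSerreClass
        have := isIso_counit_of_isLocalization P.isoModSerre adj
        have := hP.preservesColimits_toQuotient
        have := hS.closedUnderCoproducts J
        -- The coproduct of the sections, formed in `A`, is in `S`, and its localization is the
        -- given coproduct.
        refine ⟨colimit (h.diag ⋙ j), S.prop_colimit _ fun k =>
          (imageInQuotient_iff adj hS hPS _).1 (h.prop_diag_obj k), ⟨?_⟩⟩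
        exact (isColimitOfPreserves (toQuotient P)
          (colimit.isColimit (h.diag ⋙ j))).coconePointsIsoOfNatIso
          h.isColimit (Functor.associator _ _ _ ≪≫
            Functor.isoWhiskerLeft _ (asIso adj.counit) ≪≫ Functor.rightUnitor _) }

-- The objects whose localization is in `S^P` form a localizing subcategory containing `P` and `S`.
-- Conversely such an object is an extension of a subobject of `j (X_P)`, which is in `S`, by the
-- kernel of its unit, which is in `P`.
include adj hP hS hPS in
lemma join_iff (X : A) :
    join.{v} P S X ↔ imageInQuotient S P ((toQuotient P).obj X) := by
  have := hS.isSerreClass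
  have hT := isLocalizing_imageInQuotient adj hP hS hPS
  have := hT.isSerreClass
  have := hP.preservesColimits_toQuotient
  constructor
  · refine fun h => h ((imageInQuotient S P).inverseImage (toQuotient P))
      ⟨inferInstance, fun J => ?_⟩
      (fun Y hY => ?_) (fun Y hY => ⟨Y, hY, ⟨Iso.refl _⟩⟩)
    · have := hT.closedUnderCoproducts J
      exact ⟨by
        rintro Z ⟨h⟩
        exact (imageInQuotient S P).prop_of_isColimit
          (isColimitOfPreserves (toQuotient P) h.isColimit)
          h.prop_diag_obj⟩
    · exact (imageInQuotient S P).prop_of_isZero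
        ((ObjectProperty.SerreClassLocalization.isZero_obj_iff (toQuotient P) P Y).2 hY)
  · intro h
    let f := adj.unit.app X
    exact (join.{v} P S).prop_X₂_of_exact (S := ShortComplex.mk _ _ (kernel.condition f))
      (ShortComplex.exact_kernel f) (le_join_left P S _ (isoModSerre_unit adj X).1)
      (le_join_right P S _ ((imageInQuotient_iff adj hS hPS _).1 h))

include adj hP hS hPS in
lemma isZero_quotientFunctor_obj_iff (Z : SerreQuotient P) :
    IsZero ((quotientFunctor (le_join_left.{v} P S)).obj Z) ↔ imageInQuotient S P Z := by
  obtain ⟨X, rfl⟩ : ∃ X, (toQuotient P).obj X = Z :=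
    (Localization.Construction.objEquiv P.isoModSerre).surjective Z
  rw [← join_iff adj hP hS hPS,
    ← ObjectProperty.SerreClassLocalization.isZero_obj_iff (toQuotient (join.{v} P S))
      (join.{v} P S)]
  exact ((quotientFunctorIso (le_join_left.{v} P S)).app X).isZero_iff

end Join

/-! ### The right adjoint of the functor between quotients -/

section QuotientFunctor

variable {A : Type u} [Category.{v} A] [Abelian A] [IsGrothendieckAbelian.{v} A]
  {P P' : ObjectProperty A} [P.IsSerreClass] [P'.IsSerreClass] (h : P ≤ P')
  (hP : IsLocalizing.{v} P) (hP' : IsLocalizing.{v} P')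

include h in
lemma IsLocalObj.of_le {X : A} (hX : IsLocalObj P' X) : IsLocalObj P X :=
  fun _ _ f hf => hX f ⟨h _ hf.1, h _ hf.2⟩

-- Sections for `P'` are `P'`-local, hence `P`-local, so the section functor of `P'` factors through
-- that of `P` and the adjunction restricts to `SerreQuotient P`.
include hP hP' in
lemma exists_quotientFunctor_adjunction :
    ∃ (s : SerreQuotient P' ⥤ SerreQuotient P) (adj : quotientFunctor h ⊣ s),
      s.Additive ∧ IsIso adj.counit := by
  obtain ⟨j, adj, _, _⟩ := hP.exists_adjunction
  obtain ⟨j', adj', _, _⟩ := hP'.exists_adjunction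
  have := isIso_counit_of_isLocalization P.isoModSerre adj
  have := isIso_counit_of_isLocalization P'.isoModSerre adj'
  let s := j' ⋙ toQuotient P
  have hu (Y : SerreQuotient P') : IsIso (adj.unit.app (j'.obj Y)) :=
    isIso_unit_of_isLocalObj adj ((isLocalObj_section adj' Y).of_le h)
  let c₁ : j ⋙ toQuotient P' ≅ quotientFunctor h ⋙ 𝟭 _ :=
    Functor.isoWhiskerLeft j (quotientFunctorIso h).symm ≪≫
      Functor.isoWhiskerRight (asIso adj.counit) (quotientFunctor h)
  let c₂ : 𝟭 _ ⋙ j' ≅ s ⋙ j :=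
    NatIso.ofComponents (fun Y => asIso (adj.unit.app (j'.obj Y)))
      (fun f => adj.unit.naturality (j'.map f))
  let a := adj'.restrictFullyFaithful (.ofFullyFaithful j) (.id _) c₁ c₂
  refine ⟨s, a, a.right_adjoint_additive, ?_⟩
  have (Y : SerreQuotient P') : IsIso (a.counit.app Y) := by
    have h₁ := adj'.map_restrictFullyFaithful_counit_app (.ofFullyFaithful j) (.id _) c₁ c₂ Y
    exact (congrArg IsIso h₁).mpr (inferInstanceAs (IsIso (c₁.inv.app _ ≫
      (toQuotient P').map (c₂.inv.app Y) ≫ adj'.counit.app Y)))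
  exact NatIso.isIso_of_isIso_app _

end QuotientFunctor

/-! ### The functor between quotients as a localization -/

section Join

variable {A : Type u} [Category.{v} A] [Abelian A] [IsGrothendieckAbelian.{v} A]
  {P S : ObjectProperty A} [P.IsSerreClass]
  (hP : IsLocalizing.{v} P) (hS : IsLocalizing.{v} S) (hPS : VoevodskyProperty S P)

-- An exact functor with a fully faithful right adjoint is the localization at its kernel, and here
-- the kernel is `S^P`.
include hP hS hPS in
lemma isLocalization_quotientFunctor :
    ∃ _ : (imageInQuotient S P).IsSerreClass,
      (quotientFunctor (le_join_left.{v} P S)).IsLocalization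
        (imageInQuotient S P).isoModSerre := by
  obtain ⟨j, adj, _, _⟩ := hP.exists_adjunction
  have h₁ := (isLocalizing_imageInQuotient adj hP hS hPS).isSerreClass
  refine ⟨h₁, ?_⟩
  obtain ⟨s, a, _, _⟩ := exists_quotientFunctor_adjunction (le_join_left.{v} P S) hP
    (join_isLocalizing P S)
  have := a.fullyFaithfulROfIsIsoCounit.full
  have := a.fullyFaithfulROfIsIsoCounit.faithful
  have h₂ : (quotientFunctor (le_join_left.{v} P S)).kernel = imageInQuotient S P := by
    ext Z
    exact isZero_quotientFunctor_obj_iff adj hP hS hPS Z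
  have h₃ := Abelian.isLocalization_isoModSerre_kernel_of_leftAdjoint a
  have h₄ : (quotientFunctor (le_join_left.{v} P S)).kernel.isoModSerre =
      (imageInQuotient S P).isoModSerre := by
    ext X Y f
    simp only [ObjectProperty.isoModSerre_iff, ObjectProperty.monoModSerre_iff,
      ObjectProperty.epiModSerre_iff, h₂]
  rwa [h₄] at h₃

end Join


/-! ### Acyclic products of acyclic complexes -/

section Products

variable {A : Type u} [Category.{v} A] [Abelian A] {ι : Type w}
  {F : Discrete ι ⥤ CochainComplex A ℤ} {c : Cone F} (hc : IsLimit c)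
  [HasLimitsOfShape (Discrete ι) A]

include hc in
/-- A morphism to a product of complexes is null-homotopic if its components are. -/
lemma nonempty_homotopy_zero_of_isLimit {K : CochainComplex A ℤ} (f : K ⟶ c.pt)
    (h : ∀ i, Nonempty (Homotopy (f ≫ c.π.app i) 0)) : Nonempty (Homotopy f 0) := by
  let H i := (h i).some
  have hc' (n : ℤ) := isLimitOfPreserves (HomologicalComplex.eval A (.up ℤ) n) hc
  -- Products are formed degreewise, so the chosen homotopies of the components assemble.
  have hlift (p q : ℤ) : ∃ g : K.X p ⟶ c.pt.X q, ∀ i, g ≫ (c.π.app i).f q = (H i).hom p q :=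
    ⟨(hc' q).lift ⟨_, Discrete.natTrans fun i => (H i).hom p q⟩, fun i => (hc' q).fac _ i⟩
  choose g hg using hlift
  refine ⟨{ hom := g, zero := fun p q hpq => ?_, comm := fun p => ?_ }⟩
  · refine (hc' q).hom_ext fun i => ?_
    exact (hg p q i).trans (((H i).zero p q hpq).trans zero_comp.symm)
  · refine (hc' p).hom_ext fun i => ?_
    change f.f p ≫ (c.π.app i).f p = _ ≫ (c.π.app i).f p
    have := (H i).comm p
    simp only [HomologicalComplex.comp_f, HomologicalComplex.zero_f, add_zero] at this ⊢
    rw [this, Preadditive.add_comp, ← dNext_comp_right, ← prevD_comp_right]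
    simp only [hg]

-- An acyclic K-injective complex is contractible, and products of contractible complexes are
-- contractible.
include hc in
lemma acyclic_of_isLimit_of_isKInjective (h : ∀ i, (F.obj i).Acyclic)
    (h' : ∀ i, (F.obj i).IsKInjective) : c.pt.Acyclic := by
  obtain ⟨H⟩ := nonempty_homotopy_zero_of_isLimit hc (𝟙 _) (fun i => by
    have := h' i
    have e := CochainComplex.IsKInjective.homotopyZero (𝟙 (F.obj i)) (h i)
    exact ⟨((Homotopy.ofEq (by simp)).trans (e.compLeft (c.π.app i))).trans
      (Homotopy.ofEq (by simp))⟩)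
  intro n
  rw [HomologicalComplex.exactAt_iff_isZero_homology, IsZero.iff_id_eq_zero,
    ← HomologicalComplex.homologyMap_id, H.homologyMap_eq, HomologicalComplex.homologyMap_zero]

-- The generators detect acyclicity. A morphism from a shift of `P j` to the product in the derived
-- category is a chain map because `P j` is K-projective. Its components are null-homotopic because
-- the factors are acyclic, so it is null-homotopic itself.
include hc in
lemma acyclic_of_isLimit_of_isKProjective [HasDerivedCategory.{w₁} A] {J : Type w₂}
    (P : J → CochainComplex A ℤ) [∀ j, (P j).IsKProjective]
    (hP : ∀ (X : DerivedCategory A),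
      (∀ (j : J) (n : ℤ) (f : (DerivedCategory.Q.obj (P j))⟦n⟧ ⟶ X), f = 0) → IsZero X)
    (h : ∀ i, (F.obj i).Acyclic) : c.pt.Acyclic := by
  have h₀ : IsZero (DerivedCategory.Q.obj c.pt) := by
    refine hP _ fun j n f => ?_
    let e := (DerivedCategory.Q.commShiftIso n).app (P j)
    obtain ⟨g, hg⟩ : ∃ g : (P j)⟦n⟧ ⟶ c.pt, DerivedCategory.Q.map g = e.hom ≫ f := by
      obtain ⟨x, hx⟩ := (CochainComplex.IsKProjective.Qh_map_bijective ((P j)⟦n⟧)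
        ((HomotopyCategory.quotient _ _).obj c.pt)).2
          ((DerivedCategory.quotientCompQhIso A).hom.app _ ≫ (e.hom ≫ f) ≫
            (DerivedCategory.quotientCompQhIso A).inv.app _)
      obtain ⟨g, rfl⟩ := (HomotopyCategory.quotient A (.up ℤ)).map_surjective x
      refine ⟨g, ?_⟩
      have h₁ := (DerivedCategory.quotientCompQhIso A).hom.naturality g
      rw [← cancel_epi ((DerivedCategory.quotientCompQhIso A).hom.app _), ← h₁]
      refine (congrArg (· ≫ _) hx).trans ?_
      simp
    obtain ⟨H⟩ := nonempty_homotopy_zero_of_isLimit hc g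
      (fun i => ⟨CochainComplex.IsKProjective.homotopyZero _ (h i)⟩)
    rw [← cancel_epi e.hom, ← hg, DerivedCategory.Q_map_eq_of_homotopy A H, Functor.map_zero,
      comp_zero]
  intro n
  rw [HomologicalComplex.exactAt_iff_isZero_homology]
  exact ((DerivedCategory.homologyFunctor A n).map_isZero h₀).of_iso
    ((DerivedCategory.homologyFunctorFactors A n).app c.pt).symm

-- A fibrant acyclic complex is trivially fibrant over the terminal object, which is a right lifting
-- property, and such properties pass to products.
open HomotopicalAlgebra in
include hc in
lemma acyclic_of_isLimit_of_isFibrant [ModelCategory (CochainComplex A ℤ)]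
    (hW : weakEquivalences (CochainComplex A ℤ) = HomologicalComplex.quasiIso A (.up ℤ))
    (h : ∀ i, (F.obj i).Acyclic) (h' : ∀ i, IsFibrant (F.obj i)) : c.pt.Acyclic := by
  have hz {K : CochainComplex A ℤ} : K.Acyclic ↔
      weakEquivalences (CochainComplex A ℤ) (terminal.from K) := by
    have h₀ : IsZero (⊤_ CochainComplex A ℤ) :=
      (IsZero.iff_id_eq_zero _).2 (terminal.hom_ext _ _)
    have h₁ (n : ℤ) : IsZero ((⊤_ CochainComplex A ℤ).homology n) :=
      (HomologicalComplex.homologyFunctor A (.up ℤ) n).map_isZero h₀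
    rw [hW, HomologicalComplex.mem_quasiIso_iff, quasiIso_iff]
    refine forall_congr' fun n => ?_
    rw [HomologicalComplex.exactAt_iff_isZero_homology, quasiIsoAt_iff_isIso_homologyMap]
    exact ⟨fun h => (h.isIso (h₁ n) _), fun h => (h₁ n).of_iso
      (asIso (HomologicalComplex.homologyMap (terminal.from K) n))⟩
  have hr (i : Discrete ι) : (cofibrations (CochainComplex A ℤ)).rlp (terminal.from (F.obj i)) := by
    rw [cofibrations_rlp]
    exact ⟨(h' i).mem, hz.1 (h i)⟩
  have hr' : (cofibrations (CochainComplex A ℤ)).rlp (terminal.from c.pt) := by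
    intro X Y f hf
    refine ⟨fun {a b} sq => ?_⟩
    have (i : Discrete ι) : ∃ l : Y ⟶ F.obj i, f ≫ l = a ≫ c.π.app i := by
      have := hr i f hf
      have sq : CommSq (a ≫ c.π.app i) f (terminal.from (F.obj i)) (terminal.from Y) :=
        ⟨terminal.hom_ext _ _⟩
      exact ⟨sq.lift, sq.fac_left⟩
    choose l hl using this
    exact ⟨⟨⟨hc.lift ⟨_, Discrete.natTrans l⟩, hc.hom_ext fun i => by
      rw [Category.assoc, hc.fac]; exact hl i, terminal.hom_ext _ _⟩⟩⟩
  rw [cofibrations_rlp] at hr'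
  exact hz.2 hr'.2

end Products

/-! ### Weak reflections by a solution set -/

section HomologyIn

lemma nonempty_cokernel_mk_kernel_iso {A : Type u} [Category.{v} A] [Abelian A]
    {X Y : A} (p : X ⟶ Y) [Epi p] :
    Nonempty (cokernel (Subobject.mk (kernel.ι p)).arrow ≅ Y) := by
  have e₁ : cokernel (Subobject.mk (kernel.ι p)).arrow ≅ cokernel (kernel.ι p) :=
    (cokernelIsoOfEq (Subobject.underlyingIso_hom_comp_eq_mk _).symm).trans
      (cokernelEpiComp _ _)
  exact ⟨e₁ ≪≫ (cokernelIsCokernel _).coconePointUniqueUpToIso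
    (Abelian.epiIsCokernelOfKernel _ (kernelIsKernel p))⟩

variable {A : Type u} [Category.{v} A] [Abelian A] [HasDerivedCategory.{w₁} A]

lemma homologyIn_Q_obj_iff (T : ObjectProperty A) [T.IsClosedUnderIsomorphisms]
    (K : CochainComplex A ℤ) :
    homologyIn T (DerivedCategory.Q.obj K) ↔ ∀ n, T (K.homology n) :=
  forall_congr' fun n => T.prop_iff_of_iso
    ((DerivedCategory.homologyFunctorFactors A n).app K)

lemma exists_Q_map_eq {X Y : CochainComplex A ℤ} [Y.IsKInjective]
    (f : DerivedCategory.Q.obj X ⟶ DerivedCategory.Q.obj Y) :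
    ∃ g : X ⟶ Y, DerivedCategory.Q.map g = f := by
  obtain ⟨x, hx⟩ := (CochainComplex.IsKInjective.Qh_map_bijective
    ((HomotopyCategory.quotient _ _).obj X) Y).2
      ((DerivedCategory.quotientCompQhIso A).hom.app _ ≫ f ≫
        (DerivedCategory.quotientCompQhIso A).inv.app _)
  obtain ⟨g, rfl⟩ := (HomotopyCategory.quotient A (.up ℤ)).map_surjective x
  refine ⟨g, ?_⟩
  have h₁ := (DerivedCategory.quotientCompQhIso A).hom.naturality g
  rw [← cancel_epi ((DerivedCategory.quotientCompQhIso A).hom.app _), ← h₁]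
  refine (congrArg (· ≫ _) hx).trans ?_
  simp

/-- The complexes whose homology objects are in `T` form a weakly reflective subcategory of the
derived category if `T` is closed under subobjects and products of injective fibrant complexes
with homology in `T` have homology in `T`. -/
lemma exists_weakReflection_homologyIn [IsGrothendieckAbelian.{w} A] (T : ObjectProperty A)
    [T.IsClosedUnderSubobjects]
    (hT : ∀ (ι : Type w) (Z : ι → CochainComplex A ℤ), (∀ i, IsInjectiveFibrant (Z i)) →
      (∀ i n, T ((Z i).homology n)) → ∀ n, T ((∏ᶜ Z).homology n)) (X : DerivedCategory A) :
    ∃ (Y : DerivedCategory A) (η : X ⟶ Y), homologyIn T Y ∧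
      ∀ (Z : DerivedCategory A) (f : X ⟶ Z), homologyIn T Z → ∃ g, f = η ≫ g := by
  obtain ⟨X₀, ⟨eX⟩⟩ : ∃ X₀ : CochainComplex A ℤ, Nonempty (DerivedCategory.Q.obj X₀ ≅ X) :=
    ⟨_, ⟨DerivedCategory.Q.objObjPreimageIso X⟩⟩
  obtain ⟨I, π, _⟩ := exists_epi_diskCoproduct.{w} (A := A) X₀
  obtain ⟨I', hI'⟩ := exists_strictIn (A := A) I
  let G := diskCoproduct A I'
  -- The solution set: quotients of one fixed complex `G` with homology in `T`, together with
  -- morphisms from `X₀`. It is small because `I'`, and hence `G`, does not depend on the target.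
  let κ := Σ (U : { U : Subobject G // ∀ n, T ((cokernel U.arrow).homology n) }),
    (X₀ ⟶ cokernel U.1.arrow)
  let N (k : κ) : CochainComplex A ℤ := cokernel k.1.1.arrow
  choose R r _ hr hR using fun k : κ => exists_injectiveFibrant_resolution.{w} (N k)
  let e : Shrink.{w} κ ≃ κ := (equivShrink κ).symm
  let W : CochainComplex A ℤ := ∏ᶜ fun k => R (e k)
  let η : X₀ ⟶ W := Pi.lift fun k => (e k).2 ≫ r (e k)
  refine ⟨DerivedCategory.Q.obj W, eX.inv ≫ DerivedCategory.Q.map η, ?_, fun Z f hZ => ?_⟩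
  · rw [homologyIn_Q_obj_iff]
    refine hT _ _ (fun k => hR _) fun k n => ?_
    have := hr (e k)
    exact T.prop_of_iso (asIso (HomologicalComplex.homologyMap (r (e k)) n)) ((e k).1.2 n)
  · obtain ⟨Y, i, _, _, hY⟩ :=
      exists_injectiveFibrant_resolution.{w} (A := A) (DerivedCategory.Q.objPreimage Z)
    have eZ : DerivedCategory.Q.obj Y ≅ Z :=
      (asIso (DerivedCategory.Q.map i)).symm ≪≫ DerivedCategory.Q.objObjPreimageIso Z
    have := hY.isKInjective
    obtain ⟨φ, hφ⟩ := exists_Q_map_eq (A := A) (eX.hom ≫ f ≫ eZ.inv)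
    -- Close off the image of `φ` to a strict subcomplex `M` of `Y`. Its homology embeds in that of
    -- `Y`, so it is in `T`, and `M` is a quotient of `G`; hence `M` and the factorization of `φ`
    -- appear in the solution set.
    obtain ⟨φ', ⟨h, hh⟩, hs⟩ := hI' (𝟙 Y) (π ≫ φ)
    rw [Category.comp_id] at hs
    let M := imageSubobject φ'
    have hM : M.Factors φ := by
      refine subobject_factors_of_epi _ _ π ?_
      rw [← hh]
      exact Subobject.factors_of_factors_right _ (imageSubobject_factors_self φ')
    have hY' : ∀ n, T (Y.homology n) := by
      rw [← homologyIn_Q_obj_iff]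
      intro n
      exact T.prop_of_iso ((DerivedCategory.homologyFunctor A n).mapIso eZ.symm) (hZ n)
    have hM' (n : ℤ) : T ((M : CochainComplex A ℤ).homology n) := by
      have := hs.mono_homologyMap n
      exact T.prop_of_mono (HomologicalComplex.homologyMap (imageSubobject φ').arrow n) (hY' n)
    obtain ⟨eM⟩ := nonempty_cokernel_mk_kernel_iso (factorThruImageSubobject φ')
    let k : κ := ⟨⟨Subobject.mk (kernel.ι (factorThruImageSubobject φ')), fun n => by
      exact T.prop_of_iso ((HomologicalComplex.homologyFunctor A (.up ℤ) n).mapIso eM.symm)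
        (hM' n)⟩,
      M.factorThru φ hM ≫ eM.inv⟩
    have := hr k
    obtain ⟨k', hk'⟩ := e.surjective k
    have hη : ∃ p : W ⟶ R k, η ≫ p = k.2 ≫ r k := by
      rw [← hk']
      exact ⟨Pi.π _ k', Pi.lift_π _ _⟩
    obtain ⟨p, hp⟩ := hη
    -- Project to the resolution of `M`, invert the resolution in the derived category, and include
    -- `M` in `Y`.
    refine ⟨DerivedCategory.Q.map p ≫ inv (DerivedCategory.Q.map (r k)) ≫
      DerivedCategory.Q.map (eM.hom ≫ M.arrow) ≫ eZ.hom, ?_⟩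
    rw [← cancel_epi eX.hom, ← cancel_mono eZ.inv]
    simp only [Category.assoc, Iso.hom_inv_id, Category.comp_id, Iso.hom_inv_id_assoc]
    rw [← hφ, ← Functor.map_comp_assoc, hp, Functor.map_comp_assoc, IsIso.hom_inv_id_assoc,
      ← Functor.map_comp]
    simp [k]

end HomologyIn


open ZeroObject

/-! ### Exact functors and adjunctions on complexes -/

section ComplexFunctors

variable {A : Type*} [Category* A] [Abelian A] {B : Type*} [Category* B] [Abelian B]

/-- Exact functors commute with homology. -/
noncomputable def mapHomologyIso (F : A ⥤ B) [F.Additive] [PreservesFiniteLimits F]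
    [PreservesFiniteColimits F] (K : CochainComplex A ℤ) (n : ℤ) :
    ((F.mapHomologicalComplex (.up ℤ)).obj K).homology n ≅ F.obj (K.homology n) :=
  (K.sc n).mapHomologyIso F

lemma unit_comp_map_of_counit_eq {F : A ⥤ B} {G : B ⥤ A} (adj : F ⊣ G) {X Y : A} {Z : B}
    (i : X ⟶ Y) (f : X ⟶ G.obj Z) (g : F.obj Y ⟶ Z)
    (h : F.map i ≫ g = F.map f ≫ adj.counit.app Z) :
    i ≫ adj.unit.app Y ≫ G.map g = f := by
  rw [← adj.unit_naturality_assoc, ← G.map_comp, h, G.map_comp, adj.unit_naturality_assoc,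
    adj.right_triangle_components, Category.comp_id]

/-- The exact left adjoint preserves monomorphic quasi-isomorphisms, so lifting problems transpose.
-/
lemma IsInjectiveFibrant.map_of_adjunction {F : A ⥤ B} {G : B ⥤ A} (adj : F ⊣ G) [F.Additive]
    [G.Additive] [PreservesFiniteLimits F] [PreservesFiniteColimits F] {Z : CochainComplex B ℤ}
    (hZ : IsInjectiveFibrant Z) :
    IsInjectiveFibrant ((G.mapHomologicalComplex (.up ℤ)).obj Z) := by
  intro K L i _ _ f
  let F' := F.mapHomologicalComplex (.up ℤ)
  have : Mono (F'.map i) := by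
    have (n : ℤ) : Mono ((F'.map i).f n) := inferInstanceAs (Mono (F.map (i.f n)))
    exact HomologicalComplex.mono_of_mono_f _ this
  obtain ⟨g, hg⟩ := hZ (F'.map i) (F'.map f ≫ complexCounit adj Z)
  refine ⟨complexUnit adj L ≫ (G.mapHomologicalComplex (.up ℤ)).map g, ?_⟩
  ext n
  exact unit_comp_map_of_counit_eq adj (i.f n) (f.f n) (g.f n) (HomologicalComplex.congr_hom hg n)

lemma preservesLimitsOfShape_mapHomologicalComplex (F : A ⥤ B) [F.Additive] {J : Type*}
    [Category* J] [HasLimitsOfShape J A] [PreservesLimitsOfShape J F] :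
    PreservesLimitsOfShape J (F.mapHomologicalComplex (.up ℤ)) :=
  HomologicalComplex.preservesLimitsOfShape_of_eval _ fun n =>
    inferInstanceAs (PreservesLimitsOfShape J (HomologicalComplex.eval A _ n ⋙ F))

lemma isZero_mapDerivedCategory_obj_iff [HasDerivedCategory.{w₁} A] [HasDerivedCategory.{w₂} B]
    (F : A ⥤ B) [F.Additive] [PreservesFiniteLimits F] [PreservesFiniteColimits F]
    (X : DerivedCategory A) :
    IsZero (F.mapDerivedCategory.obj X) ↔ homologyIn F.kernel X := by
  obtain ⟨K, ⟨e⟩⟩ : ∃ K : CochainComplex A ℤ, Nonempty (DerivedCategory.Q.obj K ≅ X) :=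
    ⟨_, ⟨DerivedCategory.Q.objObjPreimageIso X⟩⟩
  have h₁ : homologyIn F.kernel X ↔ ∀ n, IsZero (F.obj (K.homology n)) :=
    forall_congr' fun n => (F.mapIso ((DerivedCategory.homologyFunctor A n).mapIso e.symm ≪≫
      (DerivedCategory.homologyFunctorFactors A n).app K)).isZero_iff
  have h₂ : ((F.mapHomologicalComplex (.up ℤ)).obj K).Acyclic ↔
      ∀ n, IsZero (F.obj (K.homology n)) :=
    forall_congr' fun n => (HomologicalComplex.exactAt_iff_isZero_homology _ _).trans
      (mapHomologyIso F K n).isZero_iff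
  have e' : F.mapDerivedCategory.obj X ≅
      DerivedCategory.Q.obj ((F.mapHomologicalComplex (.up ℤ)).obj K) :=
    F.mapDerivedCategory.mapIso e.symm ≪≫ F.mapDerivedCategoryFactors.app K
  rw [h₁, ← h₂, e'.isZero_iff]
  constructor
  · intro h n
    rw [HomologicalComplex.exactAt_iff_isZero_homology]
    exact ((DerivedCategory.homologyFunctor B n).map_isZero h).of_iso
      ((DerivedCategory.homologyFunctorFactors B n).app _).symm
  · intro h
    have : QuasiIso (0 : (F.mapHomologicalComplex (.up ℤ)).obj K ⟶ 0) := by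
      rw [quasiIso_iff]
      intro n
      rw [quasiIsoAt_iff_isIso_homologyMap]
      exact ((HomologicalComplex.exactAt_iff_isZero_homology _ _).1 (h n)).isIso
        ((HomologicalComplex.homologyFunctor B (.up ℤ) n).map_isZero (isZero_zero _)) _
    exact (DerivedCategory.Q.map_isZero (isZero_zero _)).of_iso
      (asIso (DerivedCategory.Q.map (0 : (F.mapHomologicalComplex (.up ℤ)).obj K ⟶ 0)))

end ComplexFunctors

/-! ### Kernels of triangulated functors -/

section KernelSubcategory

variable {T E : Type*} [Category* T] [Category* E] [HasZeroObject T] [HasZeroObject E]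
  [Preadditive T] [Preadditive E] [HasShift T ℤ] [HasShift E ℤ]
  [∀ n : ℤ, (shiftFunctor T n).Additive] [∀ n : ℤ, (shiftFunctor E n).Additive]
  [Pretriangulated T] [Pretriangulated E] (r : T ⥤ E) [r.CommShift ℤ] [r.IsTriangulated]
  (P : ObjectProperty T)

include r in
lemma isTriangulated_of_iff_isZero (hP : ∀ X, P X ↔ IsZero (r.obj X)) : P.IsTriangulated := by
  have : P.IsClosedUnderIsomorphisms :=
    ⟨fun e h => (hP _).2 (((hP _).1 h).of_iso (r.mapIso e.symm))⟩
  exact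
    { exists_zero := ⟨0, isZero_zero _, (hP _).2 (r.map_isZero (isZero_zero _))⟩
      isStableUnderShiftBy := fun n => ⟨fun X hX => (hP _).2
        (((shiftFunctor E n).map_isZero ((hP X).1 hX)).of_iso ((r.commShiftIso n).app X))⟩
      toIsTriangulatedClosed₂ := .mk' fun T hT h₁ h₃ => (hP _).2
        (Pretriangulated.Triangle.isZero₂_of_isZero₁₃ _ (r.map_distinguished T hT)
          ((hP _).1 h₁) ((hP _).1 h₃)) }

end KernelSubcategory

/-! ### Products and the strict Voevodsky property -/

section EnrichedProducts

variable {V : Type u} [Category.{v} V] [MonoidalCategory V] [SymmetricCategory V]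
  [MonoidalClosed V] [Abelian V] [IsGrothendieckAbelian.{v} V]
  {C : Type v} [EnrichedCategory V C]

lemma homology_vanishingOn_iff (Y : CochainComplex (VFunctor V C) ℤ) (A : Set C) :
    (∀ n, vanishingOn V A (Y.homology n)) ↔ ∀ a ∈ A, (evalComplex Y a).Acyclic := by
  have h (a n) := (HomologicalComplex.exactAt_iff_isZero_homology (evalComplex Y a) n).trans
      (mapHomologyIso (VFunctor.eval V a) Y n).isZero_iff
  exact ⟨fun H a ha n => (h a n).2 (H n a ha), fun H n a ha => (h a n).1 (H a ha n)⟩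

variable [HasDerivedCategory.{w₁} V]

/-- The three alternatives are used only here, each through its own reason why acyclicity passes to
the product. -/
lemma acyclic_of_isLimit_evalComplex {J : Type v} (P : J → CochainComplex V ℤ)
    (hP : IsCompactGenerating (fun j => DerivedCategory.Q.obj (P j)))
    (hC : (∀ j, CochainComplex.IsKProjective (P j)) ∨
      (∀ Y : CochainComplex (VFunctor V C) ℤ, CochainComplex.IsKInjective Y →
        ∀ c : C, CochainComplex.IsKInjective (evalComplex Y c)) ∨
      HasFibrantEvaluationModelStructure V C)
    {ι : Type v} {F : Discrete ι ⥤ CochainComplex V ℤ} {c : Cone F} (hc : IsLimit c)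
    (Y : ι → CochainComplex (VFunctor V C) ℤ) (hY : ∀ i, IsInjectiveFibrant (Y i)) (a : C)
    (hF : ∀ i, F.obj i = evalComplex (Y i.as) a) (h : ∀ i, (evalComplex (Y i) a).Acyclic) :
    c.pt.Acyclic := by
  have h' (i) : (F.obj i).Acyclic := by rw [hF]; exact h _
  obtain hC | hC | ⟨_, hW, hC⟩ := hC
  · exact acyclic_of_isLimit_of_isKProjective hc P hP.isZero h'
  · exact acyclic_of_isLimit_of_isKInjective hc h'
      fun i => by rw [hF]; exact hC _ (hY _).isKInjective a
  · exact acyclic_of_isLimit_of_isFibrant hc hW h' fun i => by rw [hF]; exact hC _ (hY _) a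

/-- Products of injective fibrant complexes in `[C, V] / Q` with homology in `S_A^Q` have
homology in `S_A^Q`. -/
lemma homology_product_mem_imageInQuotient {J : Type v} (P : J → CochainComplex V ℤ)
    (hP : IsCompactGenerating (fun j => DerivedCategory.Q.obj (P j)))
    (hC : (∀ j, CochainComplex.IsKProjective (P j)) ∨
      (∀ Y : CochainComplex (VFunctor V C) ℤ, CochainComplex.IsKInjective Y →
        ∀ c : C, CochainComplex.IsKInjective (evalComplex Y c)) ∨
      HasFibrantEvaluationModelStructure V C)
    (A : Set C) (Q : ObjectProperty (VFunctor V C)) [Q.IsSerreClass]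
    {j : SerreQuotient Q ⥤ VFunctor V C} (adj : toQuotient Q ⊣ j)
    [IsGrothendieckAbelian.{v} (SerreQuotient Q)]
    (hstrict : StrictVoevodskyProperty (vanishingOn V A) Q) {ι : Type v}
    (Z : ι → CochainComplex (SerreQuotient Q) ℤ) (hZ : ∀ i, IsInjectiveFibrant (Z i))
    (h : ∀ i n, imageInQuotient (vanishingOn V A) Q ((Z i).homology n)) (n : ℤ) :
    imageInQuotient (vanishingOn V A) Q ((∏ᶜ Z).homology n) := by
  have : j.IsRightAdjoint := adj.isRightAdjoint
  have : j.Additive := adj.right_adjoint_additive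
  have : PreservesLimitsOfSize.{v, v} j := adj.rightAdjoint_preservesLimits
  have := isIso_counit_of_isLocalization Q.isoModSerre adj
  let j' := j.mapHomologicalComplex (.up ℤ)
  let L' := (toQuotient Q).mapHomologicalComplex (.up ℤ)
  have e (K : CochainComplex (SerreQuotient Q) ℤ) : L'.obj (j'.obj K) ≅ K := by
    have (n : ℤ) : IsIso ((complexCounit adj K).f n) :=
      inferInstanceAs (IsIso (adj.counit.app (K.X n)))
    have : IsIso (complexCounit adj K) := HomologicalComplex.Hom.isIso_of_components _
    exact asIso (complexCounit adj K)
  -- The localization of `j' (Z i)` is `Z i`, which is K-injective, so the strict property puts the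
  -- homology of `j' (Z i)` in `S_A`. As evaluation is exact, this says that the values at `a ∈ A`
  -- are acyclic.
  have hj (i) : ∀ a ∈ A, (evalComplex (j'.obj (Z i)) a).Acyclic := by
    have := (hZ i).isKInjective
    rw [← homology_vanishingOn_iff]
    refine hstrict.homology_mem _ (fun n => isLocalObj_section adj _)
      (CochainComplex.isKInjective_of_iso (e (Z i)).symm) fun n => ?_
    obtain ⟨X, hX, ⟨f⟩⟩ := h i n
    exact ⟨X, hX, ⟨f ≪≫
      (HomologicalComplex.homologyFunctor _ (.up ℤ) n).mapIso (e (Z i)).symm⟩⟩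
  have hW : ∀ a ∈ A, (evalComplex (j'.obj (∏ᶜ Z)) a).Acyclic := by
    intro a ha
    -- Both the section functor and evaluation preserve products, so the value at `a` of the section
    -- of the product is the product of the values.
    let Φ := (j ⋙ (VFunctor.eval V a : VFunctor V C ⥤ V)).mapHomologicalComplex (.up ℤ)
    have : PreservesLimitsOfShape (Discrete ι) Φ :=
      preservesLimitsOfShape_mapHomologicalComplex _
    exact acyclic_of_isLimit_evalComplex P hP hC
      (isLimitOfPreserves Φ (limit.isLimit (Discrete.functor Z))) (fun i => j'.obj (Z i))
      (fun i => (hZ i).map_of_adjunction adj) a (fun i => rfl) (fun i => hj i a ha)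
  rw [← homology_vanishingOn_iff] at hW
  exact ⟨_, hW n, ⟨(mapHomologyIso (toQuotient Q) (j'.obj (∏ᶜ Z)) n).symm ≪≫
    (HomologicalComplex.homologyFunctor _ (.up ℤ) n).mapIso (e _)⟩⟩

end EnrichedProducts

end CategoryTheory

/-! ### The recollement -/

theorem theorem5p10
    {V : Type u} [Category.{v} V] [MonoidalCategory V] [SymmetricCategory V]
    [MonoidalClosed V] [Abelian V] [IsGrothendieckAbelian.{v} V]
    {C : Type v} [EnrichedCategory V C]
    [HasDerivedCategory.{w₁} V] [HasDerivedCategory.{w₂} (VFunctor V C)]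
    -- compact generators of the derived category of `V`, satisfying one of three conditions
    {J : Type v} (P : J → CochainComplex V ℤ)
    (hP : IsCompactGenerating (fun j => DerivedCategory.Q.obj (P j)))
    (hC : (∀ j, CochainComplex.IsKProjective (P j)) ∨
      (∀ Y : CochainComplex (VFunctor V C) ℤ, CochainComplex.IsKInjective Y →
        ∀ c : C, CochainComplex.IsKInjective (evalComplex Y c)) ∨
      HasFibrantEvaluationModelStructure V C)
    -- the class `A` of objects of `C` and the localizing subcategory `Q` of `[C, V]`
    (A : Set C) (Q : ObjectProperty (VFunctor V C)) [Q.IsSerreClass] (hQ : IsLocalizing.{v} Q)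
    [HasDerivedCategory.{w₃} (SerreQuotient Q)]
    [HasDerivedCategory.{w₄} (SerreQuotient (join.{v} Q (vanishingOn V A)))]
    (hgen : IsCompactlyGeneratedTriangulated.{v} (DerivedCategory (SerreQuotient Q)))
    (hcompact : ∀ X : DerivedCategory (VFunctor V C), IsCompactObj.{v} X →
      IsCompactObj.{v} ((toQuotient Q).mapDerivedCategory.obj X))
    (hstrict : StrictVoevodskyProperty (vanishingOn V A) Q) :
    -- `S_A` and `S_A^Q` are localizing, and `[C, V] / Q ⥤ [C, V] / J_A` is the
    -- `S_A^Q`-localization functor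
    IsLocalizing.{v} (vanishingOn V A) ∧
    IsLocalizing.{v} (imageInQuotient (vanishingOn V A) Q) ∧
    (∃ _ : (imageInQuotient (vanishingOn V A) Q).IsSerreClass,
      (quotientFunctor (le_join_left.{v} Q (vanishingOn V A))).IsLocalization
        (imageInQuotient (vanishingOn V A) Q).isoModSerre) ∧
    -- the recollement
    ∃ (_ : (homologyIn (imageInQuotient (vanishingOn V A) Q)).IsTriangulated)
      (R : Recollement (homologyIn (imageInQuotient (vanishingOn V A) Q)).ι
        (quotientFunctor (le_join_left.{v} Q (vanishingOn V A))).mapDerivedCategory)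
    -- its functor `R.rR` is induced by K-injective resolutions
      (s : SerreQuotient (join.{v} Q (vanishingOn V A)) ⥤ SerreQuotient Q) (_ : s.Additive)
      (_ : quotientFunctor (le_join_left.{v} Q (vanishingOn V A)) ⊣ s)
      (K : KInjectiveResolutionFunctor (SerreQuotient (join.{v} Q (vanishingOn V A)))),
      Nonempty (R.rR ≅ K.k ⋙ s.mapHomotopyCategory (ComplexShape.up ℤ) ⋙ DerivedCategory.Qh) := by
  have hS : IsLocalizing.{v} (vanishingOn V A) := VFunctor.isLocalizing_vanishingOn A
  have hV := hstrict.voevodskyProperty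
  have hJ := join_isLocalizing.{v} Q (vanishingOn V A)
  have := hQ.isGrothendieckAbelian_serreQuotient
  have := hJ.isGrothendieckAbelian_serreQuotient
  obtain ⟨j, adj, _, _⟩ := hQ.exists_adjunction
  have hT := isLocalizing_imageInQuotient adj hQ hS hV
  have := hT.isSerreClass
  refine ⟨hS, hT, isLocalization_quotientFunctor hQ hS hV, ?_⟩
  obtain ⟨s, a, hs, _⟩ := exists_quotientFunctor_adjunction
    (le_join_left.{v} Q (vanishingOn V A)) hQ hJ
  obtain ⟨K, b, _⟩ := exists_derived_adjunction a
  have hker : (quotientFunctor (le_join_left.{v} Q (vanishingOn V A))).kernel =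
      imageInQuotient (vanishingOn V A) Q := by
    ext Z
    exact isZero_quotientFunctor_obj_iff adj hQ hS hV Z
  have hE (X) : homologyIn (imageInQuotient (vanishingOn V A) Q) X ↔
      IsZero ((quotientFunctor (le_join_left.{v} Q (vanishingOn V A))).mapDerivedCategory.obj
        X) := by
    rw [isZero_mapDerivedCategory_obj_iff, hker]
  have hE₁ := isTriangulated_of_iff_isZero _ _ hE
  have : (homologyIn (imageInQuotient (vanishingOn V A) Q)).IsStableUnderRetracts :=
    ⟨fun r h => (hE _).2 (IsZero.of_mono (r.map (Functor.mapDerivedCategory _)).i ((hE _).1 h))⟩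
  have := b.fullyFaithfulROfIsIsoCounit.full
  have := b.fullyFaithfulROfIsIsoCounit.faithful
  obtain ⟨_, _, hgen⟩ := hgen
  -- Countable coproducts are needed to split the idempotent in the passage from weak reflections to
  -- reflections.
  have := hgen.hasCoproducts (ULift.{v} ℕ)
  have : HasColimitsOfShape (Discrete ℕ) (DerivedCategory (SerreQuotient Q)) :=
    hasColimitsOfShape_of_equivalence (Discrete.equivalence Equiv.ulift.{v})
  obtain ⟨R, hR⟩ := exists_recollement_of_reflections _ b _ hE
    (exists_isReflection_of_weak _ (exists_weakReflection_homologyIn.{v} _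
      fun _ Z hZ hZ' => homology_product_mem_imageInQuotient P hP hC A Q adj hstrict Z hZ hZ'))
  exact ⟨hE₁, R, s, hs, a, K, ⟨eqToIso hR⟩⟩
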